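/- Let $k$ be a field, $\mathcal{M}$ a bicomplete $k$-linear abelian category, and $\mathcal{C}$ a $k$-linear Reedy category: a small $k$-linear category with a degree function $\deg$ from its objects to the ordinals and two $k$-linear subcategories $\mathcal{C}^+,\mathcal{C}^-$ having the same objects as $\mathcal{C}$ such that (a) $\mathrm{End}_{\mathcal{C}^{\pm}}(c)\cong k$ as $k$-vector spaces for all $c$; (b) if $c\ne d$ and $\mathcal{C}^+(c,d)\neq 0$ then $\deg c<\deg d$, and if $c\neq d$ and $\mathcal{C}^-(c,d)\ne 0$ then $\deg c>\deg d$; (c) for all $c,d$ composition induces an isomorphism $\bigoplus_{e}\mathcal{C}^+(e,d)\otimes_k\mathcal{C}^-(c,e)\to\mathcal{C}(c,d)$. Let $\mathcal{M}^{\mathcal{C}}$ be the abelian category of $k$-linear functors $\mathcal{C}\to\mathcal{M}$. For $X\in\mathcal{M}^{\mathcal{C}}$ and an object $c$ of degree $\alpha$, let $\mathcal{C}^{\pm}_{<\alpha}$ be the full subcategory of $\mathcal{C}^{\pm}$ on the objects of degree $<\alpha$. The latching object is the weighted colimit (coend) $L_cX=\mathcal{C}^+(-,c)\otimes_{\mathcal{C}^+_{<\alpha}}X=\int^{d\in\mathcal{C}^+_{<\alpha}}\mathcal{C}^+(d,c)\otimes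 X(d)$, and the matching object is the weighted limit (end) $M_cX=\hom_{\mathcal{C}^-_{<\alpha}}(\mathcal{C}^-(c,-),X)=\int_{d\in\mathcal{C}^-_{<\alpha}}\hom(\mathcal{C}^-(c,d),X(d))$; here, for a $k$-vector space $V$ with basis $I$ and $N\in\mathcal{M}$, $V\otimes N=N^{(I)}$ and $\hom(V,N)=N^{I}$. Let $l^X_c\colon L_cX\to X(c)$ and $m^X_c\colon X(c)\to M_cX$ be the canonical morphisms given by the action of $X$ on morphisms. For a class $\mathcal{S}$ of objects of $\mathcal{M}$ put \[\Phi(\mathcal{S})=\{X\in\mathcal{M}^{\mathcal{C}} : \forall c\in\mathcal{C},\ l^X_c\text{ is a monomorphism and }\operatorname{coker} l^X_c\in\mathcal{S}\},\] \[\Psi(\mathcal{S})=\{X\in\mathcal{M}^{\mathcal{C}} : \forall c\in\mathcal{C},\ m^X_c\text{ is an epimorphism and }\ker m^X_c\in\mathcal{S}\}.\] A pair $(\mathcal{X},\mathcal{Y})$ of classes of objects of an abelian category is a cotorsion pair if $\mathcal{X}=\{X:\operatorname{Ext}^1(X,Y)=0\ \forall Y\in\mathcal{Y}\}$ and $\mathcal{Y}=\{Y:\operatorname{Ext}^1(X,Y)=0\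 \forall X\in\mathcal{X}\}$ (Yoneda Ext). It is complete if for every object $N$ there are short exact sequences $0\to N\to Y\to X\to0$ and $0\to Y'\to X'\to N\to 0$ with $X,X'\in\mathcal{X}$ and $Y,Y'\in\mathcal{Y}$; it is hereditary if $\operatorname{Ext}^i(X,Y)=0$ for all $X\in\mathcal{X}$, $Y\in\mathcal{Y}$, $i\geq1$. The class $\mathcal{X}$ is generating if every object is a quotient of an object of $\mathcal{X}$, and $\mathcal{Y}$ is cogenerating if every object embeds into an object of $\mathcal{Y}$. Theorem. Let $(\mathcal{A},\mathcal{B})$ be a cotorsion pair in $\mathcal{M}$ such that $\mathcal{A}$ is generating and $\mathcal{B}$ is cogenerating. Then: (1) $(\Phi(\mathcal{A}),\Psi(\mathcal{B}))$ is a cotorsion pair in $\mathcal{M}^{\mathcal{C}}$ with $\Phi(\mathcal{A})$ generating and $\Psi(\mathcal{B})$ cogenerating. (2) If $(\mathcal{A},\mathcal{B})$ is a complete cotorsion pair, so is $(\Phi(\mathcal{A}),\Psi(\mathcal{B}))$. (3) If $(\mathcal{A},\mathcal{B})$ is a hereditary cotorsion pair, so is $(\Phi(\mathcal{A}),\Psi(\mathcal{B}))$.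 -/

import Mathlib

open CategoryTheory CategoryTheory.Limits Opposite

universe t w v u

namespace LinearReedy

noncomputable section

/-! ### Cotorsion pairs in an abelian category -/

section Cotorsion

variable {D : Type u} [Category.{v} D] [Abelian D]

/-- The Yoneda Ext group `Ext^n(X, Y)` of an arbitrary abelian category vanishes. -/
def ExtVanishes (X Y : D) (n : ℕ) : Prop :=
  letI : HasExt.{max u v} D := HasExt.standard D
  Subsingleton (Abelian.Ext.{max u v} X Y n)

/-- The class `⊥𝒴` of all `X` with `Ext^1(X, Y) = 0` for every `Y` in `𝒴`. -/
def leftPerp (𝒴 : ObjectProperty D) : ObjectProperty D :=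
  fun X => ∀ Y : D, 𝒴 Y → ExtVanishes X Y 1

/-- The class `𝒳⊥` of all `Y` with `Ext^1(X, Y) = 0` for every `X` in `𝒳`. -/
def rightPerp (𝒳 : ObjectProperty D) : ObjectProperty D :=
  fun Y => ∀ X : D, 𝒳 X → ExtVanishes X Y 1

/-- `(𝒳, 𝒴)` is a cotorsion pair. -/
structure IsCotorsionPair (𝒳 𝒴 : ObjectProperty D) : Prop where
  left_eq : 𝒳 = leftPerp 𝒴
  right_eq : 𝒴 = rightPerp 𝒳

/-- The approximation sequences of a complete cotorsion pair exist: for every object `M` there are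
short exact sequences `0 → M → Y → X → 0` and `0 → Y' → X' → M → 0` with `X, X'` in `𝒳` and
`Y, Y'` in `𝒴`. -/
structure HasApproximations (𝒳 𝒴 : ObjectProperty D) : Prop where
  right_approx : ∀ M : D, ∃ (Y X : D) (f : M ⟶ Y) (g : Y ⟶ X) (h : f ≫ g = 0),
    𝒳 X ∧ 𝒴 Y ∧ (ShortComplex.mk f g h).ShortExact
  left_approx : ∀ M : D, ∃ (Y' X' : D) (f : Y' ⟶ X') (g : X' ⟶ M) (h : f ≫ g = 0),
    𝒳 X' ∧ 𝒴 Y' ∧ (ShortComplex.mk f g h).ShortExact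

/-- `(𝒳, 𝒴)` is a complete cotorsion pair. -/
structure IsCompleteCotorsionPair (𝒳 𝒴 : ObjectProperty D) : Prop extends
  IsCotorsionPair 𝒳 𝒴, HasApproximations 𝒳 𝒴

/-- `(𝒳, 𝒴)` is a hereditary cotorsion pair. -/
structure IsHereditaryCotorsionPair (𝒳 𝒴 : ObjectProperty D) : Prop extends
  IsCotorsionPair 𝒳 𝒴 where
  ext_vanishes : ∀ X Y : D, 𝒳 X → 𝒴 Y → ∀ i : ℕ, 1 ≤ i → ExtVanishes X Y i

/-- Every object is a quotient of an object of `𝒳`. -/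
def IsGenerating (𝒳 : ObjectProperty D) : Prop :=
  ∀ M : D, ∃ (X : D) (p : X ⟶ M), 𝒳 X ∧ Epi p

/-- Every object embeds into an object of `𝒴`. -/
def IsCogenerating (𝒴 : ObjectProperty D) : Prop :=
  ∀ M : D, ∃ (Y : D) (i : M ⟶ Y), 𝒴 Y ∧ Mono i

end Cotorsion

/-! ### The abelian category of `k`-linear functors -/

section LinearFunctors

open scoped ZeroObject

variable (k : Type w) [Field k] (C : Type v) [Category.{v} C] [Preadditive C] [Linear k C]
  (M : Type u) [Category.{v} M] [Abelian M] [Linear k M]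

/-- The property of a functor of being `k`-linear on all hom spaces. -/
def isLinearFunctor : ObjectProperty (C ⥤ M) :=
  fun F => F.Additive ∧ F.Linear k

/-- The category of `k`-linear functors from `C` to `M` and all natural transformations. -/
abbrev LinearFunctorCategory := (isLinearFunctor k C M).FullSubcategory

instance (X : LinearFunctorCategory k C M) : X.obj.Additive := X.property.1

instance (X : LinearFunctorCategory k C M) : X.obj.Linear k := X.property.2

instance : (isLinearFunctor k C M).IsClosedUnderSubobjects where
  prop_of_mono {F G} f hf hG := by
    have h1 := hG.1
    have h2 := hG.2
    refine ⟨⟨fun {X Y a b} => ?_⟩, ⟨fun {X Y} a r => ?_⟩⟩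
    · rw [← cancel_mono (f.app Y)]
      rw [Preadditive.add_comp, f.naturality, f.naturality, f.naturality, G.map_add,
        Preadditive.comp_add]
    · rw [← cancel_mono (f.app Y)]
      rw [Linear.smul_comp, f.naturality, f.naturality, G.map_smul, Linear.comp_smul]

instance : (isLinearFunctor k C M).IsClosedUnderQuotients where
  prop_of_epi {F G} f hf hF := by
    have h1 := hF.1
    have h2 := hF.2
    refine ⟨⟨fun {X Y a b} => ?_⟩, ⟨fun {X Y} a r => ?_⟩⟩
    · rw [← cancel_epi (f.app X)]
      rw [Preadditive.comp_add, ← f.naturality, ← f.naturality, ← f.naturality, F.map_add,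
        Preadditive.add_comp]
    · rw [← cancel_epi (f.app X)]
      rw [Linear.comp_smul, ← f.naturality, ← f.naturality, F.map_smul, Linear.smul_comp]

instance : (isLinearFunctor k C M).ContainsZero where
  exists_zero := by
    refine ⟨(Functor.const C).obj (0 : M), Functor.isZero _ (fun _ => isZero_zero M),
      ⟨fun {X Y a b} => ?_⟩, ⟨fun {X Y} a r => ?_⟩⟩
    · exact (isZero_zero M).eq_of_src _ _
    · exact (isZero_zero M).eq_of_src _ _

instance : (isLinearFunctor k C M).IsClosedUnderFiniteProducts where
  isClosedUnderLimitsOfShape J _ := ⟨by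
    rintro G ⟨p, hp⟩
    have hmono : ∀ (Y : C) {Z : M} (a b : Z ⟶ G.obj Y),
        (∀ j, a ≫ (p.π.app j).app Y = b ≫ (p.π.app j).app Y) → a = b := fun Y Z a b h =>
      (isLimitOfPreserves ((evaluation C M).obj Y) p.isLimit).hom_ext h
    have hnat : ∀ (j : Discrete J) {X Y : C} (a : X ⟶ Y), G.map a ≫ (p.π.app j).app Y =
        (p.π.app j).app X ≫ (p.diag.obj j).map a := fun j _ _ a => (p.π.app j).naturality a
    refine ⟨⟨fun {X Y a b} => hmono Y _ _ fun j => ?_⟩,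
      ⟨fun {X Y} a r => hmono Y _ _ fun j => ?_⟩⟩
    · have := (hp j).1
      rw [Preadditive.add_comp, hnat, hnat, hnat, Functor.map_add, Preadditive.comp_add]
    · have := (hp j).2
      rw [Linear.smul_comp, hnat, hnat, Functor.map_smul, Linear.comp_smul]⟩

end LinearFunctors

/-! ### Tensors, cotensors, and limits and colimits weighted by `k`-linear functors -/

section Weighted

variable {k : Type w} [Field k] {M : Type u} [Category.{v} M] [Abelian M] [Linear k M]

section Tensor

variable (V : Type v) [AddCommGroup V] [Module k V] (A : M)

/-- The tensor product `V ⊗ A` of a `k`-vector space with an object of `M`: the coproduct of copies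
of `A` indexed by a basis of `V`. -/
def tensor (k : Type w) [Field k] [Linear k M] [HasColimits M] (V : Type v) [AddCommGroup V]
    [Module k V] (A : M) : M :=
  ∐ fun _ : Module.Basis.ofVectorSpaceIndex k V => A

/-- The universal `k`-linear map `V → M(A, V ⊗ A)`. -/
def tensorι [HasColimits M] : V →ₗ[k] (A ⟶ tensor k V A) :=
  (Module.Basis.ofVectorSpace k V).constr k
    (fun b => Sigma.ι (fun _ : Module.Basis.ofVectorSpaceIndex k V => A) b)

variable {V A}

theorem tensorι_basis [HasColimits M] (b : Module.Basis.ofVectorSpaceIndex k V) :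
    tensorι V A (Module.Basis.ofVectorSpace k V b) =
      Sigma.ι (fun _ : Module.Basis.ofVectorSpaceIndex k V => A) b :=
  (Module.Basis.ofVectorSpace k V).constr_basis k _ b

/-- The morphism `V ⊗ A → N` corresponding to a `k`-linear map `V → M(A, N)`. -/
def tensorDesc [HasColimits M] {N : M} (f : V →ₗ[k] (A ⟶ N)) : tensor k V A ⟶ N :=
  Sigma.desc (fun b => f (Module.Basis.ofVectorSpace k V b))

theorem tensorι_desc [HasColimits M] {N : M} (f : V →ₗ[k] (A ⟶ N)) (x : V) :
    tensorι V A x ≫ tensorDesc f = f x := by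
  have : (Linear.rightComp k A (tensorDesc f)).comp (tensorι V A) = f := by
    refine (Module.Basis.ofVectorSpace k V).ext (fun b => ?_)
    rw [LinearMap.comp_apply, tensorι_basis]
    exact Sigma.ι_desc (fun b => f (Module.Basis.ofVectorSpace k V b)) b
  exact LinearMap.congr_fun this x

theorem tensor_hom_ext [HasColimits M] {N : M} {f g : tensor k V A ⟶ N}
    (h : ∀ x : V, tensorι V A x ≫ f = tensorι V A x ≫ g) : f = g := by
  refine Sigma.hom_ext _ _ (fun b => ?_)
  have := h (Module.Basis.ofVectorSpace k V b)
  rwa [tensorι_basis] at this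

variable (A) in
/-- The cotensor product `hom(V, A)` of a `k`-vector space with an object of `M`: the product of
copies of `A` indexed by a basis of `V`. -/
def cotensor (k : Type w) [Field k] [Linear k M] [HasLimits M] (V : Type v) [AddCommGroup V]
    [Module k V] (A : M) : M :=
  ∏ᶜ fun _ : Module.Basis.ofVectorSpaceIndex k V => A

variable (V A) in
/-- The universal `k`-linear map `V → M(hom(V, A), A)`. -/
def cotensorπ [HasLimits M] : V →ₗ[k] (cotensor k V A ⟶ A) :=
  (Module.Basis.ofVectorSpace k V).constr k
    (fun b => Pi.π (fun _ : Module.Basis.ofVectorSpaceIndex k V => A) b)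

theorem cotensorπ_basis [HasLimits M] (b : Module.Basis.ofVectorSpaceIndex k V) :
    cotensorπ V A (Module.Basis.ofVectorSpace k V b) =
      Pi.π (fun _ : Module.Basis.ofVectorSpaceIndex k V => A) b :=
  (Module.Basis.ofVectorSpace k V).constr_basis k _ b

/-- The morphism `N → hom(V, A)` corresponding to a `k`-linear map `V → M(N, A)`. -/
def cotensorLift [HasLimits M] {N : M} (f : V →ₗ[k] (N ⟶ A)) : N ⟶ cotensor k V A :=
  Pi.lift (fun b => f (Module.Basis.ofVectorSpace k V b))

theorem cotensorLift_π [HasLimits M] {N : M} (f : V →ₗ[k] (N ⟶ A)) (x : V) :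
    cotensorLift f ≫ cotensorπ V A x = f x := by
  have : (Linear.leftComp k A (cotensorLift f)).comp (cotensorπ V A) = f := by
    refine (Module.Basis.ofVectorSpace k V).ext (fun b => ?_)
    rw [LinearMap.comp_apply, cotensorπ_basis]
    exact Pi.lift_π (fun b => f (Module.Basis.ofVectorSpace k V b)) b
  exact LinearMap.congr_fun this x

theorem cotensor_hom_ext [HasLimits M] {N : M} {f g : N ⟶ cotensor k V A}
    (h : ∀ x : V, f ≫ cotensorπ V A x = g ≫ cotensorπ V A x) : f = g := by
  refine Pi.hom_ext _ _ (fun b => ?_)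
  have := h (Module.Basis.ofVectorSpace k V b)
  rwa [cotensorπ_basis] at this

end Tensor

variable {J : Type v} [Category.{v} J]

section Colimit

variable [HasColimits M] (W : Jᵒᵖ ⥤ ModuleCat.{v} k) (X : J ⥤ M)

/-- For `r : i ⟶ j`, the difference of the two morphisms
`W(j) ⊗ X(i) → W(j) ⊗ X(j)` and `W(j) ⊗ X(i) → W(i) ⊗ X(i)` into the coproduct of all
`W(j) ⊗ X(j)`. -/
def coendRelation (r : Σ i j : J, (i ⟶ j)) :
    tensor k (W.obj (op r.2.1)) (X.obj r.1) ⟶ ∐ fun j : J => tensor k (W.obj (op j)) (X.obj j) :=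
  tensorDesc ((Linear.leftComp k _ (X.map r.2.2)).comp (tensorι _ (X.obj r.2.1))) ≫
      Sigma.ι (fun j : J => tensor k (W.obj (op j)) (X.obj j)) r.2.1 -
    tensorDesc ((tensorι _ (X.obj r.1)).comp (W.map r.2.2.op).hom) ≫
      Sigma.ι (fun j : J => tensor k (W.obj (op j)) (X.obj j)) r.1

/-- The colimit `W ⊗_J X` of `X` weighted by `W`, that is, the coend `∫^j W(j) ⊗ X(j)`. -/
def weightedColimit : M :=
  cokernel (Sigma.desc (coendRelation W X))

/-- The projection `∐_j W(j) ⊗ X(j) → W ⊗_J X`. -/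
def weightedColimitProj :
    (∐ fun j : J => tensor k (W.obj (op j)) (X.obj j)) ⟶ weightedColimit W X :=
  cokernel.π (Sigma.desc (coendRelation W X))

/-- The universal cocone: the `k`-linear maps `W(j) → M(X(j), W ⊗_J X)`. -/
def weightedColimitι (j : J) : W.obj (op j) →ₗ[k] (X.obj j ⟶ weightedColimit W X) :=
  (Linear.rightComp k (X.obj j)
    (Sigma.ι (fun j : J => tensor k (W.obj (op j)) (X.obj j)) j ≫
      weightedColimitProj W X)).comp (tensorι _ (X.obj j))

theorem weightedColimitι_apply (j : J) (x : W.obj (op j)) :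
    weightedColimitι W X j x = tensorι _ (X.obj j) x ≫
      Sigma.ι (fun j : J => tensor k (W.obj (op j)) (X.obj j)) j ≫ weightedColimitProj W X :=
  rfl

theorem weightedColimit_w {i j : J} (r : i ⟶ j) (x : W.obj (op j)) :
    X.map r ≫ weightedColimitι W X j x = weightedColimitι W X i ((W.map r.op).hom x) := by
  have h : coendRelation W X ⟨i, j, r⟩ ≫ weightedColimitProj W X = 0 := by
    have h0 : Sigma.desc (coendRelation W X) ≫ weightedColimitProj W X = 0 :=
      cokernel.condition _
    rw [← Sigma.ι_desc (coendRelation W X) ⟨i, j, r⟩, Category.assoc, h0, comp_zero]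
  have h2 := tensorι _ (X.obj i) x ≫= h
  rw [comp_zero, coendRelation, Preadditive.sub_comp, Preadditive.comp_sub, sub_eq_zero] at h2
  simp only [← Category.assoc, tensorι_desc] at h2
  simpa [weightedColimitι_apply] using h2

variable {W X}

/-- The morphism out of `W ⊗_J X` given by a natural family of `k`-linear maps
`W(j) → M(X(j), N)`. -/
def weightedColimitDesc {N : M} (f : ∀ j : J, W.obj (op j) →ₗ[k] (X.obj j ⟶ N))
    (hf : ∀ (i j : J) (r : i ⟶ j) (x : W.obj (op j)),
      X.map r ≫ f j x = f i ((W.map r.op).hom x)) :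
    weightedColimit W X ⟶ N :=
  cokernel.desc _ (Sigma.desc (fun j => tensorDesc (f j))) (by
    refine Sigma.hom_ext _ _ (fun r => ?_)
    rw [← Category.assoc, Sigma.ι_desc, comp_zero]
    refine tensor_hom_ext (fun x => ?_)
    rw [coendRelation, Preadditive.sub_comp, Preadditive.comp_sub, comp_zero, sub_eq_zero]
    simp only [Category.assoc, Sigma.ι_desc]
    simp only [← Category.assoc, tensorι_desc]
    simpa [tensorι_desc] using hf _ _ r.2.2 x)

theorem weightedColimitι_desc {N : M} (f : ∀ j : J, W.obj (op j) →ₗ[k] (X.obj j ⟶ N))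
    (hf : ∀ (i j : J) (r : i ⟶ j) (x : W.obj (op j)),
      X.map r ≫ f j x = f i ((W.map r.op).hom x)) (j : J) (x : W.obj (op j)) :
    weightedColimitι W X j x ≫ weightedColimitDesc f hf = f j x := by
  have h : weightedColimitProj W X ≫ weightedColimitDesc f hf =
      Sigma.desc (fun j => tensorDesc (f j)) := cokernel.π_desc _ _ _
  rw [weightedColimitι_apply, Category.assoc, Category.assoc, h, Sigma.ι_desc, tensorι_desc]

theorem weightedColimit_hom_ext {N : M} {f g : weightedColimit W X ⟶ N}
    (h : ∀ (j : J) (x : W.obj (op j)),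
      weightedColimitι W X j x ≫ f = weightedColimitι W X j x ≫ g) : f = g := by
  have : Epi (weightedColimitProj W X) :=
    inferInstanceAs (Epi (cokernel.π (Sigma.desc (coendRelation W X))))
  refine (cancel_epi (weightedColimitProj W X)).1 ?_
  refine Sigma.hom_ext _ _ (fun j => tensor_hom_ext (fun x => ?_))
  simpa [weightedColimitι_apply] using h j x

end Colimit

section Limit

variable [HasLimits M] (U : J ⥤ ModuleCat.{v} k) (X : J ⥤ M)

/-- For `r : i ⟶ j`, the difference of the two morphisms from the product of all `hom(U(j), X(j))`
to `hom(U(i), X(j))` that factor through `hom(U(i), X(i))` and through `hom(U(j), X(j))`. -/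
def endRelation (r : Σ i j : J, (i ⟶ j)) :
    (∏ᶜ fun j : J => cotensor k (U.obj j) (X.obj j)) ⟶ cotensor k (U.obj r.1) (X.obj r.2.1) :=
  Pi.π (fun j : J => cotensor k (U.obj j) (X.obj j)) r.1 ≫
      cotensorLift ((Linear.rightComp k _ (X.map r.2.2)).comp (cotensorπ _ (X.obj r.1))) -
    Pi.π (fun j : J => cotensor k (U.obj j) (X.obj j)) r.2.1 ≫
      cotensorLift ((cotensorπ _ (X.obj r.2.1)).comp (U.map r.2.2).hom)

/-- The limit `hom_J(U, X)` of `X` weighted by `U`, that is, the end `∫_j hom(U(j), X(j))`. -/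
def weightedLimit : M :=
  kernel (Pi.lift (endRelation U X))

/-- The inclusion `hom_J(U, X) → ∏_j hom(U(j), X(j))`. -/
def weightedLimitIncl :
    weightedLimit U X ⟶ ∏ᶜ fun j : J => cotensor k (U.obj j) (X.obj j) :=
  kernel.ι (Pi.lift (endRelation U X))

/-- The universal cone: the `k`-linear maps `U(j) → M(hom_J(U, X), X(j))`. -/
def weightedLimitπ (j : J) : U.obj j →ₗ[k] (weightedLimit U X ⟶ X.obj j) :=
  (Linear.leftComp k (X.obj j)
    (weightedLimitIncl U X ≫
      Pi.π (fun j : J => cotensor k (U.obj j) (X.obj j)) j)).comp (cotensorπ _ (X.obj j))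

theorem weightedLimitπ_apply (j : J) (x : U.obj j) :
    weightedLimitπ U X j x = (weightedLimitIncl U X ≫
      Pi.π (fun j : J => cotensor k (U.obj j) (X.obj j)) j) ≫ cotensorπ _ (X.obj j) x :=
  rfl

theorem weightedLimit_w {i j : J} (r : i ⟶ j) (x : U.obj i) :
    weightedLimitπ U X i x ≫ X.map r = weightedLimitπ U X j ((U.map r).hom x) := by
  have h : weightedLimitIncl U X ≫ endRelation U X ⟨i, j, r⟩ = 0 := by
    have h0 : weightedLimitIncl U X ≫ Pi.lift (endRelation U X) = 0 := kernel.condition _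
    rw [← Pi.lift_π (endRelation U X) ⟨i, j, r⟩, ← Category.assoc, h0, zero_comp]
  have h2 := h =≫ cotensorπ _ (X.obj j) x
  rw [zero_comp, endRelation, Preadditive.comp_sub, Preadditive.sub_comp, sub_eq_zero] at h2
  simp only [Category.assoc, cotensorLift_π] at h2
  simpa [weightedLimitπ_apply] using h2

variable {U X}

/-- The morphism into `hom_J(U, X)` given by a natural family of `k`-linear maps
`U(j) → M(N, X(j))`. -/
def weightedLimitLift {N : M} (f : ∀ j : J, U.obj j →ₗ[k] (N ⟶ X.obj j))
    (hf : ∀ (i j : J) (r : i ⟶ j) (x : U.obj i),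
      f i x ≫ X.map r = f j ((U.map r).hom x)) :
    N ⟶ weightedLimit U X :=
  kernel.lift _ (Pi.lift (fun j => cotensorLift (f j))) (by
    refine Pi.hom_ext _ _ (fun r => ?_)
    rw [Category.assoc, Pi.lift_π, zero_comp]
    refine cotensor_hom_ext (fun x => ?_)
    rw [endRelation, Preadditive.comp_sub, Preadditive.sub_comp, zero_comp, sub_eq_zero]
    simp only [← Category.assoc, Pi.lift_π]
    simp only [Category.assoc, cotensorLift_π]
    simpa [← Category.assoc, cotensorLift_π] using hf _ _ r.2.2 x)

theorem weightedLimitLift_π {N : M} (f : ∀ j : J, U.obj j →ₗ[k] (N ⟶ X.obj j))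
    (hf : ∀ (i j : J) (r : i ⟶ j) (x : U.obj i),
      f i x ≫ X.map r = f j ((U.map r).hom x)) (j : J) (x : U.obj j) :
    weightedLimitLift f hf ≫ weightedLimitπ U X j x = f j x := by
  have h : weightedLimitLift f hf ≫ weightedLimitIncl U X =
      Pi.lift (fun j => cotensorLift (f j)) := kernel.lift_ι _ _ _
  rw [weightedLimitπ_apply, ← Category.assoc, ← Category.assoc, h, Pi.lift_π, cotensorLift_π]

theorem weightedLimit_hom_ext {N : M} {f g : N ⟶ weightedLimit U X}
    (h : ∀ (j : J) (x : U.obj j),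
      f ≫ weightedLimitπ U X j x = g ≫ weightedLimitπ U X j x) : f = g := by
  have : Mono (weightedLimitIncl U X) :=
    inferInstanceAs (Mono (kernel.ι (Pi.lift (endRelation U X))))
  refine (cancel_mono (weightedLimitIncl U X)).1 ?_
  refine Pi.hom_ext _ _ (fun j => cotensor_hom_ext (fun x => ?_))
  simpa [weightedLimitπ_apply] using h j x

end Limit

end Weighted

/-! ### Linear Reedy categories -/

section Reedy

/-- A `k`-linear subcategory of `C` with the same objects as `C`. -/
structure LinearSubcategory (k : Type w) [Field k] (C : Type v) [Category.{v} C] [Preadditive C]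
    [Linear k C] where
  hom : ∀ c d : C, Submodule k (c ⟶ d)
  id_mem : ∀ c : C, 𝟙 c ∈ hom c c
  comp_mem : ∀ {c d e : C} {f : c ⟶ d} {g : d ⟶ e}, f ∈ hom c d → g ∈ hom d e → f ≫ g ∈ hom c e

variable {k : Type w} [Field k] {C : Type v} [Category.{v} C] [Preadditive C] [Linear k C]

namespace LinearSubcategory

variable (S : LinearSubcategory k C)

/-- The objects of a linear subcategory, regarded as a category of its own. -/
@[ext]
structure Obj (S : LinearSubcategory k C) : Type v where
  obj : C

instance : Category.{v} S.Obj where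
  Hom c d := S.hom c.obj d.obj
  id c := ⟨𝟙 c.obj, S.id_mem c.obj⟩
  comp f g := ⟨f.1 ≫ g.1, S.comp_mem f.2 g.2⟩
  id_comp _ := Subtype.ext (Category.id_comp _)
  comp_id _ := Subtype.ext (Category.comp_id _)
  assoc _ _ _ := Subtype.ext (Category.assoc _ _ _)

instance : Preadditive S.Obj where
  homGroup c d := inferInstanceAs (AddCommGroup (S.hom c.obj d.obj))
  add_comp _ _ _ _ _ _ := Subtype.ext (Preadditive.add_comp _ _ _ _ _ _)
  comp_add _ _ _ _ _ _ := Subtype.ext (Preadditive.comp_add _ _ _ _ _ _)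

instance : Linear k S.Obj where
  homModule c d := inferInstanceAs (Module k (S.hom c.obj d.obj))
  smul_comp _ _ _ _ _ _ := Subtype.ext (Linear.smul_comp _ _ _ _ _ _)
  comp_smul _ _ _ _ _ _ := Subtype.ext (Linear.comp_smul _ _ _ _ _ _)

/-- The inclusion functor of a linear subcategory. -/
def inclusion : S.Obj ⥤ C where
  obj c := c.obj
  map f := f.1

end LinearSubcategory

/-- `C` is a `k`-linear direct category with respect to the degree function `deg`. -/
structure IsDirect (k : Type w) [Field k] (C : Type v) [Category.{v} C] [Preadditive C]
    [Linear k C] (deg : C → Ordinal.{t}) : Prop where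
  nonempty_end_equiv : ∀ c : C, Nonempty ((c ⟶ c) ≃ₗ[k] k)
  deg_lt : ∀ {c d : C} (f : c ⟶ d), f ≠ 0 → c ≠ d → deg c < deg d

/-- `C` is a `k`-linear inverse category with respect to the degree function `deg`. -/
structure IsInverse (k : Type w) [Field k] (C : Type v) [Category.{v} C] [Preadditive C]
    [Linear k C] (deg : C → Ordinal.{t}) : Prop where
  nonempty_end_equiv : ∀ c : C, Nonempty ((c ⟶ c) ≃ₗ[k] k)
  deg_lt : ∀ {c d : C} (f : c ⟶ d), f ≠ 0 → c ≠ d → deg d < deg c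

open scoped TensorProduct DirectSum in
open Classical in
/-- The `k`-linear map `⨁_e C⁺(e, d) ⊗ C⁻(c, e) → C(c, d)` induced by composition. -/
def factorizationMap (P N : LinearSubcategory k C) (c d : C) :
    (⨁ e : C, (P.hom e d ⊗[k] N.hom c e)) →ₗ[k] (c ⟶ d) :=
  DirectSum.toModule k C (c ⟶ d) (fun e => TensorProduct.lift
    ((Linear.comp (S := k) c e d).flip.compl₁₂ (P.hom e d).subtype (N.hom c e).subtype))

/-- The data exhibiting the small `k`-linear category `C` as a `k`-linear Reedy category. -/
structure ReedyStructure (k : Type w) [Field k] (C : Type v) [Category.{v} C] [Preadditive C]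
    [Linear k C] where
  deg : C → Ordinal.{t}
  plus : LinearSubcategory k C
  minus : LinearSubcategory k C
  isDirect_plus : IsDirect k plus.Obj (fun c => deg c.obj)
  isInverse_minus : IsInverse k minus.Obj (fun c => deg c.obj)
  factorization : ∀ c d : C, Function.Bijective (factorizationMap plus minus c d)

namespace ReedyStructure

variable (R : ReedyStructure.{t} k C)

/-- The objects of degree `< α` of a linear subcategory. -/
def degLT (S : LinearSubcategory k C) (α : Ordinal.{t}) : ObjectProperty S.Obj :=
  fun c => R.deg c.obj < α

/-- The inclusion of the full subcategory of objects of degree `< α` of a linear subcategory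
into `C`. -/
def inclusionLT (S : LinearSubcategory k C) (α : Ordinal.{t}) :
    (R.degLT S α).FullSubcategory ⥤ C :=
  (R.degLT S α).ι ⋙ S.inclusion

/-- The weight `C⁺(-, c)` on the category of objects of degree `< deg c` of `C⁺`. -/
def latchingWeight (c : C) :
    ((R.degLT R.plus (R.deg c)).FullSubcategory)ᵒᵖ ⥤ ModuleCat.{v} k :=
  (R.degLT R.plus (R.deg c)).ι.op ⋙ (linearYoneda k R.plus.Obj).obj ⟨c⟩

/-- The weight `C⁻(c, -)` on the category of objects of degree `< deg c` of `C⁻`. -/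
def matchingWeight (c : C) :
    (R.degLT R.minus (R.deg c)).FullSubcategory ⥤ ModuleCat.{v} k :=
  (R.degLT R.minus (R.deg c)).ι ⋙ (linearCoyoneda k R.minus.Obj).obj (op ⟨c⟩)

variable {M : Type u} [Category.{v} M] [Abelian M] [Linear k M]

/-- The latching object `L_c X`. -/
def latchingObj [HasColimits M] (X : LinearFunctorCategory k C M) (c : C) : M :=
  weightedColimit (R.latchingWeight c) (R.inclusionLT R.plus (R.deg c) ⋙ X.obj)

/-- The latching morphism `L_c X → X(c)`, given on the component of `f ∈ C⁺(d, c)` by `X(f)`. -/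
def latchingMap [HasColimits M] (X : LinearFunctorCategory k C M) (c : C) :
    R.latchingObj X c ⟶ X.obj.obj c :=
  weightedColimitDesc
    (fun j => (X.obj.mapLinearMap k).comp (R.plus.hom j.obj.obj c).subtype)
    (fun _ _ _ _ => (X.obj.map_comp _ _).symm)

/-- The matching object `M_c X`. -/
def matchingObj [HasLimits M] (X : LinearFunctorCategory k C M) (c : C) : M :=
  weightedLimit (R.matchingWeight c) (R.inclusionLT R.minus (R.deg c) ⋙ X.obj)

/-- The matching morphism `X(c) → M_c X`, whose component at `f ∈ C⁻(c, d)` is `X(f)`. -/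
def matchingMap [HasLimits M] (X : LinearFunctorCategory k C M) (c : C) :
    X.obj.obj c ⟶ R.matchingObj X c :=
  weightedLimitLift
    (fun j => (X.obj.mapLinearMap k).comp (R.minus.hom c j.obj.obj).subtype)
    (fun _ _ _ _ => (X.obj.map_comp _ _).symm)

/-- The class `Φ(𝒮)` of all `k`-linear functors all of whose latching morphisms are monomorphisms
with cokernel in `𝒮`. -/
def Phi [HasColimits M] (𝒮 : ObjectProperty M) : ObjectProperty (LinearFunctorCategory k C M) :=
  fun X => ∀ c : C, Mono (R.latchingMap X c) ∧ 𝒮 (cokernel (R.latchingMap X c))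

/-- The class `Ψ(𝒮)` of all `k`-linear functors all of whose matching morphisms are epimorphisms
with kernel in `𝒮`. -/
def Psi [HasLimits M] (𝒮 : ObjectProperty M) : ObjectProperty (LinearFunctorCategory k C M) :=
  fun X => ∀ c : C, Epi (R.matchingMap X c) ∧ 𝒮 (kernel (R.matchingMap X c))

end ReedyStructure

end Reedy

end

end LinearReedy

open LinearReedy

/-!
# Cotorsion pairs of linear functors on a linear Reedy category

The proof is an argument with lifting properties. In an abelian category with a cotorsion pair
`(𝒳, 𝒴)`, where `𝒳` is generating and `𝒴` is cogenerating, the monomorphisms with cokernel in `𝒳`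
and the epimorphisms with kernel in `𝒴` determine each other by lifting properties
(`IsCotorsionPair.llp_epiWithKernel`, `IsCotorsionPair.rlp_monoWithCokernel`). Hence membership in
`Φ(𝒜)` or in `Ψ(ℬ)` is a lifting property of the latching or the matching maps. The morphisms to a
matching object, or from a latching object, are handled as natural families of linear maps
(`MatchingFamily`, `LatchingFamily`).

The link between the two classes is the class `reedyFibrations` of the morphisms of functors whose
relative matching maps lift against the monomorphisms with cokernel in `𝒜`; these are precisely the
epimorphisms with kernel in `Ψ(ℬ)` (`reedyFibrations_eq`). A functor in `Φ(𝒜)` lifts against them by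
recursion on the degree (`exists_lift_of_phi`). Conversely, to solve a lifting problem for the
latching map of `X` at `c`, one forms the universal functor over `X` in which it has a solution
(`exists_cofreeExtension`). It is a Reedy fibration over `X`, and a section of it solves the
original problem (`phi_of_forall_section`). This is where the factorization axiom enters: `C(d, c)`
is the direct sum of `C⁻(d, c)` and of the space of the morphisms that factor through an object of
degree smaller than `deg c`, which in turn is freely generated by composites, so that linear maps
out of it may be prescribed (`ReedyStructure.exists_linearMap_plus` and, dually,
`ReedyStructure.exists_linearMap_minus`). This gives `Φ(𝒜) = ⊥Ψ(ℬ)`. The other equality is proved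
with the universal functor under `Y` in which an extension problem for the matching map at `c` has a
solution (`IsFreeExtension`): `Y` maps to it by a monomorphism with cokernel in `Φ(𝒜)`, which
splits if `Y` is orthogonal to `Φ(𝒜)` (`psi_eq_rightPerp`).

If `(𝒜, ℬ)` is complete, the matching map of a functor at an object `c` of least degree where it is
not yet an epimorphism with kernel in `ℬ` is factored as a monomorphism with cokernel in `𝒜`,
followed by an epimorphism with kernel in `ℬ`. The universal extension along the first factor
repairs the matching map at `c` and leaves alone what is already in order
(`exists_extension_step`). A transfinite iteration ends after fewer steps than the successor of the
cardinality of `C`, because the repaired objects are pairwise different (`exists_llp_to_psi`).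
For hereditary pairs it suffices that `Ψ(ℬ)` inherits from `ℬ` the closure under cokernels of
monomorphisms (`psi_of_shortExact`).
-/

namespace LinearReedy

noncomputable section

open scoped ZeroObject

/-! ### Effaceability of Ext classes -/

section Effacement

variable {D : Type u} [Category.{v} D] [Abelian D]

open HomologicalComplex in
/-- A quasi-isomorphism from a one-term complex to a complex concentrated in degrees `≥ i` becomes
a monomorphism of one-term complexes after projection onto the term of degree `i`. -/
theorem exists_mono_of_quasiIsoAt_single {Y : D} {L : CochainComplex D ℤ} {i : ℤ}
    (s : (single D (ComplexShape.up ℤ) i).obj Y ⟶ L) [L.IsStrictlyGE i] [QuasiIsoAt s i] :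
    ∃ (I : D) (f : Y ⟶ I) (r : L ⟶ (single D (ComplexShape.up ℤ) i).obj I), Mono f ∧
      s ≫ r = (single D (ComplexShape.up ℤ) i).map f := by
  let e := L.pOpcyclesIso (i - 1) i (by simp)
    ((L.isZero_of_isStrictlyGE i (i - 1) (by simp)).eq_of_src _ _)
  let α : Y ⟶ L.X i :=
    (singleObjHomologySelfIso _ _ _).inv ≫ homologyMap s i ≫ L.homologyι i ≫ e.inv
  have hα : s.f i = (singleObjXSelf (ComplexShape.up ℤ) i Y).hom ≫ α := by
    rw [← cancel_mono e.hom]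
    dsimp only [α, e]
    simp only [Category.assoc]
    rw [Iso.inv_hom_id, Category.comp_id, homologyι_naturality,
      singleObjHomologySelfIso_inv_homologyι_assoc,
      ← pOpcycles_singleObjOpcyclesSelfIso_inv_assoc, Iso.inv_hom_id_assoc]
    exact (p_opcyclesMap s i).symm
  refine ⟨L.X i, α, mkHomToSingle (𝟙 _) ?_, ?_, ?_⟩
  · rintro j rfl
    apply (L.isZero_of_isStrictlyGE (j + 1) j (by simp)).eq_of_src
  · have : IsIso (homologyMap s i) := inferInstance
    have h1 : Mono (L.homologyι i ≫ e.inv) := mono_comp _ _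
    have h2 : Mono (homologyMap s i ≫ L.homologyι i ≫ e.inv) := mono_comp _ _
    exact mono_comp _ _
  · apply HomologicalComplex.to_single_hom_ext
    rw [comp_f, mkHomToSingle_f, hα, HomologicalComplex.single_map_f_self]
    simp

open DerivedCategory in
/-- A right fraction `s⁻¹ g` is killed by `m` as soon as `m` extends along `s` to a morphism that
kills `g`. -/
theorem comp_Q_map_eq_zero [HasDerivedCategory.{t} D] {K A L B : CochainComplex D ℤ}
    {φ : Q.obj K ⟶ Q.obj A} {g : K ⟶ L} {s : A ⟶ L} [IsIso (Q.map s)]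
    (hφ : φ = Q.map g ≫ inv (Q.map s)) {r : L ⟶ B} {m : A ⟶ B} (hr : s ≫ r = m)
    (hg : g ≫ r = 0) : φ ≫ Q.map m = 0 := by
  rw [hφ, ← hr, Q.map_comp, Category.assoc, IsIso.inv_hom_id_assoc, ← Q.map_comp, hg, Q.map_zero]

open DerivedCategory in
/-- Every Ext class of positive degree is killed by a monomorphism of its second argument. -/
theorem exists_mono_comp_eq_zero [HasExt.{t} D] {X Y : D} {n : ℕ}
    (e : Abelian.Ext.{t} X Y (n + 1)) :
    ∃ (I : D) (f : Y ⟶ I), Mono f ∧ e.comp (Abelian.Ext.mk₀ f) (add_zero _) = 0 := by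
  let := HasDerivedCategory.standard D
  let K := (CochainComplex.singleFunctor D 0).obj X
  have := K.isStrictlyGE_of_ge (-n) 0 (by lia)
  let σ := ((singleFunctors D).shiftIso (n + 1) (-(n + 1)) 0 (by lia))
  obtain ⟨L, _, g, s, h, hφ⟩ := left_fac_of_isStrictlyGE
    (X := K) (Y := (CochainComplex.singleFunctor D (-(n + 1))).obj Y)
      (e.hom ≫ σ.hom.app Y) (-(n + 1))
  rw [isIso_Q_map_iff_quasiIso] at h
  have h' : QuasiIsoAt s (-(n + 1)) := h.quasiIsoAt _
  obtain ⟨I, f, r, hf, hr⟩ := @exists_mono_of_quasiIsoAt_single D _ _ Y L (-(n + 1)) s _ h'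
  refine ⟨I, f, hf, ?_⟩
  ext
  rw [← cancel_mono (σ.hom.app I)]
  rw [Abelian.Ext.comp_hom, Abelian.Ext.mk₀_hom, ShiftedHom.comp_mk₀, Abelian.Ext.zero_hom,
    zero_comp, Category.assoc]
  have h1 := σ.hom.naturality f
  dsimp only [Functor.comp_map] at h1
  erw [h1]
  have h2 : g ≫ r = 0 := by
    apply HomologicalComplex.to_single_hom_ext
    apply (K.isZero_of_isStrictlyGE (-n) _ (by lia)).eq_of_src
  exact (Category.assoc _ _ _).symm.trans (comp_Q_map_eq_zero hφ hr h2)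

end Effacement

/-! ### Cotorsion pairs and lifting properties -/

section Lifting

variable {D : Type u} [Category.{v} D] [Abelian D]

/-- The base change of a short exact sequence along a morphism to its last term. -/
theorem shortExact_pullback {K P V X : D} {f : K ⟶ P} {g : P ⟶ V} {w : f ≫ g = 0}
    (hS : (ShortComplex.mk f g w).ShortExact) (x : X ⟶ V) :
    ∃ w', (ShortComplex.mk (pullback.lift f (0 : K ⟶ X) (by simp [w])) (pullback.snd g x)
      w').ShortExact := by
  have : Mono f := hS.mono_f
  have : Epi g := hS.epi_g
  refine ⟨pullback.lift_snd _ _ _, ?_⟩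
  have hm : Mono (pullback.lift f (0 : K ⟶ X) (by simp [w]) : _ ⟶ pullback g x) :=
    have : Mono (pullback.lift f (0 : K ⟶ X) (by simp [w]) ≫ pullback.fst g x) := by
      rwa [pullback.lift_fst]
    mono_of_mono _ (pullback.fst g x)
  refine ShortComplex.ShortExact.mk' (ShortComplex.exact_of_f_is_kernel _ ?_) hm inferInstance
  refine KernelFork.IsLimit.ofι' _ _ fun {T} a ha => ?_
  have ha' : a ≫ pullback.snd g x = 0 := ha
  have h1 : (a ≫ pullback.fst g x) ≫ g = 0 := by
    rw [Category.assoc, pullback.condition, reassoc_of% ha', zero_comp]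
  refine ⟨hS.exact.lift _ h1, ?_⟩
  apply pullback.hom_ext
  · rw [Category.assoc, pullback.lift_fst]
    exact hS.exact.lift_f _ h1
  · rw [Category.assoc, pullback.lift_snd, comp_zero, ha']

/-- The cobase change of a short exact sequence along a morphism from its first term. -/
theorem shortExact_pushout {K P V Y : D} {f : K ⟶ P} {g : P ⟶ V} {w : f ≫ g = 0}
    (hS : (ShortComplex.mk f g w).ShortExact) (y : K ⟶ Y) :
    ∃ w', (ShortComplex.mk (pushout.inr f y) (pushout.desc g (0 : Y ⟶ V) (by simp [w]))
      w').ShortExact := by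
  have : Mono f := hS.mono_f
  have : Epi g := hS.epi_g
  refine ⟨pushout.inr_desc _ _ _, ?_⟩
  have hm : Epi (pushout.desc g (0 : Y ⟶ V) (by simp [w]) : pushout f y ⟶ _) :=
    have : Epi (pushout.inl f y ≫ pushout.desc g (0 : Y ⟶ V) (by simp [w])) := by
      rwa [pushout.inl_desc]
    epi_of_epi (pushout.inl f y) _
  refine ShortComplex.ShortExact.mk' (ShortComplex.exact_of_g_is_cokernel _ ?_) inferInstance hm
  refine CokernelCofork.IsColimit.ofπ' _ _ fun {T} a ha => ?_
  have ha' : pushout.inr f y ≫ a = 0 := ha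
  have h1 : f ≫ pushout.inl f y ≫ a = 0 := by
    rw [pushout.condition_assoc, ha', comp_zero]
  refine ⟨hS.exact.desc _ h1, ?_⟩
  apply pushout.hom_ext
  · rw [pushout.inl_desc_assoc]
    exact hS.exact.g_desc _ h1
  · rw [pushout.inr_desc_assoc, zero_comp, ha']

theorem shortExact_kernel {E F : D} (p : E ⟶ F) [Epi p] :
    (ShortComplex.mk (kernel.ι p) p (kernel.condition p)).ShortExact :=
  ShortComplex.ShortExact.mk' (ShortComplex.exact_kernel p) inferInstance inferInstance

theorem shortExact_cokernel {E F : D} (p : E ⟶ F) [Mono p] :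
    (ShortComplex.mk p (cokernel.π p) (cokernel.condition p)).ShortExact :=
  ShortComplex.ShortExact.mk' (ShortComplex.exact_cokernel p) inferInstance inferInstance

theorem ExtVanishes.exists_lift {S : ShortComplex D} (hS : S.ShortExact) {X : D}
    (h : ExtVanishes X S.X₁ 1) (x : X ⟶ S.X₃) : ∃ l, l ≫ S.g = x := by
  let _ : HasExt.{max u v} D := HasExt.standard D
  have h' : Subsingleton (Abelian.Ext.{max u v} X S.X₁ 1) := h
  obtain ⟨x₂, hx⟩ := Abelian.Ext.covariant_sequence_exact₃ X hS (Abelian.Ext.mk₀ x) (zero_add 1)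
    (Subsingleton.elim _ _)
  obtain ⟨l, rfl⟩ := Abelian.Ext.addEquiv₀.symm.surjective x₂
  refine ⟨l, ?_⟩
  apply (Abelian.Ext.mk₀_bijective _ _).1
  simpa using hx

theorem ExtVanishes.exists_extension {S : ShortComplex D} (hS : S.ShortExact) {Y : D}
    (h : ExtVanishes S.X₃ Y 1) (y : S.X₁ ⟶ Y) : ∃ l, S.f ≫ l = y := by
  let _ : HasExt.{max u v} D := HasExt.standard D
  have h' : Subsingleton (Abelian.Ext.{max u v} S.X₃ Y 1) := h
  obtain ⟨x₂, hx⟩ := Abelian.Ext.contravariant_sequence_exact₁ hS Y (Abelian.Ext.mk₀ y) (add_zero 1)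
    (Subsingleton.elim _ _)
  obtain ⟨l, rfl⟩ := Abelian.Ext.addEquiv₀.symm.surjective x₂
  refine ⟨l, ?_⟩
  apply (Abelian.Ext.mk₀_bijective _ _).1
  simpa using hx

/-- `Ext^1(X, Y)` vanishes if all extensions of `X` by `Y` split: an extension class comes, after
embedding `Y` into an object in which the class dies, from a base change of a short exact
sequence. -/
theorem extVanishes_one_of_section {X Y : D}
    (H : ∀ (E : D) (i : Y ⟶ E) (g : E ⟶ X) (w : i ≫ g = 0), (ShortComplex.mk i g w).ShortExact →
      ∃ s, s ≫ g = 𝟙 X) : ExtVanishes X Y 1 := by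
  let _ : HasExt.{max u v} D := HasExt.standard D
  refine subsingleton_of_forall_eq 0 fun e => ?_
  obtain ⟨I, f, hf, he⟩ := exists_mono_comp_eq_zero (n := 0) e
  have hS := shortExact_cokernel f
  obtain ⟨x₃, hx⟩ := Abelian.Ext.covariant_sequence_exact₁ X hS e he (zero_add 1)
  obtain ⟨x, rfl⟩ := Abelian.Ext.addEquiv₀.symm.surjective x₃
  obtain ⟨w, hP⟩ := shortExact_pullback hS x
  obtain ⟨s, hs⟩ := H _ _ _ _ hP
  have hx' : x = (s ≫ pullback.fst _ _) ≫ cokernel.π f := by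
    have hs' : s ≫ pullback.snd (cokernel.π f) x = 𝟙 X := hs
    rw [Category.assoc, pullback.condition, reassoc_of% hs']
  rw [← hx]
  have h2 : (Abelian.Ext.addEquiv₀.symm x : Abelian.Ext.{max u v} X (cokernel f) 0) =
      (Abelian.Ext.mk₀ (s ≫ pullback.fst _ _)).comp (Abelian.Ext.mk₀ (cokernel.π f))
        (add_zero 0) := by
    rw [Abelian.Ext.mk₀_comp_mk₀, ← hx']
    rfl
  refine (congrArg (fun z => Abelian.Ext.comp z hS.extClass (zero_add 1)) h2).trans ?_
  refine (Abelian.Ext.comp_assoc_of_second_deg_zero _ _ _ _).trans ?_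
  rw [hS.comp_extClass, Abelian.Ext.comp_zero]

theorem extVanishes_one_of_retraction {X Y : D}
    (H : ∀ (E : D) (i : Y ⟶ E) (g : E ⟶ X) (w : i ≫ g = 0), (ShortComplex.mk i g w).ShortExact →
      ∃ r, i ≫ r = 𝟙 Y) : ExtVanishes X Y 1 := by
  refine extVanishes_one_of_section fun E i g w hS => ?_
  obtain ⟨r, hr⟩ := H E i g w hS
  let σ := ShortComplex.Splitting.ofExactOfRetraction _ hS.exact r hr hS.epi_g
  exact ⟨σ.s, σ.s_g⟩

/-- The epimorphisms with kernel in `𝒴`. -/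
def epiWithKernel (𝒴 : ObjectProperty D) : MorphismProperty D := fun E _ p =>
  ∃ (Y : D) (i : Y ⟶ E) (w : i ≫ p = 0), 𝒴 Y ∧ (ShortComplex.mk i p w).ShortExact

/-- The monomorphisms with cokernel in `𝒳`. -/
def monoWithCokernel (𝒳 : ObjectProperty D) : MorphismProperty D := fun _ F i =>
  ∃ (X : D) (p : F ⟶ X) (w : i ≫ p = 0), 𝒳 X ∧ (ShortComplex.mk i p w).ShortExact

theorem epiWithKernel_of_epi {𝒴 : ObjectProperty D} {E F : D} (p : E ⟶ F) (hp : Epi p)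
    (h : 𝒴 (kernel p)) : epiWithKernel 𝒴 p :=
  ⟨_, _, _, h, shortExact_kernel p⟩

theorem monoWithCokernel_of_mono {𝒳 : ObjectProperty D} {E F : D} (i : E ⟶ F) (hi : Mono i)
    (h : 𝒳 (cokernel i)) : monoWithCokernel 𝒳 i :=
  ⟨_, _, _, h, shortExact_cokernel i⟩

theorem epiWithKernel_to_zero {𝒴 : ObjectProperty D} {Y Z : D} (hY : 𝒴 Y) (hZ : IsZero Z)
    (p : Y ⟶ Z) : epiWithKernel 𝒴 p := by
  refine ⟨Y, 𝟙 Y, hZ.eq_of_tgt _ _, hY, ?_⟩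
  have : Epi p := ⟨fun _ _ _ => hZ.eq_of_src _ _⟩
  refine ShortComplex.ShortExact.mk' ?_ inferInstance this
  exact (ShortComplex.exact_iff_epi _ (hZ.eq_of_tgt _ _)).2 inferInstance

theorem monoWithCokernel_from_zero {𝒳 : ObjectProperty D} {X Z : D} (hX : 𝒳 X) (hZ : IsZero Z)
    (i : Z ⟶ X) : monoWithCokernel 𝒳 i := by
  refine ⟨X, 𝟙 X, hZ.eq_of_src _ _, hX, ?_⟩
  have : Mono i := ⟨fun _ _ _ => hZ.eq_of_tgt _ _⟩
  refine ShortComplex.ShortExact.mk' ?_ this inferInstance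
  exact (ShortComplex.exact_iff_mono _ (hZ.eq_of_src _ _)).2 inferInstance

/-- A monomorphism lifts against an epimorphism if `Ext^1(cokernel, kernel) = 0`: the vanishing
first gives a morphism making the lower triangle commute and then corrects the upper triangle. -/
theorem hasLiftingProperty_of_extVanishes {S T : ShortComplex D} (hS : S.ShortExact)
    (hT : T.ShortExact) (h : ExtVanishes S.X₃ T.X₁ 1) : HasLiftingProperty S.f T.g := by
  have := hT.mono_f
  refine ⟨fun {a b} sq => ?_⟩
  obtain ⟨l, hl⟩ : ∃ l : S.X₂ ⟶ T.X₂, l ≫ T.g = b := by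
    let _ : HasExt.{max u v} D := HasExt.standard D
    have h' : Subsingleton (Abelian.Ext.{max u v} S.X₃ T.X₁ 1) := h
    obtain ⟨x₁, hx⟩ := Abelian.Ext.contravariant_sequence_exact₂ hS T.X₁
      ((Abelian.Ext.mk₀ b).comp hT.extClass (zero_add 1)) (by
        rw [Abelian.Ext.mk₀_comp_mk₀_assoc, ← sq.w, ← Abelian.Ext.mk₀_comp_mk₀_assoc,
          hT.comp_extClass, Abelian.Ext.comp_zero])
    obtain ⟨x₂, hx⟩ := Abelian.Ext.covariant_sequence_exact₃ S.X₂ hT (Abelian.Ext.mk₀ b)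
      (zero_add 1) (by rw [← hx, Subsingleton.elim x₁ 0, Abelian.Ext.comp_zero])
    obtain ⟨l, rfl⟩ := Abelian.Ext.addEquiv₀.symm.surjective x₂
    refine ⟨l, (Abelian.Ext.mk₀_bijective _ _).1 ?_⟩
    simpa using hx
  obtain ⟨m, hm⟩ := h.exists_extension hS (hT.exact.lift (a - S.f ≫ l) (by simp [hl, sq.w]))
  have hm' : S.f ≫ m ≫ T.f = a - S.f ≫ l := by rw [reassoc_of% hm, hT.exact.lift_f]
  exact ⟨⟨⟨l + m ≫ T.f, by simp [hm'], by simp [hl]⟩⟩⟩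

theorem monoWithCokernel_le_llp {𝒳 𝒴 : ObjectProperty D}
    (h : ∀ X Y, 𝒳 X → 𝒴 Y → ExtVanishes X Y 1) :
    monoWithCokernel 𝒳 ≤ (epiWithKernel 𝒴).llp := by
  rintro _ _ f ⟨X, p, w, hX, hS⟩ _ _ g ⟨Y, i, w', hY, hT⟩
  exact hasLiftingProperty_of_extVanishes hS hT (h X Y hX hY)

theorem leftPerp_of_llp {𝒴 : ObjectProperty D} {X Z : D} (hZ : IsZero Z) (f : Z ⟶ X)
    (hf : (epiWithKernel 𝒴).llp f) : leftPerp 𝒴 X := fun Y hY => by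
  refine extVanishes_one_of_section fun E i g w hS => ?_
  have := hf g ⟨_, _, _, hY, hS⟩
  have sq : CommSq (0 : Z ⟶ E) f g (𝟙 _) := ⟨hZ.eq_of_src _ _⟩
  exact ⟨sq.lift, sq.fac_right⟩

/-- Lifting against `Y ⟶ 0`, for `Y` in `𝒴`, extends an embedding into `Y`. -/
theorem mono_of_llp {𝒴 : ObjectProperty D} (h𝒴 : IsCogenerating 𝒴) {P Q : D} (f : P ⟶ Q)
    (hf : (epiWithKernel 𝒴).llp f) : Mono f := by
  obtain ⟨B, i, hB, hi⟩ := h𝒴 P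
  have := hf (0 : B ⟶ 0) (epiWithKernel_to_zero hB (isZero_zero D) _)
  have sq : CommSq i f (0 : B ⟶ 0) 0 := ⟨by simp⟩
  have h1 : Mono (f ≫ sq.lift) := by rw [sq.fac_left]; exact hi
  exact mono_of_mono f sq.lift

/-- Lifting `0 ⟶ X`, for `X` in `𝒳`, lifts an epimorphism from `X`. -/
theorem epi_of_rlp {𝒳 : ObjectProperty D} (h𝒳 : IsGenerating 𝒳) {E F : D} (g : E ⟶ F)
    (hg : (monoWithCokernel 𝒳).rlp g) : Epi g := by
  obtain ⟨A, p, hA, hp⟩ := h𝒳 F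
  have := hg (0 : 0 ⟶ A) (monoWithCokernel_from_zero hA (isZero_zero D) _)
  have sq : CommSq (0 : 0 ⟶ E) (0 : 0 ⟶ A) g p := ⟨by simp⟩
  have h1 : Epi (sq.lift ≫ g) := by rw [sq.fac_right]; exact hp
  exact epi_of_epi sq.lift g

theorem monoWithCokernel_of_llp {𝒴 : ObjectProperty D} (h𝒴 : IsCogenerating 𝒴) {P Q : D}
    (f : P ⟶ Q) (hf : (epiWithKernel 𝒴).llp f) : monoWithCokernel (leftPerp 𝒴) f := by
  refine monoWithCokernel_of_mono f (mono_of_llp h𝒴 f hf) fun Y hY => ?_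
  refine extVanishes_one_of_section fun E i g w hS => ?_
  have := hf g ⟨_, _, _, hY, hS⟩
  have sq : CommSq (0 : P ⟶ E) f g (cokernel.π f) := ⟨by simp⟩
  refine ⟨cokernel.desc f sq.lift sq.fac_left, ?_⟩
  rw [← cancel_epi (cokernel.π f)]
  simp

theorem epiWithKernel_of_rlp {𝒳 : ObjectProperty D} (h𝒳 : IsGenerating 𝒳) {E F : D}
    (g : E ⟶ F) (hg : (monoWithCokernel 𝒳).rlp g) : epiWithKernel (rightPerp 𝒳) g := by
  refine epiWithKernel_of_epi g (epi_of_rlp h𝒳 g hg) fun X hX => ?_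
  refine extVanishes_one_of_retraction fun P i p w hS => ?_
  have := hg i ⟨_, _, _, hX, hS⟩
  have sq : CommSq (kernel.ι g) i g (0 : P ⟶ F) := ⟨by simp⟩
  refine ⟨kernel.lift g sq.lift sq.fac_right, ?_⟩
  rw [← cancel_mono (kernel.ι g)]
  simp

theorem IsCotorsionPair.llp_epiWithKernel {𝒳 𝒴 : ObjectProperty D} (h : IsCotorsionPair 𝒳 𝒴)
    (h𝒴 : IsCogenerating 𝒴) : (epiWithKernel 𝒴).llp = monoWithCokernel 𝒳 := by
  refine le_antisymm (fun P Q f hf => ?_) (monoWithCokernel_le_llp fun X Y hX hY => ?_)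
  · rw [h.left_eq]
    exact monoWithCokernel_of_llp h𝒴 f hf
  · rw [h.left_eq] at hX
    exact hX Y hY

theorem IsCotorsionPair.rlp_monoWithCokernel {𝒳 𝒴 : ObjectProperty D} (h : IsCotorsionPair 𝒳 𝒴)
    (h𝒳 : IsGenerating 𝒳) : (monoWithCokernel 𝒳).rlp = epiWithKernel 𝒴 := by
  refine le_antisymm (fun P Q f hf => ?_) ?_
  · rw [h.right_eq]
    exact epiWithKernel_of_rlp h𝒳 f hf
  · intro E F g hg P Q f hf
    refine monoWithCokernel_le_llp (𝒴 := 𝒴) (fun X Y hX hY => ?_) f hf g hg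
    rw [h.left_eq] at hX
    exact hX Y hY

theorem leftPerp_of_mono {𝒴 : ObjectProperty D} {P Q X : D} {f : P ⟶ Q} {p : Q ⟶ X} {w}
    (h : (epiWithKernel 𝒴).llp f) (hS : (ShortComplex.mk f p w).ShortExact) : leftPerp 𝒴 X := by
  have := hS.epi_g
  have : Epi p := hS.epi_g
  intro Y hY
  refine extVanishes_one_of_section fun E i g w' hT => ?_
  have := h g ⟨_, _, _, hY, hT⟩
  have sq : CommSq (0 : P ⟶ E) f g p := ⟨by simp [w]⟩
  obtain ⟨s, hs⟩ : ∃ s, p ≫ s = sq.lift :=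
    ⟨hS.exact.desc sq.lift sq.fac_left, hS.exact.g_desc _ _⟩
  refine ⟨s, ?_⟩
  rw [← cancel_epi p, reassoc_of% hs, sq.fac_right, Category.comp_id]

theorem rightPerp_of_epi {𝒳 : ObjectProperty D} {Y E F : D} {g : E ⟶ F} {i : Y ⟶ E} {w}
    (h : (monoWithCokernel 𝒳).rlp g) (hS : (ShortComplex.mk i g w).ShortExact) :
    rightPerp 𝒳 Y := by
  have : Mono i := hS.mono_f
  intro X hX
  refine extVanishes_one_of_retraction fun P j p w' hT => ?_
  have := h j ⟨_, _, _, hX, hT⟩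
  have sq : CommSq i j g (0 : P ⟶ F) := ⟨by simp [w]⟩
  obtain ⟨s, hs⟩ : ∃ s, s ≫ i = sq.lift :=
    ⟨hS.exact.lift sq.lift sq.fac_right, hS.exact.lift_f _ _⟩
  refine ⟨s, ?_⟩
  rw [← cancel_mono i, Category.assoc, hs, sq.fac_left, Category.id_comp]

end Lifting

section KernelsAndCokernels

variable {D : Type u} [Category.{v} D] [Abelian D] {𝒳 𝒴 : ObjectProperty D}

theorem IsCotorsionPair.epiWithKernel_iff (h : IsCotorsionPair 𝒳 𝒴) (h𝒳 : IsGenerating 𝒳)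
    {E F : D} (p : E ⟶ F) : epiWithKernel 𝒴 p ↔ Epi p ∧ 𝒴 (kernel p) := by
  refine ⟨fun hp => ?_, fun hp => epiWithKernel_of_epi p hp.1 hp.2⟩
  rw [← h.rlp_monoWithCokernel h𝒳] at hp
  have := epi_of_rlp h𝒳 p hp
  exact ⟨this, h.right_eq ▸ rightPerp_of_epi hp (shortExact_kernel p)⟩

theorem IsCotorsionPair.monoWithCokernel_iff (h : IsCotorsionPair 𝒳 𝒴) (h𝒴 : IsCogenerating 𝒴)
    {E F : D} (p : E ⟶ F) : monoWithCokernel 𝒳 p ↔ Mono p ∧ 𝒳 (cokernel p) := by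
  refine ⟨fun hp => ?_, fun hp => monoWithCokernel_of_mono p hp.1 hp.2⟩
  rw [← h.llp_epiWithKernel h𝒴] at hp
  have := mono_of_llp h𝒴 p hp
  exact ⟨this, h.left_eq ▸ leftPerp_of_mono hp (shortExact_cokernel p)⟩

end KernelsAndCokernels

/-! ### Factorizations, approximations and heredity -/

section Approximations

variable {D : Type u} [Category.{v} D] [Abelian D] {𝒳 𝒴 : ObjectProperty D}

/-- A complete cotorsion pair factors every morphism into a monomorphism with cokernel in `𝒳`
followed by an epimorphism with kernel in `𝒴`. -/
theorem IsCompleteCotorsionPair.exists_factorization (h : IsCompleteCotorsionPair 𝒳 𝒴)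
    (h𝒳 : IsGenerating 𝒳) {U V : D} (f : U ⟶ V) :
    ∃ (Z : D) (i : U ⟶ Z) (q : Z ⟶ V), i ≫ q = f ∧ (epiWithKernel 𝒴).llp i ∧
      epiWithKernel 𝒴 q := by
  have hle : monoWithCokernel 𝒳 ≤ (epiWithKernel 𝒴).llp := monoWithCokernel_le_llp
    fun X Y hX hY => by
      rw [h.left_eq] at hX
      exact hX Y hY
  -- enlarge `f` to an epimorphism from `U ⊞ A`, then embed its kernel into an object of `𝒴`
  obtain ⟨A, p, hA, hp⟩ := h𝒳 V
  have : Epi (biprod.desc f p) :=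
    have : Epi (biprod.inr ≫ biprod.desc f p) := by rwa [biprod.inr_desc]
    epi_of_epi biprod.inr _
  obtain ⟨B, A₁, j, r, w, hA₁, hB, hS⟩ := h.right_approx (kernel (biprod.desc f p))
  obtain ⟨w', hT⟩ := shortExact_pushout (shortExact_kernel (biprod.desc f p)) j
  refine ⟨_, biprod.inl ≫ pushout.inl _ _, _, ?_, ?_, ⟨_, _, w', hB, hT⟩⟩
  · rw [Category.assoc, pushout.inl_desc, biprod.inl_desc]
  · refine MorphismProperty.comp_mem _ _ _ (hle _ ⟨A, biprod.snd, by simp, hA, ?_⟩)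
      (MorphismProperty.pushout_inl _ _ (hle _ ⟨_, _, w, hA₁, hS⟩))
    exact (ShortComplex.Splitting.ofHasBinaryBiproduct U A).shortExact

/-- Salce's argument: push out the kernel of an epimorphism from an object of `𝒳` along its
embedding into an object of `𝒴`. -/
theorem hasApproximations_of_right (h : IsCotorsionPair 𝒳 𝒴) (h𝒳 : IsGenerating 𝒳)
    (H : ∀ N : D, ∃ (Y X : D) (f : N ⟶ Y) (g : Y ⟶ X) (w : f ≫ g = 0),
      𝒳 X ∧ 𝒴 Y ∧ (ShortComplex.mk f g w).ShortExact) : HasApproximations 𝒳 𝒴 where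
  right_approx := H
  left_approx N := by
    have hle : monoWithCokernel 𝒳 ≤ (epiWithKernel 𝒴).llp := monoWithCokernel_le_llp
      fun X Y hX hY => by
        rw [h.left_eq] at hX
        exact hX Y hY
    obtain ⟨F, p, hF, hp⟩ := h𝒳 N
    obtain ⟨Y, X, f, g, w, hX, hY, hS⟩ := H (kernel p)
    obtain ⟨w', hT⟩ := shortExact_pushout (shortExact_kernel p) f
    refine ⟨_, _, _, _, w', ?_, hY, hT⟩
    rw [h.left_eq]
    refine leftPerp_of_llp (isZero_zero D) (0 ≫ pushout.inl _ _) ?_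
    exact MorphismProperty.comp_mem _ _ _
      (hle (0 : 0 ⟶ F) (monoWithCokernel_from_zero hF (isZero_zero D) _))
      (MorphismProperty.pushout_inl _ _ (hle _ ⟨_, _, w, hX, hS⟩))

/-- The right class of a hereditary cotorsion pair is closed under cokernels of monomorphisms. -/
theorem IsHereditaryCotorsionPair.of_shortExact (h : IsHereditaryCotorsionPair 𝒳 𝒴)
    {S : ShortComplex D} (hS : S.ShortExact) (h₁ : 𝒴 S.X₁) (h₂ : 𝒴 S.X₂) : 𝒴 S.X₃ := by
  rw [h.right_eq]
  intro X hX
  let _ : HasExt.{max u v} D := HasExt.standard D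
  have e₁ : Subsingleton (Abelian.Ext.{max u v} X S.X₁ 2) := h.ext_vanishes X _ hX h₁ 2 (by lia)
  have e₂ : Subsingleton (Abelian.Ext.{max u v} X S.X₂ 1) := h.ext_vanishes X _ hX h₂ 1 le_rfl
  refine subsingleton_of_forall_eq 0 fun x₃ => ?_
  obtain ⟨x₂, rfl⟩ := Abelian.Ext.covariant_sequence_exact₃ X hS x₃ rfl (Subsingleton.elim _ _)
  rw [Subsingleton.elim x₂ 0, Abelian.Ext.zero_comp]

/-- Dimension shifting along embeddings into objects of `𝒴`. -/
theorem isHereditaryCotorsionPair_of_shortExact (h : IsCotorsionPair 𝒳 𝒴)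
    (h𝒴 : IsCogenerating 𝒴)
    (H : ∀ S : ShortComplex D, S.ShortExact → 𝒴 S.X₁ → 𝒴 S.X₂ → 𝒴 S.X₃) :
    IsHereditaryCotorsionPair 𝒳 𝒴 where
  toIsCotorsionPair := h
  ext_vanishes X Y hX hY i hi := by
    obtain ⟨n, rfl⟩ : ∃ n, i = n + 1 := ⟨i - 1, by lia⟩
    clear hi
    let _ : HasExt.{max u v} D := HasExt.standard D
    induction n generalizing Y with
    | zero =>
      rw [h.left_eq] at hX
      exact hX Y hY
    | succ n ih =>
      refine subsingleton_of_forall_eq 0 fun e => ?_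
      obtain ⟨I, f, hf, he⟩ := exists_mono_comp_eq_zero e
      obtain ⟨J, g, hJ, hg⟩ := h𝒴 I
      have hS := shortExact_cokernel (f ≫ g)
      have ih' : Subsingleton (Abelian.Ext.{max u v} X (cokernel (f ≫ g)) (n + 1)) :=
        ih _ (H _ hS hY hJ)
      obtain ⟨x, rfl⟩ := Abelian.Ext.covariant_sequence_exact₁ X hS e (by
        dsimp only
        rw [← Abelian.Ext.mk₀_comp_mk₀, ← Abelian.Ext.comp_assoc_of_third_deg_zero, he,
          Abelian.Ext.zero_comp]) rfl
      have hx : x = 0 := ih'.elim _ _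
      rw [hx, Abelian.Ext.zero_comp]

end Approximations

/-! ### Evaluation of linear functors -/

section Evaluation

variable {k : Type w} [Field k] {C : Type v} [Category.{v} C] [Preadditive C] [Linear k C]
  {M : Type u} [Category.{v} M] [Abelian M] [Linear k M]

instance (J : Type v) [Category.{v} J] [HasLimits M] :
    (isLinearFunctor k C M).IsClosedUnderLimitsOfShape J := ⟨by
  rintro G ⟨p, hp⟩
  have hmono : ∀ (Y : C) {Z : M} (a b : Z ⟶ G.obj Y),
      (∀ j, a ≫ (p.π.app j).app Y = b ≫ (p.π.app j).app Y) → a = b := fun Y Z a b h =>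
    (isLimitOfPreserves ((evaluation C M).obj Y) p.isLimit).hom_ext h
  have hnat : ∀ (j : J) {X Y : C} (a : X ⟶ Y), G.map a ≫ (p.π.app j).app Y =
      (p.π.app j).app X ≫ (p.diag.obj j).map a := fun j _ _ a => (p.π.app j).naturality a
  refine ⟨⟨fun {X Y a b} => hmono Y _ _ fun j => ?_⟩,
    ⟨fun {X Y} a r => hmono Y _ _ fun j => ?_⟩⟩
  · have := (hp j).1
    rw [Preadditive.add_comp, hnat, hnat, hnat, Functor.map_add, Preadditive.comp_add]
  · have := (hp j).2
    rw [Linear.smul_comp, hnat, hnat, Functor.map_smul, Linear.comp_smul]⟩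

instance (J : Type v) [Category.{v} J] [HasColimits M] :
    (isLinearFunctor k C M).IsClosedUnderColimitsOfShape J := ⟨by
  rintro G ⟨p, hp⟩
  have hepi : ∀ (Y : C) {Z : M} (a b : G.obj Y ⟶ Z),
      (∀ j, (p.ι.app j).app Y ≫ a = (p.ι.app j).app Y ≫ b) → a = b := fun Y Z a b h =>
    (isColimitOfPreserves ((evaluation C M).obj Y) p.isColimit).hom_ext h
  have hnat : ∀ (j : J) {X Y : C} (a : X ⟶ Y), (p.ι.app j).app X ≫ G.map a =
      (p.diag.obj j).map a ≫ (p.ι.app j).app Y := fun j _ _ a => ((p.ι.app j).naturality a).symm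
  refine ⟨⟨fun {X Y a b} => hepi X _ _ fun j => ?_⟩,
    ⟨fun {X Y} a r => hepi X _ _ fun j => ?_⟩⟩
  · have := (hp j).1
    rw [Preadditive.comp_add, hnat, hnat, hnat, Functor.map_add, Preadditive.add_comp]
  · have := (hp j).2
    rw [Linear.comp_smul, hnat, hnat, Functor.map_smul, Linear.smul_comp]⟩

variable (k M) in
/-- Evaluation of `k`-linear functors at an object. -/
def ev (c : C) : LinearFunctorCategory k C M ⥤ M :=
  (isLinearFunctor k C M).ι ⋙ (evaluation C M).obj c

instance (c : C) : (ev k M c).Additive where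
  map_add := rfl

instance (c : C) (J : Type v) [Category.{v} J] [HasLimits M] :
    PreservesLimitsOfShape J (ev k M c) :=
  inferInstanceAs (PreservesLimitsOfShape J
    ((isLinearFunctor k C M).ι ⋙ (evaluation C M).obj c))

instance (c : C) (J : Type v) [Category.{v} J] [HasColimits M] :
    PreservesColimitsOfShape J (ev k M c) :=
  inferInstanceAs (PreservesColimitsOfShape J
    ((isLinearFunctor k C M).ι ⋙ (evaluation C M).obj c))

instance (c : C) [HasLimits M] : PreservesLimits (ev k M c) := ⟨inferInstance⟩

instance (c : C) [HasColimits M] : PreservesColimits (ev k M c) := ⟨inferInstance⟩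

instance (c : C) [HasLimits M] : PreservesFiniteLimits (ev k M c) :=
  PreservesLimits.preservesFiniteLimits _

instance (c : C) [HasColimits M] : PreservesFiniteColimits (ev k M c) :=
  PreservesColimits.preservesFiniteColimits _

instance (J : Type v) [Category.{v} J] [HasLimits M] :
    HasLimitsOfShape J (LinearFunctorCategory k C M) := inferInstance

instance [HasColimits M] : HasColimits (LinearFunctorCategory k C M) := ⟨inferInstance⟩

theorem naturality_app {X Y : LinearFunctorCategory k C M} (f : X ⟶ Y) {c d : C} (g : c ⟶ d) :
    X.obj.map g ≫ f.hom.app d = f.hom.app c ≫ Y.obj.map g :=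
  f.hom.naturality g

theorem naturality_app_assoc {X Y : LinearFunctorCategory k C M} (f : X ⟶ Y) {c d : C} (g : c ⟶ d)
    {N : M} (h : Y.obj.obj d ⟶ N) :
    X.obj.map g ≫ f.hom.app d ≫ h = f.hom.app c ≫ Y.obj.map g ≫ h :=
  NatTrans.naturality_assoc f.hom g h

theorem epi_of_epi_app {X Y : LinearFunctorCategory k C M} (f : X ⟶ Y)
    (h : ∀ c, Epi (f.hom.app c)) : Epi f := by
  have : Epi f.hom := NatTrans.epi_of_epi_app f.hom
  exact (isLinearFunctor k C M).ι.epi_of_epi_map this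

theorem mono_of_mono_app {X Y : LinearFunctorCategory k C M} (f : X ⟶ Y)
    (h : ∀ c, Mono (f.hom.app c)) : Mono f := by
  have : Mono f.hom := NatTrans.mono_of_mono_app f.hom
  exact (isLinearFunctor k C M).ι.mono_of_mono_map this

theorem shortExact_app [HasLimits M] [HasColimits M]
    {X Y Z : LinearFunctorCategory k C M} {f : X ⟶ Y} {g : Y ⟶ Z}
    {h : f ≫ g = 0} (hS : (ShortComplex.mk f g h).ShortExact) (c : C) :
    ∃ w, (ShortComplex.mk (f.hom.app c) (g.hom.app c) w).ShortExact :=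
  ⟨_, hS.map_of_exact (ev k M c)⟩

theorem mono_kernelι_app [HasLimits M] {X Y : LinearFunctorCategory k C M} (f : X ⟶ Y) (d : C) :
    Mono ((kernel.ι f).hom.app d) :=
  inferInstanceAs (Mono ((ev k M d).map (kernel.ι f)))

theorem epi_cokernelπ_app [HasColimits M] {X Y : LinearFunctorCategory k C M} (f : X ⟶ Y) (d : C) :
    Epi ((cokernel.π f).hom.app d) :=
  inferInstanceAs (Epi ((ev k M d).map (cokernel.π f)))

theorem comp_app_eq_zero {X Y Z : LinearFunctorCategory k C M} {f : X ⟶ Y} {g : Y ⟶ Z}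
    (h : f ≫ g = 0) (d : C) : f.hom.app d ≫ g.hom.app d = 0 := by
  exact congrArg (fun f => f.hom.app d) h

theorem exists_lift_kernel_app [HasLimits M] [HasColimits M]
    {X Y : LinearFunctorCategory k C M} (f : X ⟶ Y) {d : C} {T : M}
    (x : T ⟶ X.obj.obj d) (hx : x ≫ f.hom.app d = 0) :
    ∃ l : T ⟶ (kernel f).obj.obj d, l ≫ (kernel.ι f).hom.app d = x := by
  have := mono_kernelι_app f d
  have h : (ShortComplex.mk ((kernel.ι f).hom.app d) (f.hom.app d)
      (comp_app_eq_zero (kernel.condition f) d)).Exact :=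
    (ShortComplex.exact_kernel f).map (ev k M d)
  exact ⟨h.lift x hx, h.lift_f x hx⟩

theorem exists_desc_cokernel_app [HasLimits M] [HasColimits M]
    {X Y : LinearFunctorCategory k C M} (f : X ⟶ Y) {d : C} {T : M}
    (x : Y.obj.obj d ⟶ T) (hx : f.hom.app d ≫ x = 0) :
    ∃ l : (cokernel f).obj.obj d ⟶ T, (cokernel.π f).hom.app d ≫ l = x := by
  have := epi_cokernelπ_app f d
  have h : (ShortComplex.mk (f.hom.app d) ((cokernel.π f).hom.app d)
      (comp_app_eq_zero (cokernel.condition f) d)).Exact :=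
    (ShortComplex.exact_cokernel f).map (ev k M d)
  exact ⟨h.desc x hx, h.g_desc x hx⟩

theorem pi_app_hom_ext [HasLimits M] {ι : Type v}
    (W : ι → LinearFunctorCategory k C M) {d : C} {T : M}
    {a b : T ⟶ (∏ᶜ W).obj.obj d}
    (h : ∀ j, a ≫ (Pi.π W j).hom.app d = b ≫ (Pi.π W j).hom.app d) : a = b :=
  (isLimitOfPreserves (ev k M d) (limit.isLimit (Discrete.functor W))).hom_ext fun j => h j.as

theorem exists_pi_app_lift [HasLimits M] {ι : Type v}
    (W : ι → LinearFunctorCategory k C M) {d : C} {T : M}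
    (a : ∀ j, T ⟶ (W j).obj.obj d) :
    ∃ l : T ⟶ (∏ᶜ W).obj.obj d, ∀ j, l ≫ (Pi.π W j).hom.app d = a j := by
  let hl := isLimitOfPreserves (ev k M d) (limit.isLimit (Discrete.functor W))
  refine ⟨hl.lift ⟨T, Discrete.natTrans fun j => a j.as⟩, fun j => hl.fac _ ⟨j⟩⟩

theorem sigma_app_hom_ext [HasColimits M] {ι : Type v}
    (W : ι → LinearFunctorCategory k C M) {d : C} {T : M}
    {a b : (∐ W).obj.obj d ⟶ T}
    (h : ∀ j, (Sigma.ι W j).hom.app d ≫ a = (Sigma.ι W j).hom.app d ≫ b) : a = b :=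
  (isColimitOfPreserves (ev k M d) (colimit.isColimit (Discrete.functor W))).hom_ext
    fun j => h j.as

theorem comp_app {X Y Z : LinearFunctorCategory k C M} (f : X ⟶ Y) (g : Y ⟶ Z) (d : C) :
    (f ≫ g).hom.app d = f.hom.app d ≫ g.hom.app d := rfl

theorem biprod_app_hom_ext {X Y : LinearFunctorCategory k C M} {d : C} {T : M}
    {a b : T ⟶ (X ⊞ Y).obj.obj d}
    (h₁ : a ≫ (biprod.fst : X ⊞ Y ⟶ X).hom.app d = b ≫ (biprod.fst : X ⊞ Y ⟶ X).hom.app d)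
    (h₂ : a ≫ (biprod.snd : X ⊞ Y ⟶ Y).hom.app d = b ≫ (biprod.snd : X ⊞ Y ⟶ Y).hom.app d) :
    a = b := by
  have h : (biprod.fst : X ⊞ Y ⟶ X).hom.app d ≫ (biprod.inl : X ⟶ X ⊞ Y).hom.app d +
      (biprod.snd : X ⊞ Y ⟶ Y).hom.app d ≫ (biprod.inr : Y ⟶ X ⊞ Y).hom.app d = 𝟙 _ :=
    congrArg (fun f => f.hom.app d) (biprod.total (X := X) (Y := Y))
  rw [← Category.comp_id a, ← Category.comp_id b, ← h, Preadditive.comp_add, Preadditive.comp_add,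
    reassoc_of% h₁, reassoc_of% h₂]

theorem biprod_app_hom_ext' {X Y : LinearFunctorCategory k C M} {d : C} {T : M}
    {a b : (X ⊞ Y).obj.obj d ⟶ T}
    (h₁ : (biprod.inl : X ⟶ X ⊞ Y).hom.app d ≫ a = (biprod.inl : X ⟶ X ⊞ Y).hom.app d ≫ b)
    (h₂ : (biprod.inr : Y ⟶ X ⊞ Y).hom.app d ≫ a = (biprod.inr : Y ⟶ X ⊞ Y).hom.app d ≫ b) :
    a = b := by
  have h : (biprod.fst : X ⊞ Y ⟶ X).hom.app d ≫ (biprod.inl : X ⟶ X ⊞ Y).hom.app d +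
      (biprod.snd : X ⊞ Y ⟶ Y).hom.app d ≫ (biprod.inr : Y ⟶ X ⊞ Y).hom.app d = 𝟙 _ :=
    congrArg (fun f => f.hom.app d) (biprod.total (X := X) (Y := Y))
  rw [← Category.id_comp a, ← Category.id_comp b, ← h, Preadditive.add_comp, Preadditive.add_comp,
    Category.assoc, h₁, Category.assoc, h₂, Category.assoc, Category.assoc]

theorem exists_biprod_app_lift {X Y : LinearFunctorCategory k C M} {d : C} {T : M}
    (x : T ⟶ X.obj.obj d) (y : T ⟶ Y.obj.obj d) : ∃ l : T ⟶ (X ⊞ Y).obj.obj d,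
      l ≫ (biprod.fst : X ⊞ Y ⟶ X).hom.app d = x ∧ l ≫ (biprod.snd : X ⊞ Y ⟶ Y).hom.app d = y := by
  have h₁ : (biprod.inl : X ⟶ X ⊞ Y).hom.app d ≫ (biprod.fst : X ⊞ Y ⟶ X).hom.app d = 𝟙 _ :=
    congrArg (fun f => f.hom.app d) (biprod.inl_fst (X := X) (Y := Y))
  have h₂ : (biprod.inr : Y ⟶ X ⊞ Y).hom.app d ≫ (biprod.snd : X ⊞ Y ⟶ Y).hom.app d = 𝟙 _ :=
    congrArg (fun f => f.hom.app d) (biprod.inr_snd (X := X) (Y := Y))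
  have h₃ := comp_app_eq_zero (biprod.inl_snd (X := X) (Y := Y)) d
  have h₄ := comp_app_eq_zero (biprod.inr_fst (X := X) (Y := Y)) d
  exact ⟨x ≫ (biprod.inl : X ⟶ X ⊞ Y).hom.app d + y ≫ (biprod.inr : Y ⟶ X ⊞ Y).hom.app d,
    by simp [h₁, h₄], by simp [h₂, h₃]⟩

theorem exists_biprod_app_desc {X Y : LinearFunctorCategory k C M} {d : C} {T : M}
    (x : X.obj.obj d ⟶ T) (y : Y.obj.obj d ⟶ T) : ∃ l : (X ⊞ Y).obj.obj d ⟶ T,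
      (biprod.inl : X ⟶ X ⊞ Y).hom.app d ≫ l = x ∧ (biprod.inr : Y ⟶ X ⊞ Y).hom.app d ≫ l = y := by
  have h₁ : (biprod.inl : X ⟶ X ⊞ Y).hom.app d ≫ (biprod.fst : X ⊞ Y ⟶ X).hom.app d = 𝟙 _ :=
    congrArg (fun f => f.hom.app d) (biprod.inl_fst (X := X) (Y := Y))
  have h₂ : (biprod.inr : Y ⟶ X ⊞ Y).hom.app d ≫ (biprod.snd : X ⊞ Y ⟶ Y).hom.app d = 𝟙 _ :=
    congrArg (fun f => f.hom.app d) (biprod.inr_snd (X := X) (Y := Y))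
  have h₃ := comp_app_eq_zero (biprod.inl_snd (X := X) (Y := Y)) d
  have h₄ := comp_app_eq_zero (biprod.inr_fst (X := X) (Y := Y)) d
  exact ⟨(biprod.fst : X ⊞ Y ⟶ X).hom.app d ≫ x + (biprod.snd : X ⊞ Y ⟶ Y).hom.app d ≫ y,
    by simp [reassoc_of% h₁, reassoc_of% h₃], by simp [reassoc_of% h₂, reassoc_of% h₄]⟩

end Evaluation

/-! ### Free and cofree functors -/

section Free

variable {k : Type w} [Field k] {C : Type v} [Category.{v} C] [Preadditive C] [Linear k C]
  {M : Type u} [Category.{v} M] [Abelian M] [Linear k M]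

section

variable [HasLimits M]

variable (k) in
/-- The functor `hom(C(-, c), N)`, the value at `N` of the right adjoint of evaluation at `c`. -/
def cofree (c : C) (N : M) : LinearFunctorCategory k C M where
  obj :=
    { obj d := cotensor k (d ⟶ c) N
      map g := cotensorLift ((cotensorπ _ N).comp (Linear.leftComp k c g))
      map_id d := cotensor_hom_ext fun x => by simp [cotensorLift_π]
      map_comp f g := cotensor_hom_ext fun x => by simp [cotensorLift_π] }
  property := by
    refine ⟨⟨fun {X Y f g} => cotensor_hom_ext fun x => ?_⟩,
      ⟨fun {X Y} f r => cotensor_hom_ext fun x => ?_⟩⟩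
    · simp [cotensorLift_π]
    · simp [cotensorLift_π]

/-- The evaluation of `hom(C(d, c), N)` at `f ∈ C(d, c)`, linear in `f`. -/
def cofreeπ (c : C) (N : M) (d : C) : (d ⟶ c) →ₗ[k] ((cofree k c N).obj.obj d ⟶ N) :=
  cotensorπ (d ⟶ c) N

theorem cofree_map_π (c : C) (N : M) {d e : C} (g : d ⟶ e) (f : e ⟶ c) :
    (cofree k c N).obj.map g ≫ cofreeπ c N e f = cofreeπ c N d (g ≫ f) :=
  cotensorLift_π _ _

theorem cofree_hom_ext {c : C} {N : M} {d : C} {T : M} {a b : T ⟶ (cofree k c N).obj.obj d}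
    (h : ∀ f : d ⟶ c, a ≫ cofreeπ c N d f = b ≫ cofreeπ c N d f) : a = b :=
  cotensor_hom_ext h

/-- The morphism to `hom(C(d, c), N)` with prescribed components. -/
def cofreeLift {c : C} {N : M} {d : C} {T : M} (φ : (d ⟶ c) →ₗ[k] (T ⟶ N)) :
    T ⟶ (cofree k c N).obj.obj d :=
  cotensorLift φ

theorem cofreeLift_π {c : C} {N : M} {d : C} {T : M} (φ : (d ⟶ c) →ₗ[k] (T ⟶ N)) (f : d ⟶ c) :
    cofreeLift φ ≫ cofreeπ c N d f = φ f :=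
  cotensorLift_π φ f

/-- The morphism `X ⟶ hom(C(-, c), N)` adjoint to a morphism `X(c) ⟶ N`. -/
def toCofree {X : LinearFunctorCategory k C M} {c : C} {N : M} (x : X.obj.obj c ⟶ N) :
    X ⟶ cofree k c N :=
  (isLinearFunctor k C M).homMk
    { app d := cofreeLift ((Linear.rightComp k _ x).comp (X.obj.mapLinearMap k))
      naturality d e g := cofree_hom_ext fun f => by
        rw [Category.assoc, Category.assoc, cofreeLift_π, cofree_map_π, cofreeLift_π]
        simp }

theorem toCofree_app_π {X : LinearFunctorCategory k C M} {c : C} {N : M} (x : X.obj.obj c ⟶ N)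
    {d : C} (f : d ⟶ c) : (toCofree x).hom.app d ≫ cofreeπ c N d f = X.obj.map f ≫ x :=
  cofreeLift_π _ _

end

section

variable [HasColimits M]

variable (k) in
/-- The functor `C(c, -) ⊗ N`, the value at `N` of the left adjoint of evaluation at `c`. -/
def free (c : C) (N : M) : LinearFunctorCategory k C M where
  obj :=
    { obj d := tensor k (c ⟶ d) N
      map g := tensorDesc ((tensorι _ N).comp (Linear.rightComp k c g))
      map_id d := tensor_hom_ext fun x => by simp [tensorι_desc]
      map_comp f g := tensor_hom_ext fun x => by
        rw [tensorι_desc, ← Category.assoc, tensorι_desc]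
        exact Eq.trans (by simp) (tensorι_desc _ _).symm }
  property := by
    refine ⟨⟨fun {X Y f g} => tensor_hom_ext fun x => ?_⟩,
      ⟨fun {X Y} f r => tensor_hom_ext fun x => ?_⟩⟩
    · simp [tensorι_desc]
    · simp [tensorι_desc]

/-- The inclusion of `N` into `C(c, d) ⊗ N` at `f ∈ C(c, d)`, linear in `f`. -/
def freeι (c : C) (N : M) (d : C) : (c ⟶ d) →ₗ[k] (N ⟶ (free k c N).obj.obj d) :=
  tensorι (c ⟶ d) N

theorem freeι_map (c : C) (N : M) {d e : C} (f : c ⟶ d) (g : d ⟶ e) :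
    freeι c N d f ≫ (free k c N).obj.map g = freeι c N e (f ≫ g) :=
  tensorι_desc _ _

theorem free_hom_ext {c : C} {N : M} {d : C} {T : M} {a b : (free k c N).obj.obj d ⟶ T}
    (h : ∀ f : c ⟶ d, freeι c N d f ≫ a = freeι c N d f ≫ b) : a = b :=
  tensor_hom_ext h

/-- The morphism from `C(c, d) ⊗ N` with prescribed components. -/
def freeDesc {c : C} {N : M} {d : C} {T : M} (φ : (c ⟶ d) →ₗ[k] (N ⟶ T)) :
    (free k c N).obj.obj d ⟶ T :=
  tensorDesc φ

theorem freeι_desc {c : C} {N : M} {d : C} {T : M} (φ : (c ⟶ d) →ₗ[k] (N ⟶ T)) (f : c ⟶ d) :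
    freeι c N d f ≫ freeDesc φ = φ f :=
  tensorι_desc φ f

/-- The morphism `C(c, -) ⊗ N ⟶ X` adjoint to a morphism `N ⟶ X(c)`. -/
def fromFree {X : LinearFunctorCategory k C M} {c : C} {N : M} (x : N ⟶ X.obj.obj c) :
    free k c N ⟶ X :=
  (isLinearFunctor k C M).homMk
    { app d := freeDesc ((Linear.leftComp k _ x).comp (X.obj.mapLinearMap k))
      naturality d e g := free_hom_ext fun f => by
        rw [← Category.assoc, ← Category.assoc, freeι_map, freeι_desc, freeι_desc]
        simp }

theorem freeι_fromFree_app {X : LinearFunctorCategory k C M} {c : C} {N : M}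
    (x : N ⟶ X.obj.obj c) {d : C} (f : c ⟶ d) :
    freeι c N d f ≫ (fromFree x).hom.app d = x ≫ X.obj.map f :=
  freeι_desc _ _

theorem free_functor_hom_ext {X : LinearFunctorCategory k C M} {c : C} {N : M}
    {a b : free k c N ⟶ X}
    (h : freeι c N c (𝟙 c) ≫ a.hom.app c = freeι c N c (𝟙 c) ≫ b.hom.app c) : a = b := by
  ext d
  refine free_hom_ext fun f => ?_
  have key : ∀ a : free k c N ⟶ X, freeι c N d f ≫ a.hom.app d =
      (freeι c N c (𝟙 c) ≫ a.hom.app c) ≫ X.obj.map f := fun a => by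
    rw [Category.assoc, ← naturality_app, ← Category.assoc, freeι_map, Category.id_comp]
  rw [key a, key b, h]

end

end Free

/-! ### The hom spaces of a linear Reedy category -/

section ReedyAlgebra

variable {k : Type w} [Field k] {C : Type v} [Category.{v} C] [Preadditive C] [Linear k C]

namespace ReedyStructure

variable (R : ReedyStructure.{t} k C)

theorem eq_or_lt_of_plus {c d : C} (f : R.plus.hom c d) (hf : f ≠ 0) :
    c = d ∨ R.deg c < R.deg d := by
  by_cases h : c = d
  · exact .inl h
  · exact .inr (R.isDirect_plus.deg_lt (c := ⟨c⟩) (d := ⟨d⟩) f hf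
      fun e => h (congrArg LinearSubcategory.Obj.obj e))

theorem eq_or_lt_of_minus {c d : C} (f : R.minus.hom c d) (hf : f ≠ 0) :
    c = d ∨ R.deg d < R.deg c := by
  by_cases h : c = d
  · exact .inl h
  · exact .inr (R.isInverse_minus.deg_lt (c := ⟨c⟩) (d := ⟨d⟩) f hf
      fun e => h (congrArg LinearSubcategory.Obj.obj e))

/-- A subcategory whose endomorphism spaces are one-dimensional has only scalar endomorphisms. -/
theorem exists_coefficient (S : LinearSubcategory k C) {c : C}
    (e : ((⟨c⟩ : S.Obj) ⟶ ⟨c⟩) ≃ₗ[k] k) :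
    ∃ χ : S.hom c c →ₗ[k] k, χ ⟨𝟙 c, S.id_mem c⟩ = 1 ∧ ∀ f : S.hom c c, f.1 = χ f • 𝟙 c := by
  let i : S.hom c c := ⟨𝟙 c, S.id_mem c⟩
  let e' : S.hom c c ≃ₗ[k] k := e
  have hi : e' i ≠ 0 := by
    intro h
    have h0 : i = 0 := e'.map_eq_zero_iff.1 h
    have h0' : 𝟙 c = 0 := congrArg Subtype.val h0
    have h1 : e'.symm 1 = 0 := by
      refine Subtype.ext ?_
      rw [← Category.comp_id (e'.symm 1).1, h0', comp_zero]
      rfl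
    exact one_ne_zero (e'.symm.map_eq_zero_iff.1 h1)
  refine ⟨(e' i)⁻¹ • e'.toLinearMap, inv_mul_cancel₀ hi, fun f => ?_⟩
  have h : f = ((e' i)⁻¹ * e' f) • i := by
    apply e'.injective
    rw [map_smul, smul_eq_mul, mul_assoc, mul_comm (e' f), ← mul_assoc, inv_mul_cancel₀ hi, one_mul]
  exact congrArg Subtype.val h

theorem exists_plus_coefficient (c : C) : ∃ χ : R.plus.hom c c →ₗ[k] k,
    χ ⟨𝟙 c, R.plus.id_mem c⟩ = 1 ∧ ∀ f : R.plus.hom c c, f.1 = χ f • 𝟙 c :=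
  exists_coefficient R.plus (R.isDirect_plus.nonempty_end_equiv ⟨c⟩).some

theorem exists_minus_coefficient (c : C) : ∃ χ : R.minus.hom c c →ₗ[k] k,
    χ ⟨𝟙 c, R.minus.id_mem c⟩ = 1 ∧ ∀ f : R.minus.hom c c, f.1 = χ f • 𝟙 c :=
  exists_coefficient R.minus (R.isInverse_minus.nonempty_end_equiv ⟨c⟩).some

section

variable {R}

open scoped TensorProduct DirectSum in
open Classical in
theorem factorizationMap_of_tmul (P N : LinearSubcategory k C) {c d e : C} (a : P.hom e d)
    (b : N.hom c e) :
    factorizationMap P N c d (DirectSum.lof k C (fun e => P.hom e d ⊗[k] N.hom c e) e (a ⊗ₜ b)) =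
      b.1 ≫ a.1 := by
  rw [factorizationMap, DirectSum.toModule_lof, TensorProduct.lift.tmul]
  rfl

open scoped TensorProduct DirectSum in
/-- Every morphism is a sum of composites of a morphism of `C⁻` with a morphism of `C⁺`. -/
theorem hom_induction (R : ReedyStructure.{t} k C) {c d : C} {p : (c ⟶ d) → Prop}
    (add : ∀ f g, p f → p g → p (f + g))
    (comp : ∀ (e : C) (b : R.minus.hom c e) (a : R.plus.hom e d), p (b.1 ≫ a.1)) (f : c ⟶ d) :
    p f := by
  classical
  obtain ⟨x, rfl⟩ := (R.factorization c d).2 f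
  have zero : p 0 := by simpa using comp c 0 0
  induction x using DirectSum.induction_on with
  | zero => simpa using zero
  | of e x =>
    induction x using TensorProduct.induction_on with
    | zero => simpa using zero
    | tmul a b =>
      have h := factorizationMap_of_tmul R.plus R.minus a b
      rw [DirectSum.lof_eq_of] at h
      rw [h]
      exact comp e b a
    | add x y hx hy =>
      rw [map_add, map_add]
      exact add _ _ hx hy
  | add x y hx hy =>
    rw [map_add]
    exact add _ _ hx hy

open scoped TensorProduct DirectSum in
/-- Linear maps out of `C(c, d)` may be prescribed, bilinearly, on the composites of morphisms of
`C⁻(c, e)` and `C⁺(e, d)`. -/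
theorem exists_linearMap (R : ReedyStructure.{t} k C) {c d : C} {G : Type*} [AddCommGroup G]
    [Module k G] (β : ∀ e : C, R.plus.hom e d →ₗ[k] R.minus.hom c e →ₗ[k] G) :
    ∃ T : (c ⟶ d) →ₗ[k] G, ∀ (e : C) (b : R.minus.hom c e) (a : R.plus.hom e d),
      T (b.1 ≫ a.1) = β e a b := by
  classical
  let E := LinearEquiv.ofBijective _ (R.factorization c d)
  refine ⟨(DirectSum.toModule k C G fun e => TensorProduct.lift (β e)).comp E.symm.toLinearMap,
    fun e b a => ?_⟩
  have h : E.symm (b.1 ≫ a.1) =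
      DirectSum.lof k C (fun e => R.plus.hom e d ⊗[k] R.minus.hom c e) e (a ⊗ₜ b) := by
    rw [LinearEquiv.symm_apply_eq]
    exact (factorizationMap_of_tmul R.plus R.minus a b).symm
  rw [LinearMap.comp_apply, LinearEquiv.coe_coe, h, DirectSum.toModule_lof,
    TensorProduct.lift.tmul]

end

/-- The space `C(c, d)` is the direct sum of `C⁺(c, d)` and of the space of morphisms that factor
through a degree-lowering morphism out of `c`; this is the spanning part. -/
theorem hom_induction_minus {c d : C} {p : (c ⟶ d) → Prop}
    (add : ∀ f g, p f → p g → p (f + g)) (plus : ∀ a : R.plus.hom c d, p a.1)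
    (comp : ∀ (e : C) (_ : R.deg e < R.deg c) (b : R.minus.hom c e) (a : R.plus.hom e d),
      p (b.1 ≫ a.1)) (f : c ⟶ d) : p f := by
  refine R.hom_induction add (fun e b a => ?_) f
  by_cases hb : b = 0
  · subst hb
    simpa using plus 0
  · obtain rfl | h := R.eq_or_lt_of_minus b hb
    · obtain ⟨χ, -, hχ⟩ := R.exists_minus_coefficient c
      rw [hχ b, Linear.smul_comp, Category.id_comp]
      exact plus (χ b • a)
    · exact comp e h b a

/-- The independence part of the decomposition in `hom_induction_minus`. -/
theorem exists_linearMap_minus {c d : C} {G : Type*} [AddCommGroup G] [Module k G]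
    (τ : R.plus.hom c d →ₗ[k] G)
    (β : ∀ e : C, R.deg e < R.deg c → R.minus.hom c e →ₗ[k] R.plus.hom e d →ₗ[k] G) :
    ∃ T : (c ⟶ d) →ₗ[k] G, (∀ a : R.plus.hom c d, T a.1 = τ a) ∧
      ∀ (e : C) (h : R.deg e < R.deg c) (b : R.minus.hom c e) (a : R.plus.hom e d),
        T (b.1 ≫ a.1) = β e h b a := by
  classical
  obtain ⟨χ, hχ, -⟩ := R.exists_minus_coefficient c
  let γ : R.plus.hom c d →ₗ[k] R.minus.hom c c →ₗ[k] G :=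
    LinearMap.mk₂ k (fun a b => χ b • τ a) (by simp)
      (fun _ _ _ => by rw [map_smul, smul_comm]) (by simp [add_smul]) (by simp [mul_smul])
  obtain ⟨T, hT⟩ := R.exists_linearMap (c := c) (d := d) (G := G) fun e =>
    if h : R.deg e < R.deg c then (β e h).flip else
      if h : c = e then h ▸ γ else 0
  refine ⟨T, fun a => ?_, fun e h b a => ?_⟩
  · have := hT c ⟨𝟙 c, R.minus.id_mem c⟩ a
    rw [Category.id_comp] at this
    rw [this]
    simp [γ, hχ]
  · rw [hT e b a, dif_pos h]
    rfl

/-- The dual of `hom_induction_minus`. -/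
theorem hom_induction_plus {d c : C} {p : (d ⟶ c) → Prop}
    (add : ∀ f g, p f → p g → p (f + g)) (minus : ∀ b : R.minus.hom d c, p b.1)
    (comp : ∀ (e : C) (_ : R.deg e < R.deg c) (b : R.minus.hom d e) (a : R.plus.hom e c),
      p (b.1 ≫ a.1)) (f : d ⟶ c) : p f := by
  refine R.hom_induction add (fun e b a => ?_) f
  by_cases ha : a = 0
  · subst ha
    simpa using minus 0
  · obtain rfl | h := R.eq_or_lt_of_plus a ha
    · obtain ⟨χ, -, hχ⟩ := R.exists_plus_coefficient e
      rw [hχ a, Linear.comp_smul, Category.comp_id]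
      exact minus (χ a • b)
    · exact comp e h b a

/-- The dual of `exists_linearMap_minus`. -/
theorem exists_linearMap_plus {d c : C} {G : Type*} [AddCommGroup G] [Module k G]
    (τ : R.minus.hom d c →ₗ[k] G)
    (β : ∀ e : C, R.deg e < R.deg c → R.minus.hom d e →ₗ[k] R.plus.hom e c →ₗ[k] G) :
    ∃ T : (d ⟶ c) →ₗ[k] G, (∀ b : R.minus.hom d c, T b.1 = τ b) ∧
      ∀ (e : C) (h : R.deg e < R.deg c) (b : R.minus.hom d e) (a : R.plus.hom e c),
        T (b.1 ≫ a.1) = β e h b a := by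
  classical
  obtain ⟨χ, hχ, -⟩ := R.exists_plus_coefficient c
  let γ : R.plus.hom c c →ₗ[k] R.minus.hom d c →ₗ[k] G :=
    LinearMap.mk₂ k (fun a b => χ a • τ b) (by simp [add_smul]) (by simp [mul_smul]) (by simp)
      (fun _ _ _ => by rw [map_smul, smul_comm])
  obtain ⟨T, hT⟩ := R.exists_linearMap (c := d) (d := c) (G := G) fun e =>
    if h : R.deg e < R.deg c then (β e h).flip else
      if h : c = e then h ▸ γ else 0
  refine ⟨T, fun b => ?_, fun e h b a => ?_⟩
  · have := hT c b ⟨𝟙 c, R.plus.id_mem c⟩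
    rw [Category.comp_id] at this
    rw [this]
    simp [γ, hχ]
  · rw [hT e b a, dif_pos h]
    rfl

end ReedyStructure

end ReedyAlgebra

/-! ### Constructions by recursion on the degree -/

section Choice

/-- Simultaneous construction, by recursion on a degree, of a family whose members have to satisfy
a condition that refers to the members of smaller degree. -/
theorem exists_family_of_deg {ι : Type*} (deg : ι → Ordinal.{t}) {T : ι → Type*}
    [∀ i, Inhabited (T i)] (Good : ∀ i, (∀ j, T j) → T i → Prop)
    (hloc : ∀ i s s', (∀ j, deg j < deg i → s j = s' j) → ∀ t, Good i s t → Good i s' t)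
    (step : ∀ i s, (∀ j, deg j < deg i → Good j s (s j)) → ∃ t, Good i s t) :
    ∃ s : ∀ i, T i, ∀ i, Good i s (s i) := by
  classical
  let ext (i : ι) (prev : ∀ j, deg j < deg i → T j) (j : ι) : T j :=
    if h : deg j < deg i then prev j h else default
  let F (i : ι) (prev : ∀ j, deg j < deg i → T j) : T i :=
    if h : ∃ t, Good i (ext i prev) t then h.choose else default
  have wf : WellFounded (fun i j => deg i < deg j) := InvImage.wf deg wellFounded_lt
  let s : ∀ i, T i := wf.fix F
  have hs : ∀ i, s i = F i (fun j _ => s j) := fun i => wf.fix_eq F i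
  have hext : ∀ i j, deg j < deg i → ext i (fun j _ => s j) j = s j := fun i j h => dif_pos h
  refine ⟨s, fun i => ?_⟩
  induction i using wf.induction with
  | _ i ih =>
    obtain ⟨t, ht⟩ := step i s ih
    have h : ∃ t, Good i (ext i fun j _ => s j) t :=
      ⟨t, hloc i _ _ (fun j hj => (hext i j hj).symm) t ht⟩
    have h' : s i = h.choose := (hs i).trans (dif_pos h)
    rw [h']
    exact hloc i _ _ (hext i) _ h.choose_spec

/-- A linear choice of solutions of a linear problem over a field. -/
theorem exists_linearMap_forall {k : Type*} [Field k] {V G : Type*} [AddCommGroup V] [Module k V]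
    [AddCommGroup G] [Module k G] (P : V → G → Prop)
    (hadd : ∀ x y g h, P x g → P y h → P (x + y) (g + h))
    (hsmul : ∀ (r : k) x g, P x g → P (r • x) (r • g)) (hex : ∀ x, ∃ g, P x g) :
    ∃ T : V →ₗ[k] G, ∀ x, P x (T x) := by
  let b := Module.Basis.ofVectorSpace k V
  choose g hg using hex
  refine ⟨b.constr k fun j => g (b j), fun x => ?_⟩
  have hx : x ∈ Submodule.span k (Set.range b) := by simp
  induction hx using Submodule.span_induction with
  | zero => simpa using hsmul 0 0 _ (hg 0)
  | mem x hx =>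
    obtain ⟨j, rfl⟩ := hx
    rw [b.constr_basis]
    exact hg _
  | smul r x _ hx =>
    rw [map_smul]
    exact hsmul r x _ hx
  | add x y _ _ hx hy =>
    rw [map_add]
    exact hadd x y _ _ hx hy

end Choice

/-! ### Matching and latching families -/

section Families

variable {k : Type w} [Field k] {C : Type v} [Category.{v} C] [Preadditive C] [Linear k C]
  (R : ReedyStructure.{t} k C) {M : Type u} [Category.{v} M] [Abelian M] [Linear k M]

/-- Postcomposition with a morphism of a linear subcategory. -/
def LinearSubcategory.postcomp (S : LinearSubcategory k C) (c : C) {d e : C} (g : S.hom d e) :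
    S.hom c d →ₗ[k] S.hom c e where
  toFun f := ⟨f.1 ≫ g.1, S.comp_mem f.2 g.2⟩
  map_add' _ _ := Subtype.ext (Preadditive.add_comp _ _ _ _ _ _)
  map_smul' _ _ := Subtype.ext (Linear.smul_comp _ _ _ _ _ _)

/-- Precomposition with a morphism of a linear subcategory. -/
def LinearSubcategory.precomp (S : LinearSubcategory k C) {c d : C} (e : C) (g : S.hom c d) :
    S.hom d e →ₗ[k] S.hom c e where
  toFun f := ⟨g.1 ≫ f.1, S.comp_mem g.2 f.2⟩
  map_add' _ _ := Subtype.ext (Preadditive.comp_add _ _ _ _ _ _)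
  map_smul' _ _ := Subtype.ext (Linear.comp_smul _ _ _ _ _ _)

/-- The natural families of linear maps `C⁻(c, d) → M(Z, Y(d))` for `d` of degree `< β`. For
`β = deg c` these are the `Z`-valued points of the matching object `M_c Y`. -/
structure MatchingFamily (Y : LinearFunctorCategory k C M) (c : C) (β : Ordinal.{t}) (Z : M) where
  app : ∀ d, R.deg d < β → R.minus.hom c d →ₗ[k] (Z ⟶ Y.obj.obj d)
  naturality : ∀ {d e : C} (hd : R.deg d < β) (he : R.deg e < β) (f : R.minus.hom c d)
    (g : R.minus.hom d e), app d hd f ≫ Y.obj.map g.1 = app e he (R.minus.postcomp c g f)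

/-- The natural families of linear maps `C⁺(d, c) → M(X(d), U)` for `d` of degree `< deg c`, that
is, the `U`-valued copoints of the latching object `L_c X`. -/
structure LatchingFamily (X : LinearFunctorCategory k C M) (c : C) (U : M) where
  app : ∀ d, R.deg d < R.deg c → R.plus.hom d c →ₗ[k] (X.obj.obj d ⟶ U)
  naturality : ∀ {d e : C} (hd : R.deg d < R.deg c) (he : R.deg e < R.deg c)
    (f : R.plus.hom e c) (g : R.plus.hom d e),
    X.obj.map g.1 ≫ app e he f = app d hd (R.plus.precomp c g f)

namespace MatchingFamily

variable {R} {Y Y' : LinearFunctorCategory k C M} {c : C} {β : Ordinal.{t}} {Z Z' : M}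

/-- The matching family given by the action of `Y` on a morphism `Z ⟶ Y(c)`. -/
def ofHom (β : Ordinal.{t}) (z : Z ⟶ Y.obj.obj c) : MatchingFamily R Y c β Z where
  app d _ := (Linear.leftComp k _ z).comp
    ((Y.obj.mapLinearMap k).comp (R.minus.hom c d).subtype)
  naturality hd he f g := by simp [LinearSubcategory.postcomp]

@[simp]
theorem ofHom_app (z : Z ⟶ Y.obj.obj c) {d : C} (hd : R.deg d < β) (f : R.minus.hom c d) :
    (ofHom β z).app d hd f = z ≫ Y.obj.map f.1 := rfl

/-- The zero family. -/
def zero : MatchingFamily R Y c β Z where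
  app _ _ := 0
  naturality _ _ _ _ := by simp

/-- The image of a matching family under a morphism of functors. -/
def map (q : MatchingFamily R Y c β Z) (p : Y ⟶ Y') : MatchingFamily R Y' c β Z where
  app d hd := (Linear.rightComp k _ (p.hom.app d)).comp (q.app d hd)
  naturality {d e} hd he f g := by
    change (q.app d hd f ≫ p.hom.app d) ≫ _ = q.app e he _ ≫ p.hom.app e
    rw [Category.assoc, ← naturality_app, ← Category.assoc, q.naturality hd he]

@[simp]
theorem map_app (q : MatchingFamily R Y c β Z) (p : Y ⟶ Y') {d : C} (hd : R.deg d < β)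
    (f : R.minus.hom c d) : (q.map p).app d hd f = q.app d hd f ≫ p.hom.app d := rfl

/-- Naturality needs to be checked only for the degree-lowering morphisms, since the other
morphisms of `C⁻` are scalars. -/
def mkOfLT (app : ∀ d, R.deg d < β → R.minus.hom c d →ₗ[k] (Z ⟶ Y.obj.obj d))
    (h : ∀ {d e : C} (hd : R.deg d < β) (he : R.deg e < β) (_ : R.deg e < R.deg d)
      (f : R.minus.hom c d) (g : R.minus.hom d e),
      app d hd f ≫ Y.obj.map g.1 = app e he (R.minus.postcomp c g f)) :
    MatchingFamily R Y c β Z where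
  app := app
  naturality {d e} hd he f g := by
    by_cases hg : g = 0
    · subst hg
      have h0 : R.minus.postcomp c (0 : R.minus.hom d e) f = 0 := Subtype.ext comp_zero
      rw [h0, map_zero]
      exact Eq.trans (congrArg _ (Y.obj.map_zero _ _)) comp_zero
    · obtain rfl | hlt := R.eq_or_lt_of_minus g hg
      · obtain ⟨χ, -, hχ⟩ := R.exists_minus_coefficient d
        have h1 : R.minus.postcomp c g f = χ g • f := Subtype.ext (by
          change f.1 ≫ g.1 = χ g • f.1
          rw [hχ g, Linear.comp_smul, Category.comp_id])
        rw [h1, map_smul, hχ g, Y.obj.map_smul, Y.obj.map_id, Linear.comp_smul, Category.comp_id]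
      · exact h hd he hlt f g

/-- The restriction of a matching family along `Z' ⟶ Z`. -/
def precomp (q : MatchingFamily R Y c β Z) (z : Z' ⟶ Z) : MatchingFamily R Y c β Z' where
  app d hd := (Linear.leftComp k _ z).comp (q.app d hd)
  naturality {d e} hd he f g := by
    change (z ≫ q.app d hd f) ≫ _ = z ≫ q.app e he _
    rw [Category.assoc, q.naturality hd he]

@[simp]
theorem precomp_app (q : MatchingFamily R Y c β Z) (z : Z' ⟶ Z) {d : C} (hd : R.deg d < β)
    (f : R.minus.hom c d) : (q.precomp z).app d hd f = z ≫ q.app d hd f := rfl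

variable [HasLimits M]

/-- The morphism to the matching object that corresponds to a matching family. -/
def lift (q : MatchingFamily R Y c (R.deg c) Z) : Z ⟶ R.matchingObj Y c :=
  weightedLimitLift (fun j => q.app j.obj.obj j.property)
    (fun i j r x => q.naturality i.property j.property x r.hom)

variable (R) in
/-- The components of the matching object. -/
def matchingπ (Y : LinearFunctorCategory k C M) (c : C) (d : C) (hd : R.deg d < R.deg c) :
    R.minus.hom c d →ₗ[k] (R.matchingObj Y c ⟶ Y.obj.obj d) :=
  weightedLimitπ (R.matchingWeight c) (R.inclusionLT R.minus (R.deg c) ⋙ Y.obj) ⟨⟨d⟩, hd⟩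

theorem lift_π (q : MatchingFamily R Y c (R.deg c) Z) {d : C} (hd : R.deg d < R.deg c)
    (f : R.minus.hom c d) : q.lift ≫ matchingπ R Y c d hd f = q.app d hd f :=
  weightedLimitLift_π _ _ _ _

variable (R) in
/-- The universal matching family. -/
def univ (Y : LinearFunctorCategory k C M) (c : C) :
    MatchingFamily R Y c (R.deg c) (R.matchingObj Y c) where
  app d hd := matchingπ R Y c d hd
  naturality {d e} hd he f g :=
    weightedLimit_w (R.matchingWeight c) (R.inclusionLT R.minus (R.deg c) ⋙ Y.obj)
      (i := ⟨⟨d⟩, hd⟩) (j := ⟨⟨e⟩, he⟩) (ObjectProperty.homMk g) f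

theorem matchingObj_hom_ext {a b : Z ⟶ R.matchingObj Y c}
    (h : ∀ (d : C) (hd : R.deg d < R.deg c) (f : R.minus.hom c d),
      a ≫ matchingπ R Y c d hd f = b ≫ matchingπ R Y c d hd f) : a = b :=
  weightedLimit_hom_ext fun j x => h j.obj.obj j.property x

theorem matchingMap_π {d : C} (hd : R.deg d < R.deg c) (f : R.minus.hom c d) :
    R.matchingMap Y c ≫ matchingπ R Y c d hd f = Y.obj.map f.1 :=
  weightedLimitLift_π _ _ _ _

end MatchingFamily

namespace LatchingFamily

variable {R} {X : LinearFunctorCategory k C M} {c : C} {U : M} [HasColimits M]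

/-- The morphism from the latching object that corresponds to a latching family. -/
def desc (h : LatchingFamily R X c U) : R.latchingObj X c ⟶ U :=
  weightedColimitDesc (fun j => h.app j.obj.obj j.property)
    (fun i j r x => h.naturality i.property j.property x r.hom)

variable (R) in
/-- The components of the latching object. -/
def latchingι (X : LinearFunctorCategory k C M) (c : C) (d : C) (hd : R.deg d < R.deg c) :
    R.plus.hom d c →ₗ[k] (X.obj.obj d ⟶ R.latchingObj X c) :=
  weightedColimitι (R.latchingWeight c) (R.inclusionLT R.plus (R.deg c) ⋙ X.obj) ⟨⟨d⟩, hd⟩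

theorem ι_desc (h : LatchingFamily R X c U) {d : C} (hd : R.deg d < R.deg c)
    (f : R.plus.hom d c) : latchingι R X c d hd f ≫ h.desc = h.app d hd f :=
  weightedColimitι_desc _ _ _ _

theorem latchingObj_hom_ext {a b : R.latchingObj X c ⟶ U}
    (h : ∀ (d : C) (hd : R.deg d < R.deg c) (f : R.plus.hom d c),
      latchingι R X c d hd f ≫ a = latchingι R X c d hd f ≫ b) : a = b :=
  weightedColimit_hom_ext fun j x => h j.obj.obj j.property x

theorem ι_latchingMap {d : C} (hd : R.deg d < R.deg c) (f : R.plus.hom d c) :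
    latchingι R X c d hd f ≫ R.latchingMap X c = X.obj.map f.1 :=
  weightedColimitι_desc _ _ _ _

variable (R) in
/-- The universal latching family. -/
def univ (X : LinearFunctorCategory k C M) (c : C) :
    LatchingFamily R X c (R.latchingObj X c) where
  app d hd := latchingι R X c d hd
  naturality {d e} hd he f g :=
    weightedColimit_w (R.latchingWeight c) (R.inclusionLT R.plus (R.deg c) ⋙ X.obj)
      (i := ⟨⟨d⟩, hd⟩) (j := ⟨⟨e⟩, he⟩) (ObjectProperty.homMk g) f

/-- The corestriction of a latching family along `U ⟶ V`. -/
def postcomp (h : LatchingFamily R X c U) {V : M} (p : U ⟶ V) : LatchingFamily R X c V where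
  app d hd := (Linear.rightComp k _ p).comp (h.app d hd)
  naturality {d e} hd he f g := by
    change _ ≫ h.app e he f ≫ p = h.app d hd _ ≫ p
    rw [← Category.assoc, h.naturality hd he]

end LatchingFamily

end Families

/-! ### Reedy fibrations -/

variable {k : Type w} [Field k] {C : Type v} [Category.{v} C] [Preadditive C] [Linear k C]
  {R : ReedyStructure.{t} k C} {M : Type u} [Category.{v} M] [Abelian M] [Linear k M]
  {𝒜 ℬ : ObjectProperty M}

section Fibrations

variable (R) in
/-- The relative matching map `E(c) ⟶ F(c) ×_{M_c F} M_c E` of `p : E ⟶ F` has the right lifting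
property with respect to `i`, spelled out in terms of matching families. -/
def HasMatchingLift {E F : LinearFunctorCategory k C M} (p : E ⟶ F) (c : C) {A A' : M}
    (i : A ⟶ A') : Prop :=
  ∀ (a : A ⟶ E.obj.obj c) (b : A' ⟶ F.obj.obj c) (q : MatchingFamily R E c (R.deg c) A'),
    i ≫ b = a ≫ p.hom.app c →
    (∀ d hd f, i ≫ q.app d hd f = a ≫ E.obj.map f.1) →
    (∀ d hd f, q.app d hd f ≫ p.hom.app d = b ≫ F.obj.map f.1) →
    ∃ l : A' ⟶ E.obj.obj c, i ≫ l = a ∧ l ≫ p.hom.app c = b ∧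
      ∀ d hd f, l ≫ E.obj.map f.1 = q.app d hd f

variable (R 𝒜) in
/-- The morphisms of functors all of whose relative matching maps have the right lifting property
with respect to the monomorphisms with cokernel in `𝒜`. -/
def reedyFibrations : MorphismProperty (LinearFunctorCategory k C M) := fun _ _ p =>
  ∀ (c : C) ⦃A A' : M⦄ (i : A ⟶ A'), monoWithCokernel 𝒜 i → HasMatchingLift R p c i

/-- Matching families lift along Reedy fibrations, one degree after the other. In degree `d` the
values on a basis of `C⁻(c, d)` are found by solving lifting problems against the relative
matching map at `d`. -/
theorem MatchingFamily.exists_lift {E F : LinearFunctorCategory k C M} {p : E ⟶ F}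
    (hp : reedyFibrations R 𝒜 p) {A A' : M} {i : A ⟶ A'} (hi : monoWithCokernel 𝒜 i) {c : C}
    {β : Ordinal.{t}} (x : MatchingFamily R E c β A) (y : MatchingFamily R F c β A')
    (hxy : ∀ d hd f, i ≫ y.app d hd f = x.app d hd f ≫ p.hom.app d) :
    ∃ z : MatchingFamily R E c β A', (∀ d hd f, i ≫ z.app d hd f = x.app d hd f) ∧
      ∀ d hd f, z.app d hd f ≫ p.hom.app d = y.app d hd f := by
  obtain ⟨s, hs⟩ := exists_family_of_deg R.deg
    (T := fun d => R.minus.hom c d →ₗ[k] (A' ⟶ E.obj.obj d))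
    (fun d s z => ∀ hd : R.deg d < β, ∀ f, i ≫ z f = x.app d hd f ∧
      z f ≫ p.hom.app d = y.app d hd f ∧
      ∀ (e : C) (_ : R.deg e < R.deg d) (g : R.minus.hom d e),
        z f ≫ E.obj.map g.1 = s e (R.minus.postcomp c g f))
    (fun d s s' h z hz hd f => ⟨(hz hd f).1, (hz hd f).2.1, fun e he g => by
      rw [← h e he]
      exact (hz hd f).2.2 e he g⟩)
    (fun d s ih => by
      by_cases hd : R.deg d < β
      swap
      · exact ⟨0, fun h => (hd h).elim⟩
      obtain ⟨z, hz⟩ := exists_linearMap_forall (k := k)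
        (fun (f : R.minus.hom c d) (z : A' ⟶ E.obj.obj d) => i ≫ z = x.app d hd f ∧
          z ≫ p.hom.app d = y.app d hd f ∧
          ∀ (e : C) (_ : R.deg e < R.deg d) (g : R.minus.hom d e),
            z ≫ E.obj.map g.1 = s e (R.minus.postcomp c g f))
        (fun f f' z z' h h' => ⟨by rw [Preadditive.comp_add, h.1, h'.1, map_add],
          by rw [Preadditive.add_comp, h.2.1, h'.2.1, map_add],
          fun e he g => by
            rw [Preadditive.add_comp, h.2.2 e he g, h'.2.2 e he g, map_add, map_add]⟩)
        (fun r f z h => ⟨by rw [Linear.comp_smul, h.1, map_smul],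
          by rw [Linear.smul_comp, h.2.1, map_smul],
          fun e he g => by rw [Linear.smul_comp, h.2.2 e he g, map_smul, map_smul]⟩)
        (fun f => by
          obtain ⟨l, h₁, h₂, h₃⟩ := hp d i hi (x.app d hd f) (y.app d hd f)
            (MatchingFamily.mkOfLT
              (fun e _ => (s e).comp (R.minus.precomp e f))
              (fun {e e'} he he' hlt g g' => by
                refine ((ih e he (he.trans hd) _).2.2 e' hlt g').trans ?_
                exact congrArg (s e') (Subtype.ext (Category.assoc _ _ _))))
            (hxy d hd f)
            (fun e he g => by
              refine ((ih e he (he.trans hd) _).1).trans ?_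
              exact (x.naturality hd (he.trans hd) f g).symm)
            (fun e he g => by
              refine ((ih e he (he.trans hd) _).2.1).trans ?_
              exact (y.naturality hd (he.trans hd) f g).symm)
          exact ⟨l, h₁, h₂, fun e he g => h₃ e he g⟩)
      exact ⟨z, fun _ f => hz f⟩)
  exact ⟨MatchingFamily.mkOfLT (fun d _ => s d)
    (fun {d e} hd _ hlt f g => (hs d hd f).2.2 e hlt g),
    fun d hd f => (hs d hd f).1, fun d hd f => (hs d hd f).2.1⟩

/-- The case of the matching families in all degrees up to `deg c`, evaluated at the identity. -/
theorem reedyFibrations_app {E F : LinearFunctorCategory k C M} {p : E ⟶ F}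
    (hp : reedyFibrations R 𝒜 p) (c : C) : (monoWithCokernel 𝒜).rlp (p.hom.app c) := by
  intro A A' i hi
  refine ⟨fun {a b} sq => ?_⟩
  have hc : R.deg c < Order.succ (R.deg c) := Order.lt_succ _
  obtain ⟨z, h₁, h₂⟩ := MatchingFamily.exists_lift hp hi
    (MatchingFamily.ofHom (R := R) (Order.succ (R.deg c)) a)
    (MatchingFamily.ofHom (Order.succ (R.deg c)) b) (fun d hd f => by
      rw [MatchingFamily.ofHom_app, MatchingFamily.ofHom_app, ← Category.assoc, ← sq.w,
        Category.assoc, Category.assoc, naturality_app])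
  exact ⟨⟨⟨z.app c hc ⟨𝟙 c, R.minus.id_mem c⟩, by simp [h₁], by simp [h₂]⟩⟩⟩

theorem epi_of_reedyFibrations (hgen : IsGenerating 𝒜) {E F : LinearFunctorCategory k C M}
    {p : E ⟶ F} (hp : reedyFibrations R 𝒜 p) : Epi p :=
  epi_of_epi_app p fun c => epi_of_rlp hgen _ (reedyFibrations_app hp c)

theorem isZero_app {Z : LinearFunctorCategory k C M} (hZ : IsZero Z) (d : C) :
    IsZero (Z.obj.obj d) :=
  (ev k M d).map_isZero hZ

variable [HasLimits M]

/-- Lifting problems for the matching map, in terms of matching families. -/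
theorem hasLiftingProperty_matchingMap_iff (Y : LinearFunctorCategory k C M) (c : C) {A A' : M}
    (i : A ⟶ A') : HasLiftingProperty i (R.matchingMap Y c) ↔
      ∀ (a : A ⟶ Y.obj.obj c) (q : MatchingFamily R Y c (R.deg c) A'),
        (∀ d hd f, i ≫ q.app d hd f = a ≫ Y.obj.map f.1) →
        ∃ l : A' ⟶ Y.obj.obj c, i ≫ l = a ∧ ∀ d hd f, l ≫ Y.obj.map f.1 = q.app d hd f := by
  refine ⟨fun h a q hq => ?_, fun h => ⟨fun {a b} sq => ?_⟩⟩
  · have sq : CommSq a i (R.matchingMap Y c) q.lift := ⟨by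
      refine MatchingFamily.matchingObj_hom_ext fun d hd f => ?_
      rw [Category.assoc, Category.assoc, q.lift_π, MatchingFamily.matchingMap_π, hq]⟩
    refine ⟨sq.lift, sq.fac_left, fun d hd f => ?_⟩
    rw [← MatchingFamily.matchingMap_π hd f, ← Category.assoc, sq.fac_right, q.lift_π]
  · obtain ⟨l, h₁, h₂⟩ := h a ((MatchingFamily.univ R Y c).precomp b) (fun d hd f => by
      rw [MatchingFamily.precomp_app, ← Category.assoc, ← sq.w, Category.assoc]
      exact congrArg _ (MatchingFamily.matchingMap_π hd f))
    refine ⟨⟨⟨l, h₁, MatchingFamily.matchingObj_hom_ext fun d hd f => ?_⟩⟩⟩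
    rw [Category.assoc, MatchingFamily.matchingMap_π, h₂]
    rfl

theorem psi_iff (hcot : IsCotorsionPair 𝒜 ℬ) (hgen : IsGenerating 𝒜)
    (Y : LinearFunctorCategory k C M) : R.Psi ℬ Y ↔
      ∀ (c : C) ⦃A A' : M⦄ (i : A ⟶ A'), monoWithCokernel 𝒜 i →
        HasLiftingProperty i (R.matchingMap Y c) := by
  refine forall_congr' fun c => ?_
  rw [← hcot.epiWithKernel_iff hgen, ← hcot.rlp_monoWithCokernel hgen]
  rfl

theorem reedyFibrations_of_isZero (hcot : IsCotorsionPair 𝒜 ℬ) (hgen : IsGenerating 𝒜)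
    {Y Z : LinearFunctorCategory k C M} (hY : R.Psi ℬ Y) (hZ : ∀ d, IsZero (Z.obj.obj d))
    (p : Y ⟶ Z) : reedyFibrations R 𝒜 p := by
  intro c A A' i hi a b q _ hq _
  rw [psi_iff hcot hgen] at hY
  obtain ⟨l, h₁, h₂⟩ := (hasLiftingProperty_matchingMap_iff Y c i).1 (hY c i hi) a q hq
  exact ⟨l, h₁, (hZ c).eq_of_tgt _ _, h₂⟩

theorem prop_app_of_psi (hcot : IsCotorsionPair 𝒜 ℬ) (hgen : IsGenerating 𝒜)
    {Y : LinearFunctorCategory k C M} (hY : R.Psi ℬ Y) (c : C) : ℬ (Y.obj.obj c) := by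
  have hZ := isZero_app (isZero_zero (LinearFunctorCategory k C M))
  have h := reedyFibrations_app (reedyFibrations_of_isZero hcot hgen hY hZ 0) c
  rw [hcot.right_eq]
  have : Epi ((0 : Y ⟶ _).hom.app c) := ⟨fun _ _ _ => (hZ c).eq_of_src _ _⟩
  refine rightPerp_of_epi (i := 𝟙 _) (w := (hZ c).eq_of_tgt _ _) h
    (ShortComplex.ShortExact.mk' ?_ inferInstance this)
  exact (ShortComplex.exact_iff_epi _ ((hZ c).eq_of_tgt _ _)).2 inferInstance

variable [HasColimits M]

/-- A relative matching problem is first lifted along the epimorphism `E(c) ⟶ F(c)`, whose kernel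
`Y(c)` lies in `ℬ`. The lift deviates from the prescribed matching family by a matching family
of `Y`, and it is corrected by an extension of the latter to a morphism into `Y(c)`. -/
theorem reedyFibrations_of_shortExact (hcot : IsCotorsionPair 𝒜 ℬ) (hgen : IsGenerating 𝒜)
    {Y E F : LinearFunctorCategory k C M} {j : Y ⟶ E} {p : E ⟶ F} {w : j ≫ p = 0}
    (hY : R.Psi ℬ Y) (hS : (ShortComplex.mk j p w).ShortExact) : reedyFibrations R 𝒜 p := by
  intro c A A' i hi a b q hab haq hqb
  have hpc : epiWithKernel ℬ (p.hom.app c) := by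
    obtain ⟨w', h⟩ := shortExact_app hS c
    exact ⟨_, _, w', prop_app_of_psi hcot hgen hY c, h⟩
  rw [← hcot.rlp_monoWithCokernel hgen] at hpc
  have := hpc i hi
  have sq : CommSq a i (p.hom.app c) b := ⟨hab.symm⟩
  have hmono : ∀ d, Mono (j.hom.app d) := fun d => (shortExact_app hS d).2.mono_f
  have key : ∀ d hd f, ∃ l : A' ⟶ Y.obj.obj d,
      l ≫ j.hom.app d = q.app d hd f - sq.lift ≫ E.obj.map f.1 := fun d hd f => by
    obtain ⟨w', h⟩ := shortExact_app hS d
    have := hmono d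
    refine ⟨h.exact.lift (q.app d hd f - sq.lift ≫ E.obj.map f.1) ?_, h.exact.lift_f _ _⟩
    change _ ≫ p.hom.app d = 0
    rw [Preadditive.sub_comp, hqb, Category.assoc, naturality_app, ← Category.assoc, sq.fac_right,
      sub_self]
  choose l hl using key
  let r : MatchingFamily R Y c (R.deg c) A' :=
    { app d hd :=
        { toFun := l d hd
          map_add' f g := by
            have := hmono d
            rw [← cancel_mono (j.hom.app d), Preadditive.add_comp, hl, hl, hl, map_add,
              Submodule.coe_add, Functor.map_add, Preadditive.comp_add]
            abel
          map_smul' s f := by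
            have := hmono d
            rw [← cancel_mono (j.hom.app d), RingHom.id_apply, Linear.smul_comp, hl, hl, map_smul,
              Submodule.coe_smul, Functor.map_smul, Linear.comp_smul, smul_sub] }
      naturality {d e} hd he f g := by
        have := hmono e
        change l d hd f ≫ _ = l e he _
        rw [← cancel_mono (j.hom.app e), Category.assoc, naturality_app, ← Category.assoc, hl, hl,
          Preadditive.sub_comp, q.naturality hd he, Category.assoc, ← Functor.map_comp]
        rfl }
  rw [psi_iff hcot hgen] at hY
  obtain ⟨m, h₁, h₂⟩ := (hasLiftingProperty_matchingMap_iff Y c i).1 (hY c i hi) 0 r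
    (fun d hd f => by
      have := hmono d
      change i ≫ l d hd f = _
      rw [← cancel_mono (j.hom.app d), Category.assoc, hl, Preadditive.comp_sub, haq,
        sq.fac_left_assoc]
      simp)
  refine ⟨sq.lift + m ≫ j.hom.app c, ?_, ?_, fun d hd f => ?_⟩
  · rw [Preadditive.comp_add, sq.fac_left, reassoc_of% h₁, zero_comp, add_zero]
  · rw [Preadditive.add_comp, sq.fac_right, Category.assoc, comp_app_eq_zero w, comp_zero, add_zero]
  · rw [Preadditive.add_comp, Category.assoc, ← naturality_app, ← Category.assoc, h₂]
    change _ + l d hd f ≫ _ = _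
    rw [hl]
    abel

theorem psi_of_reedyFibrations (hcot : IsCotorsionPair 𝒜 ℬ) (hgen : IsGenerating 𝒜)
    {Y E F : LinearFunctorCategory k C M} {j : Y ⟶ E} {p : E ⟶ F} {w : j ≫ p = 0}
    (hp : reedyFibrations R 𝒜 p) (hS : (ShortComplex.mk j p w).ShortExact) : R.Psi ℬ Y := by
  rw [psi_iff hcot hgen]
  intro c A A' i hi
  rw [hasLiftingProperty_matchingMap_iff]
  intro a q hq
  have hmono : ∀ d, Mono (j.hom.app d) := fun d => (shortExact_app hS d).2.mono_f
  obtain ⟨l, h₁, h₂, h₃⟩ := hp c i hi (a ≫ j.hom.app c) 0 (q.map j)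
    (by rw [comp_zero, Category.assoc, comp_app_eq_zero w, comp_zero])
    (fun d hd f => by
      rw [MatchingFamily.map_app, ← Category.assoc, hq, Category.assoc, Category.assoc,
        naturality_app])
    (fun d hd f => by
      rw [MatchingFamily.map_app, Category.assoc, comp_app_eq_zero w, comp_zero, zero_comp])
  obtain ⟨w', h⟩ := shortExact_app hS c
  have := hmono c
  obtain ⟨m, hm⟩ : ∃ m : A' ⟶ Y.obj.obj c, m ≫ j.hom.app c = l :=
    ⟨h.exact.lift l h₂, h.exact.lift_f _ _⟩
  refine ⟨m, ?_, fun d hd f => ?_⟩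
  · rw [← cancel_mono (j.hom.app c), Category.assoc, hm, h₁]
  · have := hmono d
    rw [← cancel_mono (j.hom.app d), Category.assoc, naturality_app, ← Category.assoc, hm, h₃,
      MatchingFamily.map_app]

theorem reedyFibrations_eq (hcot : IsCotorsionPair 𝒜 ℬ) (hgen : IsGenerating 𝒜) :
    (reedyFibrations R 𝒜 : MorphismProperty (LinearFunctorCategory k C M)) =
      epiWithKernel (R.Psi ℬ) := by
  ext E F p
  refine ⟨fun hp => ?_, fun ⟨_, _, _, hY, hS⟩ => reedyFibrations_of_shortExact hcot hgen hY hS⟩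
  have := epi_of_reedyFibrations hgen hp
  exact epiWithKernel_of_epi p this (psi_of_reedyFibrations hcot hgen hp (shortExact_kernel p))

end Fibrations

/-! ### Latching maps -/

section Latching

/-- A family of morphisms that is compatible with the degree-raising and the degree-lowering
morphisms in degrees `< β` is natural there. -/
theorem naturality_of_plus_of_minus {X E : LinearFunctorCategory k C M}
    (s : ∀ d, X.obj.obj d ⟶ E.obj.obj d) (β : Ordinal.{t})
    (hplus : ∀ d e, R.deg e < β → R.deg d < R.deg e → ∀ f : R.plus.hom d e,
      X.obj.map f.1 ≫ s e = s d ≫ E.obj.map f.1)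
    (hminus : ∀ d e, R.deg d < β → R.deg e < R.deg d → ∀ f : R.minus.hom d e,
      X.obj.map f.1 ≫ s e = s d ≫ E.obj.map f.1)
    {d e : C} (hd : R.deg d < β) (he : R.deg e < β) (f : d ⟶ e) :
    X.obj.map f ≫ s e = s d ≫ E.obj.map f := by
  have hplus' : ∀ m, ∀ f : R.plus.hom m e, X.obj.map f.1 ≫ s e = s m ≫ E.obj.map f.1 := by
    intro m f
    by_cases hf : f = 0
    · subst hf
      exact (by simp : X.obj.map 0 ≫ s e = s m ≫ E.obj.map 0)
    obtain rfl | h := R.eq_or_lt_of_plus f hf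
    · obtain ⟨χ, -, hχ⟩ := R.exists_plus_coefficient m
      rw [hχ f]
      simp
    · exact hplus m e he h f
  have hminus' : ∀ m, ∀ f : R.minus.hom d m, X.obj.map f.1 ≫ s m = s d ≫ E.obj.map f.1 := by
    intro m f
    by_cases hf : f = 0
    · subst hf
      exact (by simp : X.obj.map 0 ≫ s m = s d ≫ E.obj.map 0)
    obtain rfl | h := R.eq_or_lt_of_minus f hf
    · obtain ⟨χ, -, hχ⟩ := R.exists_minus_coefficient d
      rw [hχ f]
      simp
    · exact hminus d m hd h f
  induction f using R.hom_induction with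
  | add f g hf hg => simp [hf, hg]
  | comp m b a =>
    rw [Functor.map_comp, Functor.map_comp, Category.assoc, hplus', ← Category.assoc, hminus',
      Category.assoc]

variable [HasColimits M]

/-- Lifting problems for the latching map, in terms of latching families. -/
theorem hasLiftingProperty_latchingMap_iff (X : LinearFunctorCategory k C M) (c : C) {U V : M}
    (p : U ⟶ V) : HasLiftingProperty (R.latchingMap X c) p ↔
      ∀ (x : X.obj.obj c ⟶ V) (h : LatchingFamily R X c U),
        (∀ d hd f, h.app d hd f ≫ p = X.obj.map f.1 ≫ x) →
        ∃ l : X.obj.obj c ⟶ U, l ≫ p = x ∧ ∀ d hd f, X.obj.map f.1 ≫ l = h.app d hd f := by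
  refine ⟨fun H x h hh => ?_, fun H => ⟨fun {a b} sq => ?_⟩⟩
  · have sq : CommSq h.desc (R.latchingMap X c) p x := ⟨by
      refine LatchingFamily.latchingObj_hom_ext fun d hd f => ?_
      rw [← Category.assoc, ← Category.assoc, h.ι_desc, LatchingFamily.ι_latchingMap, hh]⟩
    refine ⟨sq.lift, sq.fac_right, fun d hd f => ?_⟩
    rw [← LatchingFamily.ι_latchingMap hd f, Category.assoc, sq.fac_left, h.ι_desc]
  · obtain ⟨l, h₁, h₂⟩ := H b ((LatchingFamily.univ R X c).postcomp a) (fun d hd f => by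
      change (LatchingFamily.latchingι R X c d hd f ≫ a) ≫ p = _
      rw [Category.assoc, sq.w, ← Category.assoc, LatchingFamily.ι_latchingMap])
    refine ⟨⟨⟨l, LatchingFamily.latchingObj_hom_ext fun d hd f => ?_, h₁⟩⟩⟩
    rw [← Category.assoc, LatchingFamily.ι_latchingMap, h₂]
    rfl

theorem phi_iff_monoWithCokernel (hcot : IsCotorsionPair 𝒜 ℬ) (hcogen : IsCogenerating ℬ)
    (X : LinearFunctorCategory k C M) : R.Phi 𝒜 X ↔
      ∀ c : C, monoWithCokernel 𝒜 (R.latchingMap X c) :=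
  forall_congr' fun _ => (hcot.monoWithCokernel_iff hcogen _).symm

/-- Morphisms out of an object of `Φ(𝒜)` lift along Reedy fibrations, one degree after the other:
in degree `c` one lifts the latching map against the relative matching map. -/
theorem exists_lift_of_phi (hcot : IsCotorsionPair 𝒜 ℬ) (hcogen : IsCogenerating ℬ)
    {X E F : LinearFunctorCategory k C M} (hX : R.Phi 𝒜 X) {p : E ⟶ F}
    (hp : reedyFibrations R 𝒜 p) (g : X ⟶ F) : ∃ l : X ⟶ E, l ≫ p = g := by
  rw [phi_iff_monoWithCokernel hcot hcogen] at hX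
  let _ : ∀ c, Inhabited (X.obj.obj c ⟶ E.obj.obj c) := fun _ => ⟨0⟩
  obtain ⟨s, hs⟩ := exists_family_of_deg R.deg (T := fun c => X.obj.obj c ⟶ E.obj.obj c)
    (fun c s z => z ≫ p.hom.app c = g.hom.app c ∧
      (∀ d, R.deg d < R.deg c → ∀ f : R.plus.hom d c,
        X.obj.map f.1 ≫ z = s d ≫ E.obj.map f.1) ∧
      ∀ d, R.deg d < R.deg c → ∀ f : R.minus.hom c d,
        X.obj.map f.1 ≫ s d = z ≫ E.obj.map f.1)
    (fun c s s' h z hz => ⟨hz.1, fun d hd f => by rw [← h d hd]; exact hz.2.1 d hd f,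
      fun d hd f => by rw [← h d hd]; exact hz.2.2 d hd f⟩)
    (fun c s ih => by
      have nat : ∀ {d e : C} (_ : R.deg d < R.deg c) (_ : R.deg e < R.deg c) (f : d ⟶ e),
          X.obj.map f ≫ s e = s d ≫ E.obj.map f := fun hd he f =>
        naturality_of_plus_of_minus (R := R) s (R.deg c)
          (fun d e he h f => (ih e he).2.1 d h f) (fun d e hd h f => (ih d hd).2.2 e h f) hd he f
      let x : LatchingFamily R X c (E.obj.obj c) :=
        { app d hd := (Linear.leftComp k _ (s d)).comp
            ((E.obj.mapLinearMap k).comp (R.plus.hom d c).subtype)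
          naturality {d e} hd he f g := by
            change _ ≫ s e ≫ E.obj.map f.1 = s d ≫ E.obj.map (g.1 ≫ f.1)
            rw [← Category.assoc, nat hd he, Functor.map_comp, Category.assoc] }
      let q : MatchingFamily R E c (R.deg c) (X.obj.obj c) :=
        { app d hd := (Linear.rightComp k _ (s d)).comp
            ((X.obj.mapLinearMap k).comp (R.minus.hom c d).subtype)
          naturality {d e} hd he f g := by
            change (X.obj.map f.1 ≫ s d) ≫ _ = X.obj.map (f.1 ≫ g.1) ≫ s e
            rw [Functor.map_comp, Category.assoc, Category.assoc, nat hd he] }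
      obtain ⟨l, h₁, h₂, h₃⟩ := hp c _ (hX c) x.desc (g.hom.app c) q
        (LatchingFamily.latchingObj_hom_ext fun d hd f => by
          rw [← Category.assoc, ← Category.assoc, x.ι_desc, LatchingFamily.ι_latchingMap]
          change _ = (s d ≫ E.obj.map f.1) ≫ _
          rw [Category.assoc, naturality_app, naturality_app, ← Category.assoc, (ih d hd).1])
        (fun e he f => LatchingFamily.latchingObj_hom_ext fun d hd f' => by
          rw [← Category.assoc, ← Category.assoc, x.ι_desc, LatchingFamily.ι_latchingMap]
          change X.obj.map f'.1 ≫ X.obj.map f.1 ≫ s e = (s d ≫ E.obj.map f'.1) ≫ E.obj.map f.1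
          rw [← Category.assoc, ← Functor.map_comp, nat hd he, Functor.map_comp, Category.assoc])
        (fun d hd f => by
          change (X.obj.map f.1 ≫ s d) ≫ _ = _
          rw [Category.assoc, (ih d hd).1, naturality_app])
      refine ⟨l, h₂, fun d hd f => ?_, fun d hd f => (h₃ d hd f).symm⟩
      rw [← LatchingFamily.ι_latchingMap hd f, Category.assoc, h₁, x.ι_desc]
      rfl)
  refine ⟨(isLinearFunctor k C M).homMk { app := s, naturality := fun c d f => ?_ }, ?_⟩
  · exact naturality_of_plus_of_minus (R := R) s
      (max (Order.succ (R.deg c)) (Order.succ (R.deg d)))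
      (fun d e _ h f => (hs e).2.1 d h f) (fun d e _ h f => (hs d).2.2 e h f)
      (lt_max_of_lt_left (Order.lt_succ _)) (lt_max_of_lt_right (Order.lt_succ _)) f
  · ext c
    exact (hs c).1

end Latching

section CofreeExtension

variable [HasLimits M] [HasColimits M]

/-- The universal functor over `X` that solves a lifting problem of the latching map `L_c X → X(c)`
against `p : U ⟶ V`: a `T`-valued point of `E(d)` consists of a point `x'` of `X(d)` and of a linear
map `φ : C(d, c) → M(T, U)` that is compatible with `x'` and with the given data. -/
theorem exists_cofreeExtension {X : LinearFunctorCategory k C M} {c : C} {U V : M} (p : U ⟶ V)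
    (x : X.obj.obj c ⟶ V) (h : LatchingFamily R X c U) :
    ∃ (E : LinearFunctorCategory k C M) (r : E ⟶ X)
      (Φ : ∀ d, (d ⟶ c) →ₗ[k] (E.obj.obj d ⟶ U)),
      (∀ {d e : C} (g : d ⟶ e) (u : e ⟶ c), E.obj.map g ≫ Φ e u = Φ d (g ≫ u)) ∧
      (∀ d (u : d ⟶ c), Φ d u ≫ p = r.hom.app d ≫ X.obj.map u ≫ x) ∧
      (∀ d e he (f : R.plus.hom e c) (u : d ⟶ e),
        Φ d (u ≫ f.1) = r.hom.app d ≫ X.obj.map u ≫ h.app e he f) ∧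
      (∀ {d : C} {T : M} (x' : T ⟶ X.obj.obj d) (φ : (d ⟶ c) →ₗ[k] (T ⟶ U)),
        (∀ u, φ u ≫ p = x' ≫ X.obj.map u ≫ x) →
        (∀ e he (f : R.plus.hom e c) (u : d ⟶ e),
          φ (u ≫ f.1) = x' ≫ X.obj.map u ≫ h.app e he f) →
        ∃ l : T ⟶ E.obj.obj d, l ≫ r.hom.app d = x' ∧ ∀ u, l ≫ Φ d u = φ u) ∧
      (∀ {d : C} {T : M} (l l' : T ⟶ E.obj.obj d), l ≫ r.hom.app d = l' ≫ r.hom.app d →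
        (∀ u, l ≫ Φ d u = l' ≫ Φ d u) → l = l') := by
  let G := cofree (M := M) k c U
  let I := Σ e : {e : C // R.deg e < R.deg c}, R.plus.hom e.1 c
  let W : I → LinearFunctorCategory k C M := fun j => cofree k j.1.1 U
  let rel₁ : X ⊞ G ⟶ cofree k c V :=
    biprod.desc (-toCofree x) (toCofree (cofreeπ c U c (𝟙 c) ≫ p))
  let rel₂ : X ⊞ G ⟶ ∏ᶜ W :=
    Pi.lift fun j => biprod.desc (-toCofree (h.app j.1.1 j.1.2 j.2))
      (toCofree (cofreeπ c U _ j.2.1))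
  let rel : X ⊞ G ⟶ cofree k c V ⊞ ∏ᶜ W := biprod.lift rel₁ rel₂
  let r₁ : X ⊞ G ⟶ X := biprod.fst
  let r₂ : X ⊞ G ⟶ G := biprod.snd
  -- the two relations, evaluated on points
  have h₁ : ∀ {d : C} {T : M} (y : T ⟶ (X ⊞ G).obj.obj d) (u : d ⟶ c),
      (y ≫ rel₁.hom.app d) ≫ cofreeπ c V d u =
        (y ≫ r₂.hom.app d) ≫ cofreeπ c U d u ≫ p -
          (y ≫ r₁.hom.app d) ≫ X.obj.map u ≫ x := fun {d T} y u => by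
    have : rel₁ = r₂ ≫ toCofree (cofreeπ c U c (𝟙 c) ≫ p) - r₁ ≫ toCofree x := by
      refine biprod.hom_ext' _ _ ?_ ?_ <;> simp [rel₁, r₁, r₂]
    rw [this]
    change (y ≫ (r₂.hom.app d ≫ (toCofree _).hom.app d - r₁.hom.app d ≫ (toCofree x).hom.app d)) ≫
      _ = _
    rw [Preadditive.comp_sub, Preadditive.sub_comp]
    simp only [Category.assoc, toCofree_app_π]
    rw [← Category.assoc (G.obj.map u), cofree_map_π, Category.comp_id]
  have h₂ : ∀ {d : C} {T : M} (y : T ⟶ (X ⊞ G).obj.obj d) (j : I) (u : d ⟶ j.1.1),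
      ((y ≫ rel₂.hom.app d) ≫ (Pi.π W j).hom.app d) ≫ cofreeπ j.1.1 U d u =
        (y ≫ r₂.hom.app d) ≫ cofreeπ c U d (u ≫ j.2.1) -
          (y ≫ r₁.hom.app d) ≫ X.obj.map u ≫ h.app j.1.1 j.1.2 j.2 := fun {d T} y j u => by
    have : rel₂ ≫ Pi.π W j = r₂ ≫ toCofree (cofreeπ c U _ j.2.1) -
        r₁ ≫ toCofree (h.app j.1.1 j.1.2 j.2) := by
      refine biprod.hom_ext' _ _ ?_ ?_ <;> simp [rel₂, r₁, r₂]
    rw [Category.assoc y, ← comp_app, this]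
    change (y ≫ (r₂.hom.app d ≫ (toCofree _).hom.app d - r₁.hom.app d ≫ (toCofree _).hom.app d)) ≫
      _ = _
    rw [Preadditive.comp_sub, Preadditive.sub_comp]
    simp only [Category.assoc, toCofree_app_π]
    rw [cofree_map_π]
  have hrel : ∀ {d : C} {T : M} (y : T ⟶ (X ⊞ G).obj.obj d), y ≫ rel.hom.app d = 0 ↔
      y ≫ rel₁.hom.app d = 0 ∧ y ≫ rel₂.hom.app d = 0 := fun {d T} y => by
    have e₁ : rel.hom.app d ≫ (biprod.fst : cofree k c V ⊞ ∏ᶜ W ⟶ _).hom.app d = rel₁.hom.app d :=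
      congrArg (fun f => f.hom.app d) (biprod.lift_fst rel₁ rel₂)
    have e₂ : rel.hom.app d ≫ (biprod.snd : cofree k c V ⊞ ∏ᶜ W ⟶ _).hom.app d = rel₂.hom.app d :=
      congrArg (fun f => f.hom.app d) (biprod.lift_snd rel₁ rel₂)
    refine ⟨fun hy => ?_, fun hy => biprod_app_hom_ext ?_ ?_⟩
    · rw [← e₁, ← e₂, reassoc_of% hy, reassoc_of% hy]
      simp
    · rw [Category.assoc, e₁, hy.1, zero_comp]
    · rw [Category.assoc, e₂, hy.2, zero_comp]
  let κ := kernel.ι rel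
  have hκ := fun d => (hrel (κ.hom.app d)).1 (comp_app_eq_zero (kernel.condition rel) d)
  refine ⟨kernel rel, κ ≫ r₁, fun d => (Linear.leftComp k U (κ.hom.app d ≫ r₂.hom.app d)).comp
    (cofreeπ c U d), fun {d e} g u => ?_, fun d u => ?_, fun d e he f u => ?_,
    fun {d T} x' φ hφ₁ hφ₂ => ?_, fun {d T} l l' hl hl' => ?_⟩
  · change _ ≫ (κ.hom.app e ≫ r₂.hom.app e) ≫ _ = (κ.hom.app d ≫ r₂.hom.app d) ≫ _
    rw [← cofree_map_π, ← Category.assoc, ← comp_app, naturality_app, Category.assoc]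
    rfl
  · change ((κ.hom.app d ≫ r₂.hom.app d) ≫ _) ≫ p = (κ.hom.app d ≫ r₁.hom.app d) ≫ _
    rw [Category.assoc, ← sub_eq_zero, ← h₁, (hκ d).1, zero_comp]
  · change (κ.hom.app d ≫ r₂.hom.app d) ≫ _ = (κ.hom.app d ≫ r₁.hom.app d) ≫ _
    rw [← sub_eq_zero]
    refine (h₂ (κ.hom.app d) ⟨⟨e, he⟩, f⟩ u).symm.trans ?_
    rw [(hκ d).2, zero_comp, zero_comp]
  · obtain ⟨y, hy₁, hy₂⟩ := exists_biprod_app_lift (Y := G) x' (cofreeLift φ)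
    obtain ⟨l, hl⟩ := exists_lift_kernel_app rel y ((hrel y).2
      ⟨cofree_hom_ext fun u => by
        rw [h₁, hy₂, hy₁, ← Category.assoc, cofreeLift_π, hφ₁, sub_self, zero_comp],
      pi_app_hom_ext W fun j => cofree_hom_ext fun u => by
        rw [h₂, hy₂, hy₁, cofreeLift_π, hφ₂ _ j.1.2, sub_self, zero_comp, zero_comp]⟩)
    refine ⟨l, ?_, fun u => ?_⟩
    · rw [comp_app, reassoc_of% hl, hy₁]
    · change l ≫ (κ.hom.app d ≫ r₂.hom.app d) ≫ _ = _
      rw [Category.assoc, reassoc_of% hl, reassoc_of% hy₂, cofreeLift_π]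
  · have := mono_kernelι_app rel d
    rw [← cancel_mono ((kernel.ι rel).hom.app d)]
    refine biprod_app_hom_ext ?_ (cofree_hom_ext fun u => ?_)
    · rw [Category.assoc, Category.assoc]
      exact hl
    · have := hl' u
      change l ≫ (κ.hom.app d ≫ r₂.hom.app d) ≫ _ = l' ≫ (κ.hom.app d ≫ r₂.hom.app d) ≫ _ at this
      simpa using this

end CofreeExtension

section Latching

variable [HasLimits M] [HasColimits M]

/-- An object onto which all Reedy fibrations split has latching maps with the left lifting
property: the universal functor of `exists_cofreeExtension` is Reedy fibred over `X`, since linear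
maps out of `C(d, c)` may be prescribed separately on the degree-lowering morphisms and on the
morphisms that factor through an object of degree smaller than `deg c`. -/
theorem phi_of_forall_section (hcot : IsCotorsionPair 𝒜 ℬ) (hgen : IsGenerating 𝒜)
    (hcogen : IsCogenerating ℬ) {X : LinearFunctorCategory k C M}
    (H : ∀ (E : LinearFunctorCategory k C M) (r : E ⟶ X), reedyFibrations R 𝒜 r →
      ∃ s : X ⟶ E, s ≫ r = 𝟙 X) : R.Phi 𝒜 X := by
  rw [phi_iff_monoWithCokernel hcot hcogen]
  intro c
  rw [← hcot.llp_epiWithKernel hcogen]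
  intro U V p hp
  rw [← hcot.rlp_monoWithCokernel hgen] at hp
  rw [hasLiftingProperty_latchingMap_iff]
  intro x h hx
  obtain ⟨E, r, Φ, hmap, hΦ₁, hΦ₂, hlift, hext⟩ := exists_cofreeExtension p x h
  have hr : reedyFibrations R 𝒜 r := by
    intro d A A' i hi a b q hab haq hqb
    have := hp i hi
    -- the lift on the degree-lowering morphisms `d ⟶ c`
    obtain ⟨τ, hτ⟩ : ∃ τ : R.minus.hom d c →ₗ[k] (A' ⟶ U), ∀ m,
        i ≫ τ m = a ≫ Φ d m.1 ∧ τ m ≫ p = b ≫ X.obj.map m.1 ≫ x ∧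
          ∀ hcd : R.deg c < R.deg d, τ m = q.app c hcd m ≫ Φ c (𝟙 c) := by
      by_cases hcd : R.deg c < R.deg d
      · refine ⟨(Linear.rightComp k _ (Φ c (𝟙 c))).comp (q.app c hcd),
          fun m => ⟨?_, ?_, fun _ => rfl⟩⟩
        · change i ≫ q.app c hcd m ≫ _ = _
          rw [← Category.assoc, haq, Category.assoc, hmap, Category.comp_id]
        · change (q.app c hcd m ≫ _) ≫ p = _
          rw [Category.assoc, hΦ₁, ← Category.assoc, hqb, X.obj.map_id, Category.id_comp,
            Category.assoc]
      · refine (exists_linearMap_forall (k := k) (fun (m : R.minus.hom d c) (z : A' ⟶ U) =>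
          i ≫ z = a ≫ Φ d m.1 ∧ z ≫ p = b ≫ X.obj.map m.1 ≫ x)
          (fun m m' z z' h h' => ⟨?_, ?_⟩) (fun r m z h => ⟨?_, ?_⟩) fun m => ?_).imp
          fun τ hτ m => ⟨(hτ m).1, (hτ m).2, fun h => (hcd h).elim⟩
        · rw [Preadditive.comp_add, h.1, h'.1, Submodule.coe_add, map_add, Preadditive.comp_add]
        · rw [Preadditive.add_comp, h.2, h'.2, Submodule.coe_add, Functor.map_add,
            Preadditive.add_comp, Preadditive.comp_add]
        · rw [Linear.comp_smul, h.1, Submodule.coe_smul, map_smul, Linear.comp_smul]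
        · rw [Linear.smul_comp, h.2, Submodule.coe_smul, Functor.map_smul, Linear.smul_comp,
            Linear.comp_smul]
        · have sq : CommSq (a ≫ Φ d m.1) i p (b ≫ X.obj.map m.1 ≫ x) := ⟨by
            rw [Category.assoc, hΦ₁, reassoc_of% hab]⟩
          exact ⟨sq.lift, sq.fac_left, sq.fac_right⟩
    obtain ⟨φ, hφτ, hφ⟩ := R.exists_linearMap_plus (d := d) (c := c) τ fun e he =>
      LinearMap.mk₂ k (fun m f => b ≫ X.obj.map m.1 ≫ h.app e he f)
        (fun _ _ _ => by simp) (fun _ _ _ => by simp) (fun _ _ _ => by simp) (fun _ _ _ => by simp)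
    have hφ' : ∀ e he (m : R.minus.hom d e) (f : R.plus.hom e c),
        φ (m.1 ≫ f.1) = b ≫ X.obj.map m.1 ≫ h.app e he f := hφ
    -- `b` and `φ` define a point of `E(d)`
    have v₁ : ∀ u, φ u ≫ p = b ≫ X.obj.map u ≫ x := fun u => by
      induction u using R.hom_induction_plus with
      | add f g hf hg => simp [hf, hg]
      | minus m => rw [hφτ, (hτ m).2.1]
      | comp e he m f => rw [hφ' e he, Category.assoc, Category.assoc, hx, Functor.map_comp,
          Category.assoc]
    have v₂ : ∀ e he (f : R.plus.hom e c) (u : d ⟶ e),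
        φ (u ≫ f.1) = b ≫ X.obj.map u ≫ h.app e he f := fun e he f u => by
      induction u using R.hom_induction with
      | add u u' hu hu' => simp [hu, hu']
      | comp e' m f' =>
        by_cases hf' : f' = 0
        · subst hf'
          simp
        have he' : R.deg e' < R.deg c := by
          obtain rfl | hlt := R.eq_or_lt_of_plus f' hf'
          · exact he
          · exact hlt.trans he
        have := hφ' e' he' m (R.plus.precomp c f' f)
        rw [← h.naturality he' he f f'] at this
        rw [Functor.map_comp, Category.assoc, Category.assoc]
        exact this
    -- this point extends `a` and is compatible with the matching family `q`
    have v₃ : ∀ u, i ≫ φ u = a ≫ Φ d u := fun u => by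
      induction u using R.hom_induction_plus with
      | add f g hf hg => simp [hf, hg]
      | minus m => rw [hφτ, (hτ m).1]
      | comp e he m f => rw [hφ' e he, reassoc_of% hab, hΦ₂ d e he]
    have v₄ : ∀ e he (g : R.minus.hom d e) (u : e ⟶ c), φ (g.1 ≫ u) = q.app e he g ≫ Φ e u :=
        fun e he g u => by
      induction u using R.hom_induction_plus with
      | add u u' hu hu' => simp [hu, hu']
      | minus m =>
        by_cases hm : m = 0
        · subst hm
          simp
        have hcd : R.deg c < R.deg d := by
          obtain rfl | hlt := R.eq_or_lt_of_minus m hm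
          · exact he
          · exact hlt.trans he
        have e₁ : q.app e he g ≫ E.obj.map m.1 ≫ Φ c (𝟙 c) =
            q.app c hcd (R.minus.postcomp d m g) ≫ Φ c (𝟙 c) := by
          rw [← Category.assoc, q.naturality he hcd]
        rw [hmap, Category.comp_id] at e₁
        rw [e₁, ← (hτ _).2.2 hcd]
        exact hφτ (R.minus.postcomp d m g)
      | comp e' he' m f =>
        rw [hΦ₂ e e' he', ← Category.assoc (q.app e he g), hqb]
        refine Eq.trans ?_ ((hφ' e' he' (R.minus.postcomp d m g) f).trans ?_)
        · rw [← Category.assoc]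
          rfl
        · change b ≫ X.obj.map (g.1 ≫ m.1) ≫ _ = _
          simp
    obtain ⟨l, hl₁, hl₂⟩ := hlift b φ v₁ v₂
    refine ⟨l, hext _ _ ?_ fun u => ?_, hl₁, fun e he f => hext _ _ ?_ fun u => ?_⟩
    · rw [Category.assoc, hl₁, hab]
    · rw [Category.assoc, hl₂, v₃]
    · rw [Category.assoc, naturality_app, ← Category.assoc, hl₁, hqb]
    · rw [Category.assoc, hmap, hl₂, v₄]
  obtain ⟨s, hs⟩ := H E r hr
  have hs' : ∀ d, s.hom.app d ≫ r.hom.app d = 𝟙 _ := fun d => congrArg (fun f => f.hom.app d) hs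
  refine ⟨s.hom.app c ≫ Φ c (𝟙 c), ?_, fun d hd f => ?_⟩
  · rw [Category.assoc, hΦ₁, reassoc_of% hs' c, X.obj.map_id, Category.id_comp]
  · rw [← Category.assoc, naturality_app, Category.assoc, hmap, Category.comp_id,
      ← Category.id_comp f.1, hΦ₂ d d hd f, reassoc_of% hs' d, X.obj.map_id, Category.id_comp]

theorem phi_eq_leftPerp (hcot : IsCotorsionPair 𝒜 ℬ) (hgen : IsGenerating 𝒜)
    (hcogen : IsCogenerating ℬ) :
    (R.Phi 𝒜 : ObjectProperty (LinearFunctorCategory k C M)) = leftPerp (R.Psi ℬ) := by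
  ext X
  refine ⟨fun hX Y hY => extVanishes_one_of_section fun E i g w hS => ?_, fun hX => ?_⟩
  · exact exists_lift_of_phi hcot hcogen hX (reedyFibrations_of_shortExact hcot hgen hY hS) (𝟙 X)
  · refine phi_of_forall_section hcot hgen hcogen fun E r hr => ?_
    rw [reedyFibrations_eq hcot hgen] at hr
    obtain ⟨Y, i, w, hY, hS⟩ := hr
    exact (hX Y hY).exists_lift hS (𝟙 X)

end Latching

/-! ### Enough objects -/

section Enough

variable [HasLimits M]

theorem psi_pi (hcot : IsCotorsionPair 𝒜 ℬ) (hgen : IsGenerating 𝒜) {ι : Type v}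
    (W : ι → LinearFunctorCategory k C M) (hW : ∀ j, R.Psi ℬ (W j)) : R.Psi ℬ (∏ᶜ W) := by
  simp only [psi_iff hcot hgen, hasLiftingProperty_matchingMap_iff] at hW ⊢
  intro c A A' i hi a q hq
  choose l hl₁ hl₂ using fun j => hW j c i hi (a ≫ (Pi.π W j).hom.app c) (q.map (Pi.π W j))
    (fun d hd f => by
      rw [MatchingFamily.map_app, ← Category.assoc, hq, Category.assoc, Category.assoc,
        naturality_app])
  obtain ⟨m, hm⟩ := exists_pi_app_lift W l
  refine ⟨m, pi_app_hom_ext W fun j => ?_, fun d hd f => pi_app_hom_ext W fun j => ?_⟩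
  · rw [Category.assoc, hm, hl₁]
  · rw [Category.assoc, naturality_app, ← Category.assoc, hm, hl₂]
    rfl

/-- Matching problems in `hom(C(-, c), B)` are solved by prescribing a linear map on `C(d, c)`: on
the morphisms that factor through a degree-lowering morphism out of `d` it is given by the
matching family, and on `C⁺(d, c)` by extension of morphisms to `B`. -/
theorem psi_cofree (hcot : IsCotorsionPair 𝒜 ℬ) (hgen : IsGenerating 𝒜) (c : C) {B : M}
    (hB : ℬ B) : R.Psi ℬ (cofree k c B) := by
  rw [psi_iff hcot hgen]
  intro d A A' i hi
  rw [hasLiftingProperty_matchingMap_iff]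
  intro a q hq
  have hB' : (monoWithCokernel 𝒜).rlp (0 : B ⟶ 0) := by
    rw [hcot.rlp_monoWithCokernel hgen]
    exact epiWithKernel_to_zero hB (isZero_zero M) _
  have := hB' i hi
  obtain ⟨τ, hτ⟩ := exists_linearMap_forall (k := k)
    (fun (f : R.plus.hom d c) (z : A' ⟶ B) => i ≫ z = a ≫ cofreeπ c B d f.1)
    (fun f g z z' h h' => by simp [h, h'])
    (fun r f z h => by simp [h])
    (fun f => by
      have sq : CommSq (a ≫ cofreeπ c B d f.1) i (0 : B ⟶ 0) 0 := ⟨by simp⟩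
      exact ⟨sq.lift, sq.fac_left⟩)
  obtain ⟨T, hTτ, hT⟩ := R.exists_linearMap_minus τ fun e he =>
    LinearMap.mk₂ k (fun g f => q.app e he g ≫ cofreeπ c B e f.1)
      (fun _ _ _ => by simp) (fun _ _ _ => by simp) (fun _ _ _ => by simp) (fun _ _ _ => by simp)
  have hT' : ∀ e he (g : R.minus.hom d e) (f : R.plus.hom e c),
      T (g.1 ≫ f.1) = q.app e he g ≫ cofreeπ c B e f.1 := hT
  refine ⟨cofreeLift T, cofree_hom_ext fun u => ?_, fun e he g => cofree_hom_ext fun u => ?_⟩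
  · rw [Category.assoc, cofreeLift_π]
    induction u using R.hom_induction_minus with
    | add u u' hu hu' => simp [hu, hu']
    | plus f => rw [hTτ, hτ]
    | comp e he g f => rw [hT' e he, reassoc_of% hq e he g, cofree_map_π]
  · rw [Category.assoc, cofree_map_π, cofreeLift_π]
    induction u using R.hom_induction with
    | add u u' hu hu' => simp [hu, hu']
    | comp m g' f =>
      by_cases hg' : g' = 0
      · subst hg'
        simp
      have hm : R.deg m < R.deg d := by
        obtain rfl | hlt := R.eq_or_lt_of_minus g' hg'
        · exact he
        · exact hlt.trans he
      have := hT' m hm (R.minus.postcomp d g' g) f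
      rw [← q.naturality he hm, Category.assoc, cofree_map_π] at this
      rw [← this, ← Category.assoc]
      rfl

theorem isCogenerating_psi (hcot : IsCotorsionPair 𝒜 ℬ) (hgen : IsGenerating 𝒜)
    (hcogen : IsCogenerating ℬ) :
    IsCogenerating (R.Psi ℬ : ObjectProperty (LinearFunctorCategory k C M)) := by
  intro N
  choose B i hB hi using fun c => hcogen (N.obj.obj c)
  refine ⟨∏ᶜ fun c => cofree k c (B c), Pi.lift fun c => toCofree (i c),
    psi_pi hcot hgen _ fun c => psi_cofree hcot hgen c (hB c), mono_of_mono_app _ fun c => ?_⟩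
  have h : (Pi.lift fun c => toCofree (i c)).hom.app c ≫
      (Pi.π (fun c => cofree k c (B c)) c).hom.app c ≫ cofreeπ c (B c) c (𝟙 c) = i c := by
    rw [← Category.assoc, ← comp_app, Pi.lift_π, toCofree_app_π, N.obj.map_id, Category.id_comp]
  have : Mono ((Pi.lift fun c => toCofree (i c)).hom.app c ≫
      (Pi.π (fun c => cofree k c (B c)) c).hom.app c ≫ cofreeπ c (B c) c (𝟙 c)) := by
    rw [h]
    exact hi c
  exact mono_of_mono _ ((Pi.π (fun c => cofree k c (B c)) c).hom.app c ≫ cofreeπ c (B c) c (𝟙 c))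

variable [HasColimits M]

theorem isGenerating_phi (hcot : IsCotorsionPair 𝒜 ℬ) (hgen : IsGenerating 𝒜)
    (hcogen : IsCogenerating ℬ) :
    IsGenerating (R.Phi 𝒜 : ObjectProperty (LinearFunctorCategory k C M)) := by
  intro N
  choose A q hA hq using fun c => hgen (N.obj.obj c)
  let W := fun c => free k c (A c)
  refine ⟨∐ W, Sigma.desc fun c => fromFree (q c), ?_, epi_of_epi_app _ fun c => ?_⟩
  · refine phi_of_forall_section hcot hgen hcogen fun E r hr => ?_
    have : ∀ c, ∃ s : A c ⟶ E.obj.obj c,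
        s ≫ r.hom.app c = freeι c (A c) c (𝟙 c) ≫ (Sigma.ι W c).hom.app c := fun c => by
      have := reedyFibrations_app hr c (0 : 0 ⟶ A c)
        (monoWithCokernel_from_zero (hA c) (isZero_zero M) _)
      have sq : CommSq (0 : 0 ⟶ E.obj.obj c) (0 : 0 ⟶ A c) (r.hom.app c)
        (freeι c (A c) c (𝟙 c) ≫ (Sigma.ι W c).hom.app c) := ⟨by simp⟩
      exact ⟨sq.lift, sq.fac_right⟩
    choose s hs using this
    refine ⟨Sigma.desc fun c => fromFree (s c), Sigma.hom_ext _ _ fun c => ?_⟩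
    rw [← Category.assoc, Sigma.ι_desc, Category.comp_id]
    refine free_functor_hom_ext ?_
    rw [comp_app, ← Category.assoc, freeι_fromFree_app, E.obj.map_id, Category.comp_id, hs]
  · have h : (freeι c (A c) c (𝟙 c) ≫ (Sigma.ι W c).hom.app c) ≫
        (Sigma.desc fun c => fromFree (q c)).hom.app c = q c := by
      rw [Category.assoc, ← comp_app, Sigma.ι_desc, freeι_fromFree_app, N.obj.map_id,
        Category.comp_id]
    have : Epi ((freeι c (A c) c (𝟙 c) ≫ (Sigma.ι W c).hom.app c) ≫
        (Sigma.desc fun c => fromFree (q c)).hom.app c) := by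
      rw [h]
      exact hq c
    exact epi_of_epi (freeι c (A c) c (𝟙 c) ≫ (Sigma.ι W c).hom.app c) _

end Enough

/-! ### Universal extensions at an object -/

section FreeExtension

/-- The functor `Y'` under `Y` is universal with a solution `ζ` of the extension problem `(a, q)`
along `i : U ⟶ Z` for the matching map `Y(c) → M_c Y`. Universality is expressed objectwise: a
morphism from `Y'(d)` to `T` consists of a morphism `y : Y(d) ⟶ T` and of a linear map
`φ : C(c, d) → M(Z, T)` that are compatible with the given data. -/
structure IsFreeExtension {Y : LinearFunctorCategory k C M} {c : C} {U Z : M} (i : U ⟶ Z)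
    (a : U ⟶ Y.obj.obj c) (q : MatchingFamily R Y c (R.deg c) Z)
    {Y' : LinearFunctorCategory k C M} (j : Y ⟶ Y') (ζ : Z ⟶ Y'.obj.obj c) : Prop where
  w : i ≫ ζ = a ≫ j.hom.app c
  map (e : C) (he : R.deg e < R.deg c) (f : R.minus.hom c e) :
    ζ ≫ Y'.obj.map f.1 = q.app e he f ≫ j.hom.app e
  exists_desc {d : C} {T : M} (y : Y.obj.obj d ⟶ T) (φ : (c ⟶ d) →ₗ[k] (Z ⟶ T))
    (hi : ∀ u, i ≫ φ u = a ≫ Y.obj.map u ≫ y)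
    (hq : ∀ (e : C) (he : R.deg e < R.deg c) (f : R.minus.hom c e) (u : e ⟶ d),
      φ (f.1 ≫ u) = q.app e he f ≫ Y.obj.map u ≫ y) :
    ∃ l : Y'.obj.obj d ⟶ T, j.hom.app d ≫ l = y ∧ ∀ u, ζ ≫ Y'.obj.map u ≫ l = φ u
  hom_ext {d : C} {T : M} (l l' : Y'.obj.obj d ⟶ T) (hj : j.hom.app d ≫ l = j.hom.app d ≫ l')
    (hζ : ∀ u, ζ ≫ Y'.obj.map u ≫ l = ζ ≫ Y'.obj.map u ≫ l') : l = l'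

theorem exists_isFreeExtension [HasLimits M] [HasColimits M] {Y : LinearFunctorCategory k C M}
    {c : C} {U Z : M} (i : U ⟶ Z) (a : U ⟶ Y.obj.obj c)
    (q : MatchingFamily R Y c (R.deg c) Z) :
    ∃ (Y' : LinearFunctorCategory k C M) (j : Y ⟶ Y') (ζ : Z ⟶ Y'.obj.obj c),
      IsFreeExtension i a q j ζ := by
  let G := free (M := M) k c Z
  let I := Σ e : {e : C // R.deg e < R.deg c}, R.minus.hom c e.1
  let W : I → LinearFunctorCategory k C M := fun j => free k j.1.1 Z
  let rel₁ : free k c U ⟶ Y ⊞ G :=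
    biprod.lift (-fromFree a) (fromFree (i ≫ freeι c Z c (𝟙 c)))
  let rel₂ : ∐ W ⟶ Y ⊞ G :=
    Sigma.desc fun j => biprod.lift (-fromFree (q.app j.1.1 j.1.2 j.2))
      (fromFree (freeι c Z _ j.2.1))
  let rel : free k c U ⊞ ∐ W ⟶ Y ⊞ G := biprod.desc rel₁ rel₂
  let r₁ : Y ⟶ Y ⊞ G := biprod.inl
  let r₂ : G ⟶ Y ⊞ G := biprod.inr
  -- the two relations, evaluated on copoints
  have h₁ : ∀ {d : C} {T : M} (y : (Y ⊞ G).obj.obj d ⟶ T) (u : c ⟶ d),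
      freeι c U d u ≫ rel₁.hom.app d ≫ y =
        i ≫ freeι c Z d u ≫ r₂.hom.app d ≫ y -
          a ≫ Y.obj.map u ≫ r₁.hom.app d ≫ y := fun {d T} y u => by
    have : rel₁ = fromFree (i ≫ freeι c Z c (𝟙 c)) ≫ r₂ - fromFree a ≫ r₁ := by
      refine biprod.hom_ext _ _ ?_ ?_ <;> simp [rel₁, r₁, r₂]
    rw [this]
    change _ ≫ ((fromFree _).hom.app d ≫ r₂.hom.app d - (fromFree a).hom.app d ≫ r₁.hom.app d) ≫
      _ = _
    rw [Preadditive.sub_comp, Preadditive.comp_sub]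
    simp only [Category.assoc]
    rw [← Category.assoc (freeι c U d u), ← Category.assoc (freeι c U d u), freeι_fromFree_app,
      freeι_fromFree_app, Category.assoc, Category.assoc, Category.assoc]
    congr 2
    rw [← Category.assoc, freeι_map, Category.id_comp]
  have h₂ : ∀ {d : C} {T : M} (y : (Y ⊞ G).obj.obj d ⟶ T) (j : I) (u : j.1.1 ⟶ d),
      freeι j.1.1 Z d u ≫ (Sigma.ι W j).hom.app d ≫ rel₂.hom.app d ≫ y =
        freeι c Z d (j.2.1 ≫ u) ≫ r₂.hom.app d ≫ y -
          q.app j.1.1 j.1.2 j.2 ≫ Y.obj.map u ≫ r₁.hom.app d ≫ y := fun {d T} y j u => by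
    have : Sigma.ι W j ≫ rel₂ = fromFree (freeι c Z _ j.2.1) ≫ r₂ -
        fromFree (q.app j.1.1 j.1.2 j.2) ≫ r₁ := by
      refine biprod.hom_ext _ _ ?_ ?_ <;> simp [rel₂, r₁, r₂]
    rw [← Category.assoc ((Sigma.ι W j).hom.app d), ← comp_app, this]
    change _ ≫ ((fromFree _).hom.app d ≫ r₂.hom.app d - (fromFree _).hom.app d ≫ r₁.hom.app d) ≫
      _ = _
    rw [Preadditive.sub_comp, Preadditive.comp_sub]
    simp only [Category.assoc]
    rw [← Category.assoc (freeι j.1.1 Z d u), ← Category.assoc (freeι j.1.1 Z d u),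
      freeι_fromFree_app, freeι_fromFree_app, freeι_map, Category.assoc]
  have hrel : ∀ {d : C} {T : M} (y : (Y ⊞ G).obj.obj d ⟶ T), rel.hom.app d ≫ y = 0 ↔
      rel₁.hom.app d ≫ y = 0 ∧ rel₂.hom.app d ≫ y = 0 := fun {d T} y => by
    have e₁ : (biprod.inl : _ ⟶ free k c U ⊞ ∐ W).hom.app d ≫ rel.hom.app d = rel₁.hom.app d :=
      congrArg (fun f => f.hom.app d) (biprod.inl_desc rel₁ rel₂)
    have e₂ : (biprod.inr : _ ⟶ free k c U ⊞ ∐ W).hom.app d ≫ rel.hom.app d = rel₂.hom.app d :=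
      congrArg (fun f => f.hom.app d) (biprod.inr_desc rel₁ rel₂)
    refine ⟨fun hy => ?_, fun hy => biprod_app_hom_ext' ?_ ?_⟩
    · rw [← e₁, ← e₂, Category.assoc, Category.assoc, hy]
      simp
    · rw [← Category.assoc, e₁, hy.1, comp_zero]
    · rw [← Category.assoc, e₂, hy.2, comp_zero]
  let κ := cokernel.π rel
  have hκ := fun d => (hrel (κ.hom.app d)).1 (comp_app_eq_zero (cokernel.condition rel) d)
  have hζ : ∀ {d : C} (u : c ⟶ d), (freeι c Z c (𝟙 c) ≫ r₂.hom.app c ≫ κ.hom.app c) ≫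
      (cokernel rel).obj.map u = freeι c Z d u ≫ r₂.hom.app d ≫ κ.hom.app d := fun {d} u => by
    rw [Category.assoc, Category.assoc, ← naturality_app, ← naturality_app_assoc,
      ← Category.assoc, freeι_map, Category.id_comp]
  refine ⟨cokernel rel, r₁ ≫ κ, freeι c Z c (𝟙 c) ≫ r₂.hom.app c ≫ κ.hom.app c,
    ⟨?_, fun e he f => ?_, fun {d T} y φ hφ₁ hφ₂ => ?_, fun {d T} l l' hl hl' => ?_⟩⟩
  · have := h₁ (κ.hom.app c) (𝟙 c)
    rw [(hκ c).1, comp_zero, Y.obj.map_id, Category.id_comp] at this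
    exact (sub_eq_zero.1 this.symm)
  · have := h₂ (κ.hom.app e) ⟨⟨e, he⟩, f⟩ (𝟙 e)
    rw [(hκ e).2, comp_zero, comp_zero, Y.obj.map_id, Category.id_comp, Category.comp_id] at this
    rw [hζ]
    exact (sub_eq_zero.1 this.symm)
  · obtain ⟨z, hz₁, hz₂⟩ := exists_biprod_app_desc (Y := G) y (freeDesc φ)
    obtain ⟨l, hl⟩ := exists_desc_cokernel_app rel z ((hrel z).2
      ⟨free_hom_ext fun u => by
        rw [h₁, hz₂, hz₁, freeι_desc, hφ₁, sub_self, comp_zero],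
      sigma_app_hom_ext W fun j => free_hom_ext fun u => by
        rw [h₂, hz₂, hz₁, freeι_desc, hφ₂ _ j.1.2, sub_self, comp_zero, comp_zero]⟩)
    refine ⟨l, ?_, fun u => ?_⟩
    · rw [comp_app, Category.assoc, hl, hz₁]
    · rw [← Category.assoc, hζ, Category.assoc, Category.assoc, hl, hz₂, freeι_desc]
  · have := epi_cokernelπ_app rel d
    rw [← cancel_epi ((cokernel.π rel).hom.app d)]
    refine biprod_app_hom_ext' ?_ (free_hom_ext fun u => ?_)
    · rw [← Category.assoc, ← Category.assoc]
      exact hl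
    · have := hl' u
      rw [← Category.assoc, hζ, ← Category.assoc _ _ l', hζ] at this
      simpa using this

end FreeExtension

namespace IsFreeExtension

variable {Y Y' : LinearFunctorCategory k C M} {c : C} {U Z : M} {i : U ⟶ Z}
  {a : U ⟶ Y.obj.obj c} {q : MatchingFamily R Y c (R.deg c) Z} {j : Y ⟶ Y'}
  {ζ : Z ⟶ Y'.obj.obj c}

theorem exists_functor_desc (h : IsFreeExtension i a q j ζ) {E : LinearFunctorCategory k C M}
    (y : Y ⟶ E) (z : Z ⟶ E.obj.obj c) (hz : i ≫ z = a ≫ y.hom.app c)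
    (hq : ∀ e he (f : R.minus.hom c e), z ≫ E.obj.map f.1 = q.app e he f ≫ y.hom.app e) :
    ∃ l : Y' ⟶ E, j ≫ l = y ∧ ζ ≫ l.hom.app c = z := by
  have H := fun d => h.exists_desc (d := d) (y.hom.app d)
    ((Linear.leftComp k _ z).comp (E.obj.mapLinearMap k))
    (fun u => by
      change i ≫ z ≫ E.obj.map u = _
      rw [reassoc_of% hz, naturality_app])
    (fun e he f u => by
      change z ≫ E.obj.map (f.1 ≫ u) = _
      rw [Functor.map_comp, reassoc_of% hq e he, naturality_app])
  choose l hl₁ hl₂ using H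
  replace hl₂ : ∀ d (u : c ⟶ d), ζ ≫ Y'.obj.map u ≫ l d = z ≫ E.obj.map u := hl₂
  refine ⟨(isLinearFunctor k C M).homMk { app := l, naturality := fun d e g => ?_ }, ?_, ?_⟩
  · refine h.hom_ext _ _ ?_ fun u => ?_
    · rw [reassoc_of% hl₁, ← naturality_app_assoc, hl₁, naturality_app]
    · rw [reassoc_of% hl₂, ← Functor.map_comp_assoc, hl₂, Functor.map_comp]
  · ext d
    exact hl₁ d
  · have := hl₂ c (𝟙 c)
    rwa [Y'.obj.map_id, E.obj.map_id, Category.id_comp, Category.comp_id] at this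

/-- Lifting problems against a universal extension are precisely lifting problems for relative
matching maps. -/
theorem llp (h : IsFreeExtension i a q j ζ) (hi : monoWithCokernel 𝒜 i)
    (hq : ∀ d hd f, i ≫ q.app d hd f = a ≫ Y.obj.map f.1) :
    (reedyFibrations R 𝒜).llp j := by
  intro E F p hp
  refine ⟨fun {y v} sq => ?_⟩
  have hsq : ∀ d, y.hom.app d ≫ p.hom.app d = j.hom.app d ≫ v.hom.app d := fun d =>
    congrArg (fun f => f.hom.app d) sq.w
  obtain ⟨z, hz₁, hz₂, hz₃⟩ := hp c i hi (a ≫ y.hom.app c) (ζ ≫ v.hom.app c) (q.map y)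
    (by rw [← Category.assoc, h.w, Category.assoc, Category.assoc, hsq])
    (fun d hd f => by
      rw [MatchingFamily.map_app, ← Category.assoc, hq, Category.assoc, Category.assoc,
        naturality_app])
    (fun d hd f => by
      rw [MatchingFamily.map_app, Category.assoc, Category.assoc, hsq, ← naturality_app,
        ← Category.assoc, ← Category.assoc, h.map])
  obtain ⟨l, hl₁, hl₂⟩ := h.exists_functor_desc y z hz₁ fun e he f => hz₃ e he f
  refine ⟨⟨⟨l, hl₁, ?_⟩⟩⟩
  ext d
  refine h.hom_ext _ _ ?_ fun u => ?_
  · rw [comp_app, ← hsq, ← Category.assoc, ← comp_app, hl₁]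
  · rw [comp_app, naturality_app_assoc, naturality_app, reassoc_of% hl₂, naturality_app,
      reassoc_of% hz₂]

/-- A universal extension at `c` does not change the values at the other objects of degree at most
`deg c`: all morphisms from `c` to such objects factor through a degree-lowering morphism. -/
theorem isIso_app (h : IsFreeExtension i a q j ζ)
    (hq : ∀ d hd f, i ≫ q.app d hd f = a ≫ Y.obj.map f.1) {d : C} (hdc : d ≠ c)
    (hd : R.deg d ≤ R.deg c) : IsIso (j.hom.app d) := by
  have hplus : ∀ f : R.plus.hom c d, f = 0 := fun f => by
    by_contra hf
    obtain he | hlt := R.eq_or_lt_of_plus f hf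
    · exact hdc he.symm
    · exact hlt.not_ge hd
  obtain ⟨φ, -, hφ⟩ := R.exists_linearMap_minus (c := c) (d := d) (G := Z ⟶ Y.obj.obj d) 0
    fun e he => LinearMap.mk₂ k (fun g f => q.app e he g ≫ Y.obj.map f.1)
      (fun _ _ _ => by simp) (fun _ _ _ => by simp) (fun _ _ _ => by simp) (fun _ _ _ => by simp)
  have hφ' : ∀ e he (g : R.minus.hom c e) (f : R.plus.hom e d),
      φ (g.1 ≫ f.1) = q.app e he g ≫ Y.obj.map f.1 := hφ
  obtain ⟨l, hl₁, hl₂⟩ := h.exists_desc (𝟙 _) φ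
    (fun u => by
      induction u using R.hom_induction_minus with
      | add u u' hu hu' => simp at hu hu'; simp [hu, hu']
      | plus f => simp [hplus f]
      | comp e he g f =>
        rw [hφ' e he, ← Category.assoc, hq]
        simp)
    (fun e he g u => by
      induction u using R.hom_induction with
      | add u u' hu hu' => simp at hu hu'; simp [hu, hu']
      | comp m g' f =>
        by_cases hg' : g' = 0
        · subst hg'
          simp
        have hm : R.deg m < R.deg c := by
          obtain rfl | hlt := R.eq_or_lt_of_minus g' hg'
          · exact he
          · exact hlt.trans he
        have := hφ' m hm (R.minus.postcomp c g' g) f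
        rw [← q.naturality he hm] at this
        rw [Category.comp_id, Functor.map_comp, ← Category.assoc, ← Category.assoc, ← this]
        rfl)
  refine ⟨l, hl₁, h.hom_ext _ _ (by rw [reassoc_of% hl₁, Category.comp_id]) fun u => ?_⟩
  rw [reassoc_of% hl₂, Category.comp_id]
  induction u using R.hom_induction_minus with
  | add u u' hu hu' => simp [hu, hu']
  | plus f => simp [hplus f]
  | comp e he g f =>
    rw [hφ' e he, Category.assoc, naturality_app, Functor.map_comp, ← Category.assoc ζ, h.map e he,
      Category.assoc]

/-- If the extension problem starts from the value at `c` itself, the universal extension has the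
value `Z` at `c`. -/
theorem isIso_of_id {i : Y.obj.obj c ⟶ Z} (h : IsFreeExtension i (𝟙 _) q j ζ)
    (hq : ∀ d hd f, i ≫ q.app d hd f = Y.obj.map f.1) : IsIso ζ := by
  obtain ⟨χ, hχ₁, hχ⟩ := R.exists_plus_coefficient c
  obtain ⟨φ, hφχ, hφ⟩ := R.exists_linearMap_minus (c := c) (d := c) (G := Z ⟶ Z)
    ((LinearMap.toSpanSingleton k _ (𝟙 Z)).comp χ)
    fun e he => LinearMap.mk₂ k (fun g f => q.app e he g ≫ Y.obj.map f.1 ≫ i)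
      (fun _ _ _ => by simp) (fun _ _ _ => by simp) (fun _ _ _ => by simp) (fun _ _ _ => by simp)
  have hφ' : ∀ e he (g : R.minus.hom c e) (f : R.plus.hom e c),
      φ (g.1 ≫ f.1) = q.app e he g ≫ Y.obj.map f.1 ≫ i := hφ
  replace hφχ : ∀ f : R.plus.hom c c, φ f.1 = χ f • 𝟙 Z := hφχ
  obtain ⟨l, hl₁, hl₂⟩ := h.exists_desc i φ
    (fun u => by
      rw [Category.id_comp]
      induction u using R.hom_induction_minus with
      | add u u' hu hu' => simp [hu, hu']
      | plus f =>
        rw [hφχ, hχ f]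
        simp
      | comp e he g f =>
        rw [hφ' e he, ← Category.assoc, hq]
        simp)
    (fun e he g u => by
      induction u using R.hom_induction with
      | add u u' hu hu' => simp [hu, hu']
      | comp m g' f =>
        by_cases hg' : g' = 0
        · subst hg'
          simp
        have hm : R.deg m < R.deg c := by
          obtain rfl | hlt := R.eq_or_lt_of_minus g' hg'
          · exact he
          · exact hlt.trans he
        have := hφ' m hm (R.minus.postcomp c g' g) f
        rw [← q.naturality he hm, Category.assoc] at this
        rw [Functor.map_comp, Category.assoc, ← this, ← Category.assoc]
        rfl)
  have hw : i ≫ ζ = j.hom.app c := by rw [h.w, Category.id_comp]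
  refine ⟨l, ?_, h.hom_ext _ _ (by rw [reassoc_of% hl₁, hw, Category.comp_id]) fun u => ?_⟩
  · have h₁ := hl₂ (𝟙 c)
    have h₂ := hφχ ⟨𝟙 c, R.plus.id_mem c⟩
    rw [hχ₁, one_smul] at h₂
    rwa [h₂, Y'.obj.map_id, Category.id_comp] at h₁
  · rw [reassoc_of% hl₂, Category.comp_id]
    induction u using R.hom_induction_minus with
    | add u u' hu hu' => simp [hu, hu']
    | plus f =>
      rw [hφχ, hχ f]
      simp
    | comp e he g f =>
      rw [hφ' e he, Category.assoc, Category.assoc, hw, naturality_app, Functor.map_comp,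
        ← Category.assoc ζ, h.map e he, Category.assoc]

end IsFreeExtension

/-! ### The cotorsion pair of linear functors -/

section CotorsionPair

variable [HasLimits M] [HasColimits M]

theorem llp_reedyFibrations (hcot : IsCotorsionPair 𝒜 ℬ) (hgen : IsGenerating 𝒜)
    (hcogen : IsCogenerating ℬ) {X Y : LinearFunctorCategory k C M} {f : X ⟶ Y}
    (hf : (reedyFibrations R 𝒜).llp f) : monoWithCokernel (R.Phi 𝒜) f := by
  rw [phi_eq_leftPerp hcot hgen hcogen]
  rw [reedyFibrations_eq hcot hgen] at hf
  exact monoWithCokernel_of_llp (isCogenerating_psi hcot hgen hcogen) f hf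

/-- If `Ext¹` from `Φ(𝒜)` to `Y` vanishes, then `Y` is a retract of its universal extensions, so
that its matching maps have the right lifting property. -/
theorem psi_eq_rightPerp (hcot : IsCotorsionPair 𝒜 ℬ) (hgen : IsGenerating 𝒜)
    (hcogen : IsCogenerating ℬ) :
    (R.Psi ℬ : ObjectProperty (LinearFunctorCategory k C M)) = rightPerp (R.Phi 𝒜) := by
  ext Y
  refine ⟨fun hY X hX => ?_, fun hY => ?_⟩
  · rw [phi_eq_leftPerp hcot hgen hcogen] at hX
    exact hX Y hY
  · rw [psi_iff hcot hgen]
    intro c U Z i hi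
    rw [hasLiftingProperty_matchingMap_iff]
    intro a q hq
    obtain ⟨Y', j, ζ, h⟩ := exists_isFreeExtension i a q
    obtain ⟨X, p, w, hX, hS⟩ := llp_reedyFibrations hcot hgen hcogen (h.llp hi hq)
    obtain ⟨r, hr⟩ := (hY X hX).exists_extension hS (𝟙 Y)
    have hr' : ∀ d, j.hom.app d ≫ r.hom.app d = 𝟙 _ := fun d =>
      congrArg (fun f => f.hom.app d) hr
    refine ⟨ζ ≫ r.hom.app c, ?_, fun d hd f => ?_⟩
    · rw [reassoc_of% h.w, hr', Category.comp_id]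
    · rw [Category.assoc, ← naturality_app, reassoc_of% h.map d hd, hr', Category.comp_id]

theorem isCotorsionPair_phi_psi (hcot : IsCotorsionPair 𝒜 ℬ) (hgen : IsGenerating 𝒜)
    (hcogen : IsCogenerating ℬ) :
    IsCotorsionPair (D := LinearFunctorCategory k C M) (R.Phi 𝒜) (R.Psi ℬ) :=
  ⟨phi_eq_leftPerp hcot hgen hcogen, psi_eq_rightPerp hcot hgen hcogen⟩

end CotorsionPair

/-! ### Completeness -/

section Core

variable [HasLimits M]

/-- The matching map at `c` depends only on the values at `c` and at the objects of smaller degree: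
if these are computed by `Z` and by `Y`, lifting properties carry over. -/
theorem hasLiftingProperty_matchingMap_of_isIso {Y Y' : LinearFunctorCategory k C M} (j : Y ⟶ Y')
    {c : C} {Z : M} (q : MatchingFamily R Y c (R.deg c) Z) (ζ : Z ⟶ Y'.obj.obj c) [IsIso ζ]
    (hj : ∀ e, R.deg e < R.deg c → IsIso (j.hom.app e))
    (hζ : ∀ e he (f : R.minus.hom c e), ζ ≫ Y'.obj.map f.1 = q.app e he f ≫ j.hom.app e)
    {A A' : M} (i : A ⟶ A') (h : HasLiftingProperty i q.lift) :
    HasLiftingProperty i (R.matchingMap Y' c) := by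
  rw [hasLiftingProperty_matchingMap_iff]
  intro a r hr
  let r' : MatchingFamily R Y c (R.deg c) A' :=
    { app e he := (Linear.rightComp k _ (have := hj e he; inv (j.hom.app e))).comp (r.app e he)
      naturality {d e} hd he f g := by
        have := hj d hd
        have := hj e he
        change (r.app d hd f ≫ inv (j.hom.app d)) ≫ _ = r.app e he _ ≫ inv (j.hom.app e)
        rw [IsIso.eq_comp_inv, Category.assoc, Category.assoc, naturality_app,
          IsIso.inv_hom_id_assoc, r.naturality hd he] }
  have hr' : ∀ e he f, r'.app e he f ≫ j.hom.app e = r.app e he f := fun e he f => by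
    have := hj e he
    change (r.app e he f ≫ inv (j.hom.app e)) ≫ j.hom.app e = _
    simp
  have sq : CommSq (a ≫ inv ζ) i q.lift r'.lift := ⟨by
    refine MatchingFamily.matchingObj_hom_ext fun e he f => ?_
    have := hj e he
    rw [Category.assoc, Category.assoc, Category.assoc, q.lift_π, r'.lift_π,
      ← cancel_mono (j.hom.app e)]
    simp only [Category.assoc]
    rw [← hζ, hr', hr, IsIso.inv_hom_id_assoc]⟩
  refine ⟨sq.lift ≫ ζ, by simp, fun e he f => ?_⟩
  rw [Category.assoc, hζ, ← q.lift_π, ← Category.assoc, ← Category.assoc, sq.fac_right, r'.lift_π,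
    hr']

variable (R 𝒜) in
/-- All matching maps of `Y` at `c` and at the objects of degree smaller than `deg c` have the right
lifting property with respect to the monomorphisms with cokernel in `𝒜`. -/
def IsFibrantUpTo (Y : LinearFunctorCategory k C M) (c : C) : Prop :=
  (monoWithCokernel 𝒜).rlp (R.matchingMap Y c) ∧
    ∀ d, R.deg d < R.deg c → (monoWithCokernel 𝒜).rlp (R.matchingMap Y d)

theorem IsFibrantUpTo.of_lt {Y : LinearFunctorCategory k C M} {c d : C}
    (h : IsFibrantUpTo R 𝒜 Y c) (hd : R.deg d < R.deg c) : IsFibrantUpTo R 𝒜 Y d :=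
  ⟨h.2 d hd, fun e he => h.2 e (he.trans hd)⟩

theorem rlp_matchingMap_of_isIso {Y Y' : LinearFunctorCategory k C M} (j : Y ⟶ Y') {c : C}
    (h : (monoWithCokernel 𝒜).rlp (R.matchingMap Y c)) (hc : IsIso (j.hom.app c))
    (hj : ∀ e, R.deg e < R.deg c → IsIso (j.hom.app e)) :
    (monoWithCokernel 𝒜).rlp (R.matchingMap Y' c) := fun A A' i hi =>
  hasLiftingProperty_matchingMap_of_isIso j (MatchingFamily.ofHom (R.deg c) (𝟙 _)) (j.hom.app c) hj
    (fun e he f => by rw [MatchingFamily.ofHom_app, Category.id_comp, naturality_app]) i (by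
      have : (MatchingFamily.ofHom (R := R) (R.deg c) (𝟙 (Y.obj.obj c))).lift =
          R.matchingMap Y c := MatchingFamily.matchingObj_hom_ext fun e he f => by
        rw [MatchingFamily.lift_π, MatchingFamily.matchingMap_π, MatchingFamily.ofHom_app,
          Category.id_comp]
      rw [this]
      exact h i hi)

theorem IsFibrantUpTo.of_isIso {Y Y' : LinearFunctorCategory k C M} (j : Y ⟶ Y')
    (hj : ∀ d, IsFibrantUpTo R 𝒜 Y d → IsIso (j.hom.app d)) {c : C}
    (h : IsFibrantUpTo R 𝒜 Y c) : IsFibrantUpTo R 𝒜 Y' c :=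
  ⟨rlp_matchingMap_of_isIso j h.1 (hj c h) fun e he => hj e (h.of_lt he), fun d hd =>
    rlp_matchingMap_of_isIso j (h.2 d hd) (hj d (h.of_lt hd))
      fun e he => hj e (h.of_lt (he.trans hd))⟩

variable [HasColimits M]

/-- If not all matching maps of `Y` are fibrations, let `c` be an object of least degree where this
fails. The universal extension of `Y` along the first factor `i` of a factorization
`Y(c) ⟶ Z ⟶ M_c Y` repairs the matching map at `c`, and changes neither the value nor the matching
map at objects where the matching maps were in order already. -/
theorem exists_extension_step (hA : IsCompleteCotorsionPair 𝒜 ℬ) (hgen : IsGenerating 𝒜)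
    (hcogen : IsCogenerating ℬ) (Y : LinearFunctorCategory k C M) :
    ∃ (Y' : LinearFunctorCategory k C M) (j : Y ⟶ Y'), (reedyFibrations R 𝒜).llp j ∧
      (∀ c, IsFibrantUpTo R 𝒜 Y c → IsIso (j.hom.app c)) ∧
      (¬ R.Psi ℬ Y → ∃ c, ¬ IsFibrantUpTo R 𝒜 Y c ∧ IsFibrantUpTo R 𝒜 Y' c) := by
  have hcot := hA.toIsCotorsionPair
  by_cases hY : R.Psi ℬ Y
  · refine ⟨Y, 𝟙 Y, fun _ _ p _ => inferInstance, fun c _ => ?_, fun h => (h hY).elim⟩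
    exact inferInstanceAs (IsIso (𝟙 (Y.obj.obj c)))
  let P : C → Prop := fun c => (monoWithCokernel 𝒜).rlp (R.matchingMap Y c)
  have hP : ∃ c, ¬ P c := by
    rw [psi_iff hcot hgen] at hY
    exact not_forall.1 hY
  obtain ⟨c, hc, hmin⟩ : ∃ c, ¬ P c ∧ ∀ d, R.deg d < R.deg c → P d := by
    have wf : WellFounded (fun c d => R.deg c < R.deg d) := InvImage.wf R.deg wellFounded_lt
    refine ⟨wf.min {c | ¬ P c} hP, wf.min_mem {c | ¬ P c} hP, fun d hd => ?_⟩
    by_contra h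
    exact wf.not_lt_min {c | ¬ P c} h hd
  obtain ⟨Z, i, p, hip, hi, hp⟩ := hA.exists_factorization hgen (R.matchingMap Y c)
  rw [hcot.llp_epiWithKernel hcogen] at hi
  rw [← hcot.rlp_monoWithCokernel hgen] at hp
  let q := (MatchingFamily.univ R Y c).precomp p
  have hq : ∀ d hd f, i ≫ q.app d hd f = Y.obj.map f.1 := fun d hd f => by
    change i ≫ p ≫ MatchingFamily.matchingπ R Y c d hd f = _
    rw [← Category.assoc, hip, MatchingFamily.matchingMap_π]
  have hqp : q.lift = p := MatchingFamily.matchingObj_hom_ext fun d hd f => q.lift_π hd f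
  have hq' : ∀ d hd f, i ≫ q.app d hd f = 𝟙 _ ≫ Y.obj.map f.1 := fun d hd f => by
    rw [hq, Category.id_comp]
  obtain ⟨Y', j, ζ, h⟩ := exists_isFreeExtension i (𝟙 _) q
  have hiso : ∀ d, IsFibrantUpTo R 𝒜 Y d → IsIso (j.hom.app d) := fun d hd => by
    refine h.isIso_app hq' ?_ (not_lt.1 fun hlt => hc (hd.2 c hlt))
    rintro rfl
    exact hc hd.1
  have hlow : ∀ d, R.deg d < R.deg c → IsFibrantUpTo R 𝒜 Y d := fun d hd =>
    ⟨hmin d hd, fun e he => hmin e (he.trans hd)⟩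
  have := h.isIso_of_id hq
  refine ⟨Y', j, h.llp hi hq', hiso, fun _ => ⟨c, fun h => hc h.1, fun A A' i' hi' => ?_,
    fun d hd => ((hlow d hd).of_isIso j hiso).1⟩⟩
  exact hasLiftingProperty_matchingMap_of_isIso j q ζ (fun e he => hiso e (hlow e he)) h.map i'
    (by rw [hqp]; exact hp i' hi')

end Core

section Complete

variable [HasLimits M] [HasColimits M]

open SmallObject in
open scoped Cardinal in
/-- Repairing the matching maps one after the other, by transfinite iteration, ends after fewer
steps than the successor cardinal of the number of objects of `C`, since every step repairs a
matching map that stays in order afterwards. -/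
theorem exists_llp_to_psi (hA : IsCompleteCotorsionPair 𝒜 ℬ) (hgen : IsGenerating 𝒜)
    (hcogen : IsCogenerating ℬ) (N : LinearFunctorCategory k C M) :
    ∃ (Y : LinearFunctorCategory k C M) (j : N ⟶ Y), (reedyFibrations R 𝒜).llp j ∧
      R.Psi ℬ Y := by
  choose S σ hσ hσiso hσnew using
    fun Y : LinearFunctorCategory k C M => exists_extension_step (R := R) hA hgen hcogen Y
  let Φ : SuccStruct (LinearFunctorCategory k C M) := { X₀ := N, succ := S, toSucc := σ }
  let κ : Cardinal.{v} := Order.succ (max ℵ₀ #C)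
  have hκ : ℵ₀ ≤ κ := (le_max_left _ _).trans (Order.le_succ _)
  have : NoMaxOrder κ.ord.ToType := Cardinal.noMaxOrder hκ
  have : Nonempty κ.ord.ToType := Cardinal.mk_ne_zero_iff.1 (by
    rw [Cardinal.mk_ord_toType]
    exact (Cardinal.aleph0_pos.trans_le hκ).ne')
  let _ : OrderBot κ.ord.ToType := WellFoundedLT.toOrderBot _
  let _ : SuccOrder κ.ord.ToType := SuccOrder.ofLinearWellFoundedLT _
  let F := Φ.iterationFunctor κ.ord.ToType
  have hsucc : ∀ (j : κ.ord.ToType), ∃ (e : S (F.obj j) ≅ F.obj (Order.succ j)),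
      F.map (homOfLE (Order.le_succ j)) = σ _ ≫ e.hom := fun j =>
    ⟨(Φ.iterationFunctorObjSuccIso j (not_isMax j)).symm,
      Φ.iterationFunctor_map_succ j (not_isMax j)⟩
  have happ : ∀ {X Y : LinearFunctorCategory k C M} (f : X ⟶ Y) [IsIso f] (c : C),
      IsIso (f.hom.app c) := fun f _ c => inferInstanceAs (IsIso ((ev k M c).map f))
  -- the values where the matching maps are in order are not changed any more
  have hiso : ∀ (j j' : κ.ord.ToType) (hj : j ≤ j') (c : C),
      IsFibrantUpTo R 𝒜 (F.obj j) c → IsIso ((F.map (homOfLE hj)).hom.app c) := by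
    intro j j'
    induction j' using SuccOrder.limitRecOn with
    | isMin j' hj' =>
      intro hj c _
      obtain rfl := le_antisymm hj (hj' hj)
      have : F.map (homOfLE hj) = 𝟙 _ := F.map_id _
      rw [this]
      exact happ _ c
    | succ j' _ ih =>
      intro hj c hc
      obtain rfl | hlt := hj.eq_or_lt
      · have : F.map (homOfLE hj) = 𝟙 _ := F.map_id _
        rw [this]
        exact happ _ c
      · have hj' := Order.le_of_lt_succ hlt
        obtain ⟨e, he⟩ := hsucc j'
        have h₁ := ih hj' c hc
        have h₂ := hσiso _ c (hc.of_isIso (F.map (homOfLE hj')) (ih hj'))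
        have h₃ := happ e.hom c
        have h₄ : F.map (homOfLE hj) = F.map (homOfLE hj') ≫ σ _ ≫ e.hom := by
          rw [← he, ← F.map_comp]
          rfl
        rw [h₄, comp_app, comp_app]
        infer_instance
    | isSuccLimit j' hj' ih =>
      intro hj c hc
      obtain rfl | hlt := hj.eq_or_lt
      · have : F.map (homOfLE hj) = 𝟙 _ := F.map_id _
        rw [this]
        exact happ _ c
      · have hcol := isColimitOfPreserves (ev k M c) (F.isColimitOfIsWellOrderContinuous j' hj')
        have : Nonempty (Set.Iio j') := ⟨⟨j, hlt⟩⟩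
        have hconst : (((Set.principalSegIio j').monotone.functor ⋙ F) ⋙
            ev k M c).IsEventuallyConstantFrom ⟨j, hlt⟩ := fun l f => ih l.1 l.2 (leOfHom f) c hc
        exact hconst.isIso_ι_of_isColimit hcol
  have hfib : ∀ {j j' : κ.ord.ToType} (hj : j ≤ j') {c : C}, IsFibrantUpTo R 𝒜 (F.obj j) c →
      IsFibrantUpTo R 𝒜 (F.obj j') c := fun hj c hc =>
    hc.of_isIso (F.map (homOfLE hj)) (hiso _ _ hj)
  obtain ⟨j, hj⟩ : ∃ j : κ.ord.ToType, R.Psi ℬ (F.obj j) := by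
    by_contra! H
    choose c hc₁ hc₂ using fun j => hσnew (F.obj j) (H j)
    have hc₃ : ∀ j, IsFibrantUpTo R 𝒜 (F.obj (Order.succ j)) (c j) := fun j => by
      obtain ⟨e, -⟩ := hsucc j
      exact (hc₂ j).of_isIso e.hom fun d _ => happ _ d
    have hne : ∀ {j j' : κ.ord.ToType}, j < j' → c j ≠ c j' := fun {j j'} hlt he =>
      hc₁ j' (he ▸ hfib (Order.succ_le_of_lt hlt) (hc₃ j))
    have hinj : Function.Injective c := fun j j' he => by
      by_contra h
      obtain hlt | hlt := lt_or_gt_of_ne h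
      · exact hne hlt he
      · exact hne hlt he.symm
    have hle := Cardinal.mk_le_of_injective hinj
    rw [Cardinal.mk_ord_toType] at hle
    exact absurd (hle.trans (le_max_right ℵ₀ _)) (not_le.2 (Order.lt_succ _))
  refine ⟨F.obj j, (Φ.ιIterationFunctor κ.ord.ToType).app j, ?_, hj⟩
  have hprop : Φ.prop ≤ (reedyFibrations R 𝒜).llp := fun X Y f hf => by
    obtain ⟨_⟩ := hf
    exact hσ _
  exact MorphismProperty.comp_mem _ _ _ (MorphismProperty.of_isIso _ _)
    (((Φ.transfiniteCompositionOfShapeιIteration κ.ord.ToType).ofLE hprop).mem_map _)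

theorem isCompleteCotorsionPair_phi_psi (hA : IsCompleteCotorsionPair 𝒜 ℬ)
    (hgen : IsGenerating 𝒜) (hcogen : IsCogenerating ℬ) :
    IsCompleteCotorsionPair (D := LinearFunctorCategory k C M) (R.Phi 𝒜) (R.Psi ℬ) where
  toIsCotorsionPair := isCotorsionPair_phi_psi hA.toIsCotorsionPair hgen hcogen
  toHasApproximations := by
    refine hasApproximations_of_right (isCotorsionPair_phi_psi hA.toIsCotorsionPair hgen hcogen)
      (isGenerating_phi hA.toIsCotorsionPair hgen hcogen) fun N => ?_
    obtain ⟨Y, j, hj, hY⟩ := exists_llp_to_psi hA hgen hcogen N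
    obtain ⟨X, p, w, hX, hS⟩ := llp_reedyFibrations hA.toIsCotorsionPair hgen hcogen hj
    exact ⟨Y, X, j, p, w, hX, hY, hS⟩

end Complete

/-! ### Heredity -/

section Hereditary

variable [HasLimits M] [HasColimits M]

/-- The kernels of the matching maps of `Y` and `Z` form an epimorphism with kernel in `ℬ`, because
it has the right lifting property. -/
theorem psi_of_shortExact (hA : IsHereditaryCotorsionPair 𝒜 ℬ) (hgen : IsGenerating 𝒜)
    {X Y Z : LinearFunctorCategory k C M} {j : X ⟶ Y} {p : Y ⟶ Z} {w : j ≫ p = 0}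
    (hS : (ShortComplex.mk j p w).ShortExact) (hX : R.Psi ℬ X) (hY : R.Psi ℬ Y) :
    R.Psi ℬ Z := by
  have hcot := hA.toIsCotorsionPair
  have hp : reedyFibrations R 𝒜 p := reedyFibrations_of_shortExact hcot hgen hX hS
  intro c
  constructor
  · obtain ⟨A, g, hA', hg⟩ := hgen (R.matchingObj Z c)
    have h₀ := monoWithCokernel_from_zero hA' (isZero_zero M) 0
    obtain ⟨z, -, hz⟩ := MatchingFamily.exists_lift hp h₀ MatchingFamily.zero
      ((MatchingFamily.univ R Z c).precomp g) (fun d hd f => (isZero_zero M).eq_of_src _ _)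
    obtain ⟨l, -, hl⟩ := (hasLiftingProperty_matchingMap_iff Y c (0 : 0 ⟶ A)).1
      ((psi_iff hcot hgen Y).1 hY c _ h₀) 0 z (fun d hd f => (isZero_zero M).eq_of_src _ _)
    have : (l ≫ p.hom.app c) ≫ R.matchingMap Z c = g :=
      MatchingFamily.matchingObj_hom_ext fun d hd f => by
        rw [Category.assoc, Category.assoc, MatchingFamily.matchingMap_π, ← naturality_app,
          ← Category.assoc, hl, hz]
        rfl
    have : Epi ((l ≫ p.hom.app c) ≫ R.matchingMap Z c) := by rwa [this]
    exact epi_of_epi (l ≫ p.hom.app c) _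
  · have hker : ∀ {W : LinearFunctorCategory k C M} {T : M} (y : T ⟶ W.obj.obj c),
        y ≫ R.matchingMap W c = 0 ↔ ∀ d (_ : R.deg d < R.deg c) (f : R.minus.hom c d),
          y ≫ W.obj.map f.1 = 0 := fun {W T} y => by
      refine ⟨fun h d hd f => ?_, fun h =>
        MatchingFamily.matchingObj_hom_ext fun d hd f => ?_⟩
      · rw [← MatchingFamily.matchingMap_π hd, ← Category.assoc, h, zero_comp]
      · rw [Category.assoc, MatchingFamily.matchingMap_π, h d hd, zero_comp]
    let m : kernel (R.matchingMap Y c) ⟶ kernel (R.matchingMap Z c) :=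
      kernel.lift _ (kernel.ι _ ≫ p.hom.app c) ((hker _).2 fun d hd f => by
        rw [Category.assoc, ← naturality_app, ← Category.assoc,
          (hker _).1 (kernel.condition (R.matchingMap Y c)) d hd, zero_comp])
    have hm : m ≫ kernel.ι _ = kernel.ι _ ≫ p.hom.app c := kernel.lift_ι _ _ _
    have hrlp : (monoWithCokernel 𝒜).rlp m := fun A A' i hi => ⟨fun {a b} sq => by
      obtain ⟨l, hl₁, hl₂, hl₃⟩ := hp c i hi (a ≫ kernel.ι _) (b ≫ kernel.ι _)
        MatchingFamily.zero
        (by rw [← Category.assoc, ← sq.w, Category.assoc, hm, Category.assoc])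
        (fun d hd f => by
          rw [Category.assoc, (hker _).1 (kernel.condition (R.matchingMap Y c)) d hd, comp_zero]
          exact comp_zero)
        (fun d hd f => by
          rw [Category.assoc, (hker _).1 (kernel.condition (R.matchingMap Z c)) d hd, comp_zero]
          exact zero_comp)
      refine ⟨⟨⟨kernel.lift _ l ((hker l).2 hl₃), ?_, ?_⟩⟩⟩
      · rw [← cancel_mono (kernel.ι _), Category.assoc, kernel.lift_ι, hl₁]
      · rw [← cancel_mono (kernel.ι _), Category.assoc, hm, kernel.lift_ι_assoc, hl₂]⟩
    rw [hcot.rlp_monoWithCokernel hgen] at hrlp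
    obtain ⟨B, _, _, hB, hT⟩ := hrlp
    exact hA.of_shortExact hT hB (hY c).2

theorem isHereditaryCotorsionPair_phi_psi (hA : IsHereditaryCotorsionPair 𝒜 ℬ)
    (hgen : IsGenerating 𝒜) (hcogen : IsCogenerating ℬ) :
    IsHereditaryCotorsionPair (D := LinearFunctorCategory k C M) (R.Phi 𝒜) (R.Psi ℬ) :=
  isHereditaryCotorsionPair_of_shortExact
    (isCotorsionPair_phi_psi hA.toIsCotorsionPair hgen hcogen)
    (isCogenerating_psi hA.toIsCotorsionPair hgen hcogen)
    fun _ hS hX hY => psi_of_shortExact hA hgen hS hX hY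

end Hereditary

end

end LinearReedy

theorem mainTheorem1 {k : Type w} [Field k]
    {M : Type u} [Category.{v} M] [Abelian M] [Linear k M] [HasLimits M] [HasColimits M]
    {C : Type v} [Category.{v} C] [Preadditive C] [Linear k C] (R : ReedyStructure.{t} k C)
    (𝒜 ℬ : ObjectProperty M) (hcot : IsCotorsionPair 𝒜 ℬ)
    (hgen : IsGenerating 𝒜) (hcogen : IsCogenerating ℬ) :
    (IsCotorsionPair (R.Phi 𝒜) (R.Psi ℬ) ∧ IsGenerating (R.Phi 𝒜) ∧ IsCogenerating (R.Psi ℬ)) ∧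
    (IsCompleteCotorsionPair 𝒜 ℬ → IsCompleteCotorsionPair (R.Phi 𝒜) (R.Psi ℬ)) ∧
    (IsHereditaryCotorsionPair 𝒜 ℬ → IsHereditaryCotorsionPair (R.Phi 𝒜) (R.Psi ℬ)) := by
  exact ⟨⟨isCotorsionPair_phi_psi hcot hgen hcogen, isGenerating_phi hcot hgen hcogen,
    isCogenerating_psi hcot hgen hcogen⟩,
    fun h => isCompleteCotorsionPair_phi_psi h hgen hcogen,
    fun h => isHereditaryCotorsionPair_phi_psi h hgen hcogen⟩
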